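/- **Setting.** All objects are smooth ($C^\infty$) and manifolds are Hausdorff. Let $\pi\colon E\to M$ be a bundle (more generally a surjective submersion) with $\dim M=m$, $\dim E=m+n$, let $\eta\in\Omega^m(M)$ be a volume form, and let $\mathcal L=L\,(\bar\pi^2)^*\eta$ be a second-order Lagrangian density with $L\in C^\infty(J^2\pi)$, where $J^k\pi$ is the bundle of $k$-jets of local sections of $\pi$, $\bar\pi^k\colon J^k\pi\to M$. A chart $(x^i,u^\alpha)$ of $E$ adapted to $\pi$ gives natural coordinates $(x^i,u^\alpha_I)$, $|I|\le k$, on $J^k\pi$. Write $d^{m-1}x_i=i(\partial/\partial x^i)d^mx$, and $n(ij)=1$ if $i=j$, $n(ij)=2$ if $i\neq j$; repeated indices are summed. * $\Lambda^m_r(J^1\pi)$ is the bundle of $m$-forms on $J^1\pi$ that vanish when contracted with $r$ vectors vertical over $M$. $J^2\pi^\dagger\subset\Lambda^m_2(J^1\pi)$ consists of the forms $p\,d^mx+p^i_\alpha du^\alpha\wedge d^{m-1}x_i+p^{ij}_\alpha du^\alpha_i\wedge d^{m-1}x_j$ with $p^{ij}_\alpha=p^{ji}_\alpha$; one puts $p^{1_i+1_j}_\alpha=n(ij)\,p^{ij}_\alpha$.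 Let $J^2\pi^\ddagger=J^2\pi^\dagger/\Lambda^m_1(J^1\pi)$, with coordinates $(x^i,u^\alpha,u^\alpha_i,p^i_\alpha,p^I_\alpha)$, $|I|=2$. * $\mathcal W=J^3\pi\times_{J^1\pi}J^2\pi^\dagger$ and $\mathcal W_r=J^3\pi\times_{J^1\pi}J^2\pi^\ddagger$, with the quotient map $\mu_{\mathcal W}\colon\mathcal W\to\mathcal W_r$ and the projection $\rho^r_M\colon\mathcal W_r\to M$. For every $w\in\mathcal W_r$ there is exactly one $\hat h(w)=(j^3_x\phi,\theta)\in\mathcal W$ over $w$ such that $(j^1\phi)^*\theta=L(j^2_x\phi)\,\eta_x$. This defines the Hamiltonian section $\hat h\colon\mathcal W_r\to\mathcal W$. Put $\Theta_r=\hat h^*\Theta$ and $\Omega_r=-d\Theta_r\in\Omega^{m+1}(\mathcal W_r)$, where $\Theta$ is the pull-back to $\mathcal W$ of the tautological $m$-form of $J^2\pi^\dagger\subset\Lambda^m(J^1\pi)$. * $\mathcal W_{\mathcal L}\subset\mathcal W_r$ is the graph of the restricted Legendre map $\mathcal{FL}\colon J^3\pi\to J^2\pi^\ddagger$ over $J^1\pi$,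 given in natural coordinates, with $\mathcal L=\hat L\,d^mx$, by $$p^i_\alpha=\frac{\partial\hat L}{\partial u^\alpha_i}-\sum_{j=1}^m\frac1{n(ij)}\frac{d}{dx^j}\left(\frac{\partial\hat L}{\partial u^\alpha_{1_i+1_j}}\right),\qquad p^I_\alpha=\frac{\partial\hat L}{\partial u^\alpha_I}\quad(|I|=2),$$ where $d/dx^j$ is the coordinate total derivative. * A section $\psi$ of $\rho^r_M$ is holonomic if its component in $J^3\pi$ equals $j^3\phi$, where $\phi$ is the projection of $\psi$ to $E$. **Proposition.** Let $U\subseteq M$ be open and let $\psi\colon U\to\mathcal W_r$ be a smooth section of $\rho^r_M$ that is holonomic. Then $$\psi^*i(X)\Omega_r=0\quad\text{for every vector field }X\in\mathfrak X(\mathcal W_r)$$ if and only if $$\psi^*i(Y)\Omega_r=0\quad\text{for every vector field }Y\in\mathfrak X(\mathcal W_r)\text{ tangent to }\mathcal W_{\mathcal L}.$$ -/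

import Mathlib

open scoped Manifold ContDiff Topology

noncomputable section

namespace FieldTheory

/-! ### Symmetry of iterated derivatives -/

section Symmetry

variable {V F : Type*} [NormedAddCommGroup V] [NormedSpace ℝ V] [NormedAddCommGroup F]
  [NormedSpace ℝ F]

/-- Iterated directional derivatives along a list of vectors. -/
def dirDeriv (f : V → F) : List V → V → F
  | [] => f
  | v :: L => fun x => fderiv ℝ (dirDeriv f L) x v

theorem contDiffAt_dirDeriv {f : V → F} {x : V} (hf : ContDiffAt ℝ ∞ f x) (L : List V) :
    ContDiffAt ℝ ∞ (dirDeriv f L) x := by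
  induction L with
  | nil => exact hf
  | cons v L ih => exact (ih.fderiv_right (m := ∞) (by simp)).clm_apply contDiffAt_const

theorem iteratedFDeriv_eq_dirDeriv {f : V → F} {x : V} (hf : ∀ᶠ y in 𝓝 x, ContDiffAt ℝ ∞ f y)
    {l : ℕ} (v : Fin l → V) : iteratedFDeriv ℝ l f x v = dirDeriv f (List.ofFn v) x := by
  induction l generalizing x with
  | zero => simp [dirDeriv]
  | succ l ih =>
    have h1 : dirDeriv f (List.ofFn (fun i : Fin l => v i.succ)) =ᶠ[𝓝 x]
        fun y => iteratedFDeriv ℝ l f y (Fin.tail v) := by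
      filter_upwards [eventually_eventually_nhds.2 hf] with y hy
      exact (ih hy _).symm
    have h2 : DifferentiableAt ℝ (iteratedFDeriv ℝ l f) x :=
      (hf.self_of_nhds).differentiableAt_iteratedFDeriv
        (by exact_mod_cast ENat.natCast_lt_top l)
    rw [iteratedFDeriv_succ_apply_left, List.ofFn_succ]
    simp only [dirDeriv]
    rw [h1.fderiv_eq, fderiv_continuousMultilinear_apply_const_apply h2]

theorem dirDeriv_perm {f : V → F} {x : V} (hf : ∀ᶠ y in 𝓝 x, ContDiffAt ℝ ∞ f y)
    {L L' : List V} (h : L.Perm L') : dirDeriv f L =ᶠ[𝓝 x] dirDeriv f L' := by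
  induction h with
  | nil => rfl
  | cons v _ ih =>
    filter_upwards [ih.eventuallyEq_nhds] with y hy
    simp only [dirDeriv, hy.fderiv_eq]
  | swap v w L =>
    filter_upwards [hf] with y hy
    have h1 : ContDiffAt ℝ ∞ (dirDeriv f L) y := contDiffAt_dirDeriv hy L
    have h2 : DifferentiableAt ℝ (fderiv ℝ (dirDeriv f L)) y :=
      (h1.fderiv_right (m := ∞) (by simp)).differentiableAt (by simp)
    have h3 : IsSymmSndFDerivAt ℝ (dirDeriv f L) y :=
      h1.isSymmSndFDerivAt (by simp only [minSmoothness_of_isRCLikeNormedField]; exact WithTop.coe_le_coe.2 (le_top : (2 : ℕ∞) ≤ ⊤))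
    simp only [dirDeriv]
    rw [fderiv_clm_apply h2 (by simp), fderiv_clm_apply h2 (by simp)]
    simpa using h3.eq w v
  | trans _ _ h1 h2 => exact h1.trans h2

theorem iteratedFDeriv_perm {f : V → F} {x : V} (hf : ∀ᶠ y in 𝓝 x, ContDiffAt ℝ ∞ f y)
    {l : ℕ} (v w : Fin l → V) (h : (List.ofFn v).Perm (List.ofFn w)) :
    iteratedFDeriv ℝ l f x v = iteratedFDeriv ℝ l f x w := by
  rw [iteratedFDeriv_eq_dirDeriv hf, iteratedFDeriv_eq_dirDeriv hf]
  exact (dirDeriv_perm hf h).self_of_nhds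

end Symmetry

/-! ### Multi-indices and Taylor polynomials in coordinates -/

/-- The coordinate space `ℝᵐ`. -/
abbrev Rn (m : ℕ) : Type := EuclideanSpace ℝ (Fin m)

/-- The `i`-th vector of the standard basis. -/
abbrev stdVec {m : ℕ} (i : Fin m) : Rn m := EuclideanSpace.single i 1

/-- The multi-index `1_{f 0} + ⋯ + 1_{f (l-1)}` of length `l`.  A multi-index of length `l` in `m`
variables is a multiset of `l` elements of `{1, …, m}`, i.e. an element of `Sym (Fin m) l`. -/
def multiIdx {m l : ℕ} (f : Fin l → Fin m) : Sym (Fin m) l :=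
  ⟨(List.ofFn f : Multiset (Fin m)), by simp⟩

theorem multiIdx_surjective {m l : ℕ} :
    Function.Surjective (multiIdx : (Fin l → Fin m) → Sym (Fin m) l) := by
  rintro ⟨s, hs⟩
  induction s using Quotient.inductionOn with
  | h L =>
    subst hs
    exact ⟨fun i => L.get i, Subtype.ext (congrArg (fun l : List (Fin m) => (l : Multiset (Fin m)))
      (List.ofFn_get L))⟩

/-- An enumeration `(f 0, …, f (l-1))` of a multi-index of length `l`. -/
def enumIdx {m l : ℕ} (I : Sym (Fin m) l) : Fin l → Fin m :=
  Function.surjInv multiIdx_surjective I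

theorem multiIdx_enumIdx {m l : ℕ} (I : Sym (Fin m) l) : multiIdx (enumIdx I) = I :=
  Function.surjInv_eq multiIdx_surjective I

theorem multiIdx_eq_iff {m l : ℕ} (f g : Fin l → Fin m) :
    multiIdx f = multiIdx g ↔ (List.ofFn f).Perm (List.ofFn g) := by
  exact Subtype.ext_iff.trans Multiset.coe_eq_coe

/-- The partial derivative `∂^{|I|} s / ∂x^I` at `x`. -/
def partialDeriv {m n l : ℕ} (I : Sym (Fin m) l) (s : Rn m → Rn n) (x : Rn m) : Rn n :=
  iteratedFDeriv ℝ l s x fun a => stdVec (enumIdx I a)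

/-- The multi-indices of length at most `k`. -/
abbrev JetIdx (m k : ℕ) : Type := Σ l : Fin (k + 1), Sym (Fin m) (l : ℕ)

/-- The space of natural coordinates `(xⁱ, u_I^α)`, `0 ≤ |I| ≤ k`, of a `k`-th order jet bundle. -/
abbrev JetCoord (m n k : ℕ) : Type := Rn m × (JetIdx m k → Rn n)

/-- The multi-index of length `0`, so that `z.2 idx0` are the coordinates `u^α`. -/
def idx0 {m k : ℕ} : JetIdx m k := ⟨0, Sym.nil⟩

/-- Forgetting the coordinates `u_I^α` with `|I| > l`. -/
def JetCoord.trunc {m n k : ℕ} (l : ℕ) (h : l ≤ k) (z : JetCoord m n k) : JetCoord m n l :=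
  (z.1, fun I => z.2 ⟨I.1.castLE (by omega), I.2⟩)

/-- The symmetric `l`-linear map with components `u_I`, `|I| = l`. -/
def symMultilinear {m n l : ℕ} (u : Sym (Fin m) l → Rn n) : Rn m [×l]→L[ℝ] Rn n :=
  ∑ f : Fin l → Fin m,
    ((ContinuousMultilinearMap.mkPiAlgebraFin ℝ l ℝ).compContinuousLinearMap
      fun a => (EuclideanSpace.proj (f a) : Rn m →L[ℝ] ℝ)).smulRight (u (multiIdx f))

theorem symMultilinear_apply {m n l : ℕ} (u : Sym (Fin m) l → Rn n) (v : Fin l → Rn m) :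
    symMultilinear u v = ∑ f : Fin l → Fin m, (∏ a, v a (f a)) • u (multiIdx f) := by
  simp [symMultilinear, List.prod_ofFn]

theorem symMultilinear_std {m n l : ℕ} (u : Sym (Fin m) l → Rn n) (f : Fin l → Fin m) :
    symMultilinear u (fun a => stdVec (f a)) = u (multiIdx f) := by
  rw [symMultilinear_apply, Finset.sum_eq_single f]
  · simp
  · intro g _ hg
    obtain ⟨a, ha⟩ := Function.ne_iff.1 hg
    rw [Finset.prod_eq_zero (Finset.mem_univ a) (by simp [ha]), zero_smul]
  · simp

theorem symMultilinear_perm {m n l : ℕ} (u : Sym (Fin m) l → Rn n) (v : Fin l → Rn m)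
    (σ : Equiv.Perm (Fin l)) : symMultilinear u (fun a => v (σ a)) = symMultilinear u v := by
  rw [symMultilinear_apply, symMultilinear_apply,
    ← Equiv.sum_comp (Equiv.arrowCongr σ (Equiv.refl (Fin m)))
      fun f => (∏ a, v a (f a)) • u (multiIdx f)]
  refine Finset.sum_congr rfl fun f _ => ?_
  have h1 : multiIdx (Equiv.arrowCongr σ (Equiv.refl (Fin m)) f) = multiIdx f := by
    rw [multiIdx_eq_iff]
    exact Equiv.Perm.ofFn_comp_perm σ.symm f
  rw [h1, ← Equiv.prod_comp σ fun a => v a (Equiv.arrowCongr σ (Equiv.refl (Fin m)) f a)]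
  simp

/-- The Taylor polynomial at `z.1` whose derivatives `u_I` are prescribed by `z`. -/
def taylorPoly {m n k : ℕ} (z : JetCoord m n k) (y : Rn m) : Rn n :=
  ∑ l : Fin (k + 1), ((l : ℕ).factorial : ℝ)⁻¹ •
    symMultilinear (fun I => z.2 ⟨l, I⟩) fun _ => y - z.1

theorem contDiff_taylorPoly {m n k : ℕ} {N : WithTop ℕ∞} :
    ContDiff ℝ N fun q : JetCoord m n k × Rn m => taylorPoly q.1 q.2 := by
  unfold taylorPoly
  simp only [symMultilinear_apply]
  fun_prop

theorem contDiff_taylorPoly_apply {m n k : ℕ} {N : WithTop ℕ∞} (z : JetCoord m n k) :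
    ContDiff ℝ N (taylorPoly z) := by
  have h : ContDiff ℝ N fun y => taylorPoly z y := by
    unfold taylorPoly
    simp only [symMultilinear_apply]
    fun_prop
  exact h

/-- The Taylor polynomial as a power series. -/
def taylorSeries {m n k : ℕ} (z : JetCoord m n k) : FormalMultilinearSeries ℝ (Rn m) (Rn n) :=
  fun l => if h : l < k + 1 then
    symMultilinear (fun I => (l.factorial : ℝ)⁻¹ • z.2 ⟨⟨l, h⟩, I⟩) else 0

theorem taylorSeries_apply {m n k l : ℕ} (z : JetCoord m n k) (hl : l < k + 1)
    (v : Fin l → Rn m) : taylorSeries z l v =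
      (l.factorial : ℝ)⁻¹ • symMultilinear (fun I => z.2 ⟨⟨l, hl⟩, I⟩) v := by
  rw [taylorSeries, dif_pos hl, symMultilinear_apply, symMultilinear_apply, Finset.smul_sum]
  exact Finset.sum_congr rfl fun f _ => smul_comm _ _ _

theorem hasSeries_taylorPoly {m n k : ℕ} (z : JetCoord m n k) :
    HasFiniteFPowerSeriesOnBall (taylorPoly z) (taylorSeries z) z.1 (k + 1) ⊤ := by
  refine HasFiniteFPowerSeriesOnBall.mk' (fun j hj => dif_neg (Nat.not_lt.2 hj)) (by simp) ?_
  intro y _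
  rw [Finset.sum_range, taylorPoly]
  refine Finset.sum_congr rfl fun l _ => ?_
  rw [taylorSeries_apply z l.2, add_sub_cancel_left]

theorem iteratedFDeriv_taylorPoly {m n k l : ℕ} (z : JetCoord m n k) (hl : l < k + 1) :
    iteratedFDeriv ℝ l (taylorPoly z) z.1 = symMultilinear fun I => z.2 ⟨⟨l, hl⟩, I⟩ := by
  ext1 v
  rw [(hasSeries_taylorPoly z).toHasFPowerSeriesOnBall.iteratedFDeriv_eq_sum_of_completeSpace]
  simp only [taylorSeries_apply z hl, symMultilinear_perm]
  rw [Finset.sum_const, Finset.card_univ, Fintype.card_perm, Fintype.card_fin,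
    ← Nat.cast_smul_eq_nsmul ℝ, smul_smul, mul_inv_cancel₀ (by positivity), one_smul]

theorem partialDeriv_taylorPoly {m n k : ℕ} (z : JetCoord m n k) (I : JetIdx m k) :
    partialDeriv I.2 (taylorPoly z) z.1 = z.2 I := by
  rw [partialDeriv, iteratedFDeriv_taylorPoly z I.1.2, symMultilinear_std, multiIdx_enumIdx]

theorem taylorPoly_self {m n k : ℕ} (z : JetCoord m n k) : taylorPoly z z.1 = z.2 idx0 := by
  have := partialDeriv_taylorPoly z idx0
  exact (iteratedFDeriv_zero_apply (𝕜 := ℝ) _).symm.trans this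

/-- The iterated derivatives are determined by the partial derivatives. -/
theorem iteratedFDeriv_eq_symMultilinear {m n l : ℕ} {s : Rn m → Rn n} {x : Rn m}
    (hs : ∀ᶠ y in 𝓝 x, ContDiffAt ℝ ∞ s y) :
    iteratedFDeriv ℝ l s x = symMultilinear fun I => partialDeriv I s x := by
  apply ContinuousMultilinearMap.toMultilinearMap_injective
  refine Module.Basis.ext_multilinear
    (fun _ => (EuclideanSpace.basisFun (Fin m) ℝ).toBasis) fun v => ?_
  simp only [OrthonormalBasis.coe_toBasis, EuclideanSpace.basisFun_apply,
    ContinuousMultilinearMap.coe_coe]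
  rw [symMultilinear_std, partialDeriv]
  refine iteratedFDeriv_perm hs _ _ ?_
  have := (multiIdx_eq_iff _ _).1 (multiIdx_enumIdx (multiIdx v))
  simpa [List.map_ofFn, Function.comp_def] using (this.map stdVec).symm

/-- Smoothness of iterated derivatives with parameters. -/
theorem contDiffAt_iteratedFDeriv_param {A V F : Type*} [NormedAddCommGroup A] [NormedSpace ℝ A]
    [NormedAddCommGroup V] [NormedSpace ℝ V] [NormedAddCommGroup F] [NormedSpace ℝ F]
    {f : A → V → F} {a : A} {x : V} (hf : ContDiffAt ℝ ∞ (Function.uncurry f) (a, x)) (l : ℕ) :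
    ContDiffAt ℝ ∞ (fun q : A × V => iteratedFDeriv ℝ l (f q.1) q.2) (a, x) := by
  induction l with
  | zero =>
    simp only [iteratedFDeriv_zero_eq_comp, Function.comp_def]
    exact (continuousMultilinearCurryFin0 ℝ V F).symm.contDiff.contDiffAt.comp _ hf
  | succ l ih =>
    simp only [iteratedFDeriv_succ_eq_comp_left, Function.comp_def]
    refine ContDiffAt.continuousLinearMap_comp
      (f := fun q : A × V => fderiv ℝ (iteratedFDeriv ℝ l (f q.1)) q.2)
      ((continuousMultilinearCurryLeftEquiv ℝ (fun _ : Fin (l + 1) => V) F).symm :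
        _ →L[ℝ] V [×(l + 1)]→L[ℝ] F) ?_
    refine ContDiffAt.fderiv (n := ∞) (f := fun q : A × V => iteratedFDeriv ℝ l (f q.1))
      (g := Prod.snd) ?_ contDiffAt_snd (by simp)
    exact ih.comp ((a, x), x) (f := fun q : (A × V) × V => (q.1.1, q.2)) (by fun_prop)


/-! ### Fibred manifolds and adapted charts -/

section Fibered

variable {m n : ℕ} {M E : Type*}
  [TopologicalSpace M] [ChartedSpace (Rn m) M] [TopologicalSpace E] [ChartedSpace (Rn (m + n)) E]

/-- A fibred manifold `π : E → M` (a surjective submersion) with `dim M = m`, `dim E = m + n`.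
Every smooth fibre bundle is one. -/
structure FiberedManifold (m n : ℕ) (M E : Type*)
    [TopologicalSpace M] [ChartedSpace (Rn m) M]
    [TopologicalSpace E] [ChartedSpace (Rn (m + n)) E] where
  proj : E → M
  isSubmersion : Manifold.IsSubmersion (𝓡 (m + n)) (𝓡 m) ∞ proj
  surjective : Function.Surjective proj

/-- A chart `(xⁱ, u^α)` of `E` adapted to `π`, over a chart `(xⁱ)` of `M`. -/
structure FiberedChart (π : FiberedManifold m n M E) where
  chart : OpenPartialHomeomorph E (Rn m × Rn n)
  base : OpenPartialHomeomorph M (Rn m)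
  smooth_chart : ContMDiffOn (𝓡 (m + n)) 𝓘(ℝ, Rn m × Rn n) ∞ chart chart.source
  smooth_chart_symm : ContMDiffOn 𝓘(ℝ, Rn m × Rn n) (𝓡 (m + n)) ∞ chart.symm chart.target
  smooth_base : ContMDiffOn (𝓡 m) (𝓡 m) ∞ base base.source
  smooth_base_symm : ContMDiffOn (𝓡 m) (𝓡 m) ∞ base.symm base.target
  proj_mem : ∀ e ∈ chart.source, π.proj e ∈ base.source
  fst_chart : ∀ e ∈ chart.source, (chart e).1 = base (π.proj e)

variable (π : FiberedManifold m n M E)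

/-- `φ` is a smooth section of `π` in a neighbourhood of `x`. -/
def IsSectionAt (φ : M → E) (x : M) : Prop :=
  ∀ᶠ y in 𝓝 x, ContMDiffAt (𝓡 m) (𝓡 (m + n)) ∞ φ y ∧ π.proj (φ y) = y

/-- A local section of `π` around the point `pt`. -/
structure LocalSection where
  pt : M
  toFun : M → E
  isSection : IsSectionAt π toFun pt

variable {π}

theorem IsSectionAt.proj_eq {φ : M → E} {x : M} (h : IsSectionAt π φ x) : π.proj (φ x) = x :=
  h.self_of_nhds.2

theorem IsSectionAt.continuousAt {φ : M → E} {x : M} (h : IsSectionAt π φ x) :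
    ContinuousAt φ x :=
  h.self_of_nhds.1.continuousAt

namespace FiberedChart

variable (c d : FiberedChart π)

theorem fst_mem_target {z : Rn m × Rn n} (hz : z ∈ c.chart.target) : z.1 ∈ c.base.target := by
  have h := c.fst_chart _ (c.chart.map_target hz)
  rw [c.chart.right_inv hz] at h
  rw [h]
  exact c.base.map_source (c.proj_mem _ (c.chart.map_target hz))

theorem proj_chart_symm {z : Rn m × Rn n} (hz : z ∈ c.chart.target) :
    π.proj (c.chart.symm z) = c.base.symm z.1 := by
  have h := c.fst_chart _ (c.chart.map_target hz)
  rw [c.chart.right_inv hz] at h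
  rw [h, c.base.left_inv (c.proj_mem _ (c.chart.map_target hz))]

/-- The coordinate expression `u^α = φ^α(x)` of a section. -/
def rep (φ : M → E) (x : Rn m) : Rn n := (c.chart (φ (c.base.symm x))).2

theorem base_mem {φ : M → E} {x : M} (h : IsSectionAt π φ x) (hc : φ x ∈ c.chart.source) :
    x ∈ c.base.source := by
  have := c.proj_mem _ hc
  rwa [h.proj_eq] at this

theorem chart_eq {φ : M → E} {x : M} (h : IsSectionAt π φ x) (hc : φ x ∈ c.chart.source) :
    c.chart (φ x) = (c.base x, c.rep φ (c.base x)) := by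
  refine Prod.ext ?_ ?_
  · rw [c.fst_chart _ hc, h.proj_eq]
  · rw [rep, c.base.left_inv (c.base_mem h hc)]

theorem eventually_section {φ : M → E} {x : M} (h : IsSectionAt π φ x)
    (hc : φ x ∈ c.chart.source) :
    ∀ᶠ y in 𝓝 x, IsSectionAt π φ y ∧ φ y ∈ c.chart.source :=
  (eventually_eventually_nhds.2 h).and
    (h.continuousAt.eventually (c.chart.open_source.mem_nhds hc))

theorem eventually_base_symm {x : M} (hx : x ∈ c.base.source) {P : M → Prop}
    (h : ∀ᶠ y in 𝓝 x, P y) :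
    ∀ᶠ y in 𝓝 (c.base x), y ∈ c.base.target ∧ P (c.base.symm y) := by
  refine Filter.Eventually.and (c.base.open_target.mem_nhds (c.base.map_source hx)) ?_
  have h2 := c.base.continuousAt_symm (c.base.map_source hx)
  rw [ContinuousAt, c.base.left_inv hx] at h2
  exact h2.eventually h

theorem rep_smooth {φ : M → E} {x : M} (h : IsSectionAt π φ x) (hc : φ x ∈ c.chart.source) :
    ∀ᶠ y in 𝓝 (c.base x), ContDiffAt ℝ ∞ (c.rep φ) y := by
  filter_upwards [c.eventually_base_symm (c.base_mem h hc) (c.eventually_section h hc)]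
    with y ⟨hy, hs, hm⟩
  rw [← contMDiffAt_iff_contDiffAt]
  have h1 : ContMDiffAt (𝓡 m) (𝓡 m) ∞ c.base.symm y :=
    c.smooth_base_symm.contMDiffAt (c.base.open_target.mem_nhds hy)
  have h2 := hs.self_of_nhds.1.comp y h1
  have h3 : ContMDiffAt (𝓡 (m + n)) 𝓘(ℝ, Rn m × Rn n) ∞ c.chart (φ (c.base.symm y)) :=
    c.smooth_chart.contMDiffAt (c.chart.open_source.mem_nhds hm)
  have h4 := h3.comp y h2
  exact (contDiff_snd.contMDiff.contMDiffAt).comp y h4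

/-- The change of charts on `E`, from `c` to `d`. -/
def trans (z : Rn m × Rn n) : Rn m × Rn n := d.chart (c.chart.symm z)

/-- The change of charts on `M`, from `c` to `d`. -/
def transBase (x : Rn m) : Rn m := d.base (c.base.symm x)

/-- The domain of the change of charts on `E`. -/
def overlap : Set (Rn m × Rn n) := (c.chart.symm.trans d.chart).source

theorem mem_overlap {z : Rn m × Rn n} :
    z ∈ c.overlap d ↔ z ∈ c.chart.target ∧ c.chart.symm z ∈ d.chart.source := by
  simp [overlap]

theorem isOpen_overlap : IsOpen (c.overlap d) := (c.chart.symm.trans d.chart).open_source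

theorem trans_smooth {z : Rn m × Rn n} (hz : z ∈ c.overlap d) :
    ContDiffAt ℝ ∞ (c.trans d) z := by
  rw [mem_overlap] at hz
  rw [← contMDiffAt_iff_contDiffAt]
  have h1 : ContMDiffAt _ _ ∞ c.chart.symm z :=
    c.smooth_chart_symm.contMDiffAt (c.chart.open_target.mem_nhds hz.1)
  have h3 : ContMDiffAt _ _ ∞ d.chart (c.chart.symm z) :=
    d.smooth_chart.contMDiffAt (d.chart.open_source.mem_nhds hz.2)
  exact h3.comp z h1

theorem transBase_smooth {x : M} (hc : x ∈ c.base.source) (hd : x ∈ d.base.source) :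
    ContDiffAt ℝ ∞ (c.transBase d) (c.base x) := by
  rw [← contMDiffAt_iff_contDiffAt]
  have h1 : ContMDiffAt _ _ ∞ c.base.symm (c.base x) :=
    c.smooth_base_symm.contMDiffAt (c.base.open_target.mem_nhds (c.base.map_source hc))
  have h3 : ContMDiffAt _ _ ∞ d.base (c.base.symm (c.base x)) :=
    d.smooth_base.contMDiffAt (d.base.open_source.mem_nhds (by rwa [c.base.left_inv hc]))
  exact h3.comp _ h1

theorem transBase_base {x : M} (hc : x ∈ c.base.source) : c.transBase d (c.base x) = d.base x := by
  rw [transBase, c.base.left_inv hc]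

/-- Change of the coordinate expression of a section. -/
theorem rep_change {φ : M → E} {x : M} (h : IsSectionAt π φ x) (hc : φ x ∈ c.chart.source)
    (hd : φ x ∈ d.chart.source) : d.rep φ =ᶠ[𝓝 (d.base x)]
      fun y => (c.trans d (d.transBase c y, c.rep φ (d.transBase c y))).2 := by
  filter_upwards [d.eventually_base_symm (d.base_mem h hd) (c.eventually_section h hc)]
    with y ⟨_, hs, hm⟩
  simp only [rep, trans, transBase]
  rw [c.base.left_inv (c.base_mem hs hm)]
  have h5 := c.chart_eq hs hm
  rw [rep, c.base.left_inv (c.base_mem hs hm)] at h5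
  rw [← h5, c.chart.left_inv hm]

end FiberedChart

theorem taylorComp_congr {V F G : Type*} [NormedAddCommGroup V] [NormedSpace ℝ V]
    [NormedAddCommGroup F] [NormedSpace ℝ F] [NormedAddCommGroup G] [NormedSpace ℝ G]
    {q : FormalMultilinearSeries ℝ F G} {p p' : FormalMultilinearSeries ℝ V F} {i : ℕ}
    (h : ∀ j ≤ i, p j = p' j) : q.taylorComp p i = q.taylorComp p' i := by
  refine Finset.sum_congr rfl fun c _ => ?_
  have h' : (fun i => p (c.partSize i)) = fun i => p' (c.partSize i) :=
    funext fun i => h _ (c.partSize_le i)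
  exact congrArg (fun r => c.compAlongOrderedFinpartition (q c.length) r) h'

theorem taylorComp_congr_left {V F G : Type*} [NormedAddCommGroup V] [NormedSpace ℝ V]
    [NormedAddCommGroup F] [NormedSpace ℝ F] [NormedAddCommGroup G] [NormedSpace ℝ G]
    {q q' : FormalMultilinearSeries ℝ F G} {p : FormalMultilinearSeries ℝ V F} {i : ℕ}
    (h : ∀ j ≤ i, q j = q' j) : q.taylorComp p i = q'.taylorComp p i := by
  refine Finset.sum_congr rfl fun c _ => ?_
  simp only [FormalMultilinearSeries.compAlongOrderedFinpartition, h _ c.length_le]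

/-- Jets of sections change under a change of charts in a way depending on the jet only. -/
theorem FiberedChart.iteratedFDeriv_rep_congr (c d : FiberedChart π) {k : ℕ} {φ χ : M → E} {x : M}
    (hφ : IsSectionAt π φ x) (hχ : IsSectionAt π χ x) (h0 : φ x = χ x)
    (hc : φ x ∈ c.chart.source) (hd : φ x ∈ d.chart.source)
    (h : ∀ l ≤ k, iteratedFDeriv ℝ l (c.rep φ) (c.base x) = iteratedFDeriv ℝ l (c.rep χ) (c.base x))
    {l : ℕ} (hl : l ≤ k) :
    iteratedFDeriv ℝ l (d.rep φ) (d.base x) = iteratedFDeriv ℝ l (d.rep χ) (d.base x) := by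
  rw [((c.rep_change d hφ hc hd).iteratedFDeriv ℝ l).self_of_nhds,
    ((c.rep_change d hχ (h0 ▸ hc) (h0 ▸ hd)).iteratedFDeriv ℝ l).self_of_nhds]
  have key : ∀ s : M → E, IsSectionAt π s x → s x ∈ c.chart.source → s x ∈ d.chart.source →
      iteratedFDeriv ℝ l
        (fun y => (c.trans d (d.transBase c y, c.rep s (d.transBase c y))).2) (d.base x) =
      ((ftaylorSeries ℝ (fun z => (c.trans d z).2) (c.chart (s x))).taylorComp
        (ftaylorSeries ℝ (fun y => (y, c.rep s y)) (c.base x))).taylorComp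
          (ftaylorSeries ℝ (d.transBase c) (d.base x)) l := by
    intro s hs hsc hsd
    have hT : ContDiffAt ℝ ∞ (d.transBase c) (d.base x) :=
      d.transBase_smooth c (d.base_mem hs hsd) (c.base_mem hs hsc)
    have hTx : d.transBase c (d.base x) = c.base x := d.transBase_base c (d.base_mem hs hsd)
    have hr : ContDiffAt ℝ ∞ (fun y => (y, c.rep s y)) (c.base x) :=
      contDiffAt_id.prodMk (c.rep_smooth hs hsc).self_of_nhds
    have hg : ContDiffAt ℝ ∞ (fun z => (c.trans d z).2) (c.chart (s x)) := by
      refine contDiffAt_snd.comp _ (c.trans_smooth d ?_)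
      rw [c.mem_overlap d, c.chart.left_inv hsc]
      exact ⟨c.chart.map_source hsc, hsd⟩
    have he := c.chart_eq hs hsc
    rw [he] at hg ⊢
    have hgr := hg.comp (c.base x) hr
    have h1 := iteratedFDeriv_comp (i := l) (g := (fun z => (c.trans d z).2) ∘ fun y => (y, c.rep s y))
      (by rw [hTx]; exact hgr) hT (by exact_mod_cast le_top)
    refine h1.trans (taylorComp_congr_left fun j _ => ?_)
    rw [hTx]
    exact iteratedFDeriv_comp (f := fun y => (y, c.rep s y)) hg hr (by exact_mod_cast le_top)
  rw [key φ hφ hc hd, key χ hχ (h0 ▸ hc) (h0 ▸ hd), h0]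
  refine taylorComp_congr_left fun j hj => taylorComp_congr fun i hi => ?_
  have hl : ((i : ℕ) : WithTop ℕ∞) ≤ ∞ := by exact_mod_cast le_top
  simp only [ftaylorSeries]
  rw [iteratedFDeriv_prodMk (f := fun y => y) contDiffAt_id (c.rep_smooth hφ hc).self_of_nhds hl,
    iteratedFDeriv_prodMk (f := fun y => y) contDiffAt_id (c.rep_smooth hχ (h0 ▸ hc)).self_of_nhds hl,
    h i (hi.trans (hj.trans ‹_›))]

end Fibered

/-! ### Jet spaces as smooth manifolds -/

theorem isManifold_of_core {H : Type*} [NormedAddCommGroup H] [NormedSpace ℝ H] {S : Type*}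
    (C : ChartedSpaceCore H S)
    (h : ∀ e ∈ C.atlas, ∀ e' ∈ C.atlas, ContDiffOn ℝ ∞ (e.symm.trans e') (e.symm.trans e').source) :
    @IsManifold ℝ _ H _ _ H _ 𝓘(ℝ, H) ∞ S C.toTopologicalSpace C.toChartedSpace := by
  let := C.toTopologicalSpace
  let := C.toChartedSpace
  apply isManifold_of_contDiffOn
  intro e e' he he'
  obtain ⟨_, ⟨e0, rfl⟩, hx⟩ := he
  obtain ⟨_, ⟨h0, rfl⟩, hx0⟩ := hx
  obtain ⟨_, ⟨e1, rfl⟩, hx⟩ := he'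
  obtain ⟨_, ⟨h1, rfl⟩, hx1⟩ := hx
  rw [Set.mem_singleton_iff] at hx0 hx1
  subst hx0 hx1
  exact (h e0 h0 e1 h1).mono fun x hx => hx.1

section Jets

set_option linter.unusedSectionVars false

variable {m n : ℕ} {M E : Type*}
  [TopologicalSpace M] [ChartedSpace (Rn m) M] [TopologicalSpace E] [ChartedSpace (Rn (m + n)) E]
  (π : FiberedManifold m n M E)

/-- Two local sections have the same `k`-jet if they agree at the same point together with all
their partial derivatives up to order `k` (in every adapted chart). -/
def jetSetoid (k : ℕ) : Setoid (LocalSection π) where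
  r s t := s.pt = t.pt ∧ s.toFun s.pt = t.toFun t.pt ∧
    ∀ c : FiberedChart π, s.toFun s.pt ∈ c.chart.source → ∀ l ≤ k,
      iteratedFDeriv ℝ l (c.rep s.toFun) (c.base s.pt) =
        iteratedFDeriv ℝ l (c.rep t.toFun) (c.base t.pt)
  iseqv :=
    { refl := fun _ => ⟨rfl, rfl, fun _ _ _ _ => rfl⟩
      symm := fun h => ⟨h.1.symm, h.2.1.symm, fun c hc l hl => (h.2.2 c (h.2.1 ▸ hc) l hl).symm⟩
      trans := fun h h' => ⟨h.1.trans h'.1, h.2.1.trans h'.2.1, fun c hc l hl =>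
        (h.2.2 c hc l hl).trans (h'.2.2 c (h.2.1 ▸ hc) l hl)⟩ }

/-- The `k`-th order jet bundle `Jᵏπ`. -/
def JetSpace (k : ℕ) : Type _ := Quotient (jetSetoid π k)

variable {π}

/-- The `k`-jet `jᵏ_x φ`. -/
def jet (k : ℕ) {φ : M → E} {x : M} (h : IsSectionAt π φ x) : JetSpace π k :=
  Quotient.mk (jetSetoid π k) ⟨x, φ, h⟩

namespace JetSpace

variable {k : ℕ}

/-- A local section representing a jet. -/
def repr (j : JetSpace π k) : LocalSection π := Quotient.out (s := jetSetoid π k) j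

theorem jet_repr (j : JetSpace π k) : jet k j.repr.isSection = j :=
  Quotient.out_eq (s := jetSetoid π k) j

theorem repr_jet {φ : M → E} {x : M} (h : IsSectionAt π φ x) :
    (jetSetoid π k).r (jet k h).repr ⟨x, φ, h⟩ :=
  Quotient.mk_out (s := jetSetoid π k) (⟨x, φ, h⟩ : LocalSection π)

/-- The projection `π̄ᵏ : Jᵏπ → M`. -/
def toBase : JetSpace π k → M := Quotient.lift (fun s => s.pt) fun _ _ h => h.1

/-- The projection `πᵏ : Jᵏπ → E`. -/
def toE : JetSpace π k → E := Quotient.lift (fun s => s.toFun s.pt) fun _ _ h => h.2.1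

/-- The projection `πᵏ_l : Jᵏπ → Jˡπ` for `l ≤ k`. -/
def proj (l : ℕ) (hl : l ≤ k) : JetSpace π k → JetSpace π l :=
  Quotient.map' id fun _ _ h =>
    ⟨h.1, h.2.1, fun c hc i hi => h.2.2 c hc i (hi.trans hl)⟩

@[simp] theorem toBase_jet {φ : M → E} {x : M} (h : IsSectionAt π φ x) :
    (jet k h).toBase = x := rfl

@[simp] theorem toE_jet {φ : M → E} {x : M} (h : IsSectionAt π φ x) :
    (jet k h).toE = φ x := rfl

@[simp] theorem proj_jet {φ : M → E} {x : M} (h : IsSectionAt π φ x) (l : ℕ) (hl : l ≤ k) :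
    (jet k h).proj l hl = jet l h := rfl

theorem exists_jet (j : JetSpace π k) :
    ∃ (φ : M → E) (x : M) (h : IsSectionAt π φ x), j = jet k h :=
  ⟨_, _, _, j.jet_repr.symm⟩

end JetSpace

theorem jet_eq {k : ℕ} {φ χ : M → E} {x x' : M} (hφ : IsSectionAt π φ x)
    (hχ : IsSectionAt π χ x') (hx : x = x')
    (c : FiberedChart π) (h0 : φ x = χ x') (hc : φ x ∈ c.chart.source)
    (h : ∀ I : JetIdx m k,
      partialDeriv I.2 (c.rep φ) (c.base x) = partialDeriv I.2 (c.rep χ) (c.base x')) :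
    jet k hφ = jet k hχ := by
  subst hx
  refine Quotient.sound (s := jetSetoid π k) ⟨rfl, h0, fun d hd l hl => ?_⟩
  refine c.iteratedFDeriv_rep_congr d hφ hχ h0 hc hd (fun i hi => ?_) hl
  rw [iteratedFDeriv_eq_symMultilinear (c.rep_smooth hφ hc),
    iteratedFDeriv_eq_symMultilinear (c.rep_smooth hχ (h0 ▸ hc))]
  exact congrArg symMultilinear (funext fun I => h ⟨⟨i, by omega⟩, I⟩)

namespace FiberedChart

theorem exists_mem [IsManifold (𝓡 m) ∞ M] [IsManifold (𝓡 (m + n)) ∞ E]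
    (π : FiberedManifold m n M E) (e : E) : ∃ c : FiberedChart π, e ∈ c.chart.source := by
  obtain ⟨F, _, _, hF⟩ := π.isSubmersion
  obtain ⟨φ, ψ, h1, h2, h3, h4, h5, A, h6⟩ := hF e
  have : FiniteDimensional ℝ (Rn m × F) := A.toLinearEquiv.finiteDimensional
  have : FiniteDimensional ℝ F := Module.Finite.of_surjective (LinearMap.snd ℝ (Rn m) F)
    LinearMap.snd_surjective
  have hdim : Module.finrank ℝ F = Module.finrank ℝ (Rn n) := by
    have := A.toLinearEquiv.finrank_eq
    simp only [finrank_euclideanSpace_fin, Module.finrank_prod] at this ⊢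
    omega
  let B : Rn (m + n) ≃L[ℝ] Rn m × Rn n :=
    A.trans ((ContinuousLinearEquiv.refl ℝ (Rn m)).prodCongr (ContinuousLinearEquiv.ofFinrankEq hdim))
  have hB : ContMDiff (𝓡 (m + n)) 𝓘(ℝ, Rn m × Rn n) ∞ B := B.contDiff.contMDiff
  have hB' : ContMDiff 𝓘(ℝ, Rn m × Rn n) (𝓡 (m + n)) ∞ B.symm := B.symm.contDiff.contMDiff
  refine ⟨{
    chart := φ.transHomeomorph B.toHomeomorph
    base := ψ
    smooth_chart := hB.comp_contMDiffOn (contMDiffOn_of_mem_maximalAtlas h3)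
    smooth_chart_symm := (contMDiffOn_symm_of_mem_maximalAtlas h3).comp hB'.contMDiffOn
      fun x hx => hx
    smooth_base := contMDiffOn_of_mem_maximalAtlas h4
    smooth_base_symm := contMDiffOn_symm_of_mem_maximalAtlas h4
    proj_mem := fun e he => h5 he
    fst_chart := fun e he => ?_ }, h1⟩
  have := h6 (x := φ e) (by simpa using φ.map_source he)
  simp [φ.left_inv he] at this
  simp [B, this]

variable (c d : FiberedChart π) {k : ℕ}

/-- The natural coordinates `(xⁱ, u_I^α)` of a jet. -/
def jetCoords (j : JetSpace π k) : JetCoord m n k :=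
  (c.base j.repr.pt, fun I => partialDeriv I.2 (c.rep j.repr.toFun) (c.base j.repr.pt))

theorem jetCoords_jet {φ : M → E} {x : M} (h : IsSectionAt π φ x) (hc : φ x ∈ c.chart.source) :
    c.jetCoords (jet k h) =
      (c.base x, fun I => partialDeriv I.2 (c.rep φ) (c.base x)) := by
  obtain ⟨h1, h2, h3⟩ := JetSpace.repr_jet (k := k) h
  have h1' : (jet k h).repr.pt = x := h1
  refine Prod.ext ?_ (funext fun I => ?_)
  · simp only [jetCoords, h1']
  · have := h3 c (h2 ▸ hc) I.1 (by omega)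
    simp only [jetCoords, partialDeriv]
    rw [this]

/-- The domain of natural coordinates. -/
def jetSource (k : ℕ) : Set (JetSpace π k) := {j | j.toE ∈ c.chart.source}

/-- The range of natural coordinates. -/
def jetTarget (k : ℕ) : Set (JetCoord m n k) := {z | (z.1, z.2 idx0) ∈ c.chart.target}

/-- A section with given natural coordinates, polynomial in the chart. -/
def polySec (z : JetCoord m n k) (y : M) : E := c.chart.symm (c.base y, taylorPoly z (c.base y))

theorem base_base_symm {z : JetCoord m n k} (hz : z ∈ c.jetTarget k) :
    c.base (c.base.symm z.1) = z.1 := c.base.right_inv (c.fst_mem_target hz)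

theorem eventually_target {z : JetCoord m n k} (hz : z ∈ c.jetTarget k) :
    ∀ᶠ y in 𝓝 (c.base.symm z.1), y ∈ c.base.source ∧
      (c.base y, taylorPoly z (c.base y)) ∈ c.chart.target := by
  have hb : c.base.symm z.1 ∈ c.base.source := c.base.map_target (c.fst_mem_target hz)
  refine Filter.Eventually.and (c.base.open_source.mem_nhds hb) ?_
  have h1 : ContinuousAt (fun y => (c.base y, taylorPoly z (c.base y))) (c.base.symm z.1) := by
    have h2 := c.base.continuousAt hb
    exact h2.prodMk (((contDiff_taylorPoly_apply (N := 0) z).continuous.continuousAt).comp h2)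
  refine h1.eventually (c.chart.open_target.mem_nhds ?_)
  change (c.base (c.base.symm z.1), taylorPoly z (c.base (c.base.symm z.1))) ∈ c.chart.target
  rw [c.base_base_symm hz, taylorPoly_self]
  exact hz

theorem polySec_isSection {z : JetCoord m n k} (hz : z ∈ c.jetTarget k) :
    IsSectionAt π (c.polySec z) (c.base.symm z.1) := by
  filter_upwards [c.eventually_target hz] with y ⟨hy, hz⟩
  refine ⟨?_, ?_⟩
  · have h1 : ContMDiffAt (𝓡 m) (𝓡 m) ∞ c.base y :=
      c.smooth_base.contMDiffAt (c.base.open_source.mem_nhds hy)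
    have h2 : ContMDiffAt (𝓡 m) (𝓡 n) ∞ (fun y => taylorPoly z (c.base y)) y :=
      (contDiff_taylorPoly_apply z).contMDiff.contMDiffAt.comp y h1
    have h3 : ContMDiffAt (𝓡 m) 𝓘(ℝ, Rn m × Rn n) ∞
        (fun y => (c.base y, taylorPoly z (c.base y))) y := h1.prodMk_space h2
    exact (c.smooth_chart_symm.contMDiffAt (c.chart.open_target.mem_nhds hz)).comp y h3
  · rw [polySec, c.proj_chart_symm hz, c.base.left_inv hy]

theorem polySec_apply {z : JetCoord m n k} (hz : z ∈ c.jetTarget k) :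
    c.polySec z (c.base.symm z.1) = c.chart.symm (z.1, z.2 idx0) := by
  rw [polySec, c.base_base_symm hz, taylorPoly_self]

theorem polySec_mem {z : JetCoord m n k} (hz : z ∈ c.jetTarget k) :
    c.polySec z (c.base.symm z.1) ∈ c.chart.source := by
  rw [c.polySec_apply hz]
  exact c.chart.map_target hz

theorem rep_polySec {z : JetCoord m n k} (hz : z ∈ c.jetTarget k) :
    c.rep (c.polySec z) =ᶠ[𝓝 z.1] taylorPoly z := by
  have hb : c.base.symm z.1 ∈ c.base.source := c.base.map_target (c.fst_mem_target hz)
  have := c.eventually_base_symm hb (c.eventually_target hz)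
  rw [c.base_base_symm hz] at this
  filter_upwards [this] with y ⟨hy, _, h2⟩
  rw [c.base.right_inv hy] at h2
  rw [rep, polySec, c.base.right_inv hy, c.chart.right_inv h2]

theorem jetCoords_polySec {z : JetCoord m n k} (hz : z ∈ c.jetTarget k) :
    c.jetCoords (jet k (c.polySec_isSection hz)) = z := by
  rw [c.jetCoords_jet _ (c.polySec_mem hz), c.base_base_symm hz]
  refine Prod.ext rfl (funext fun I => ?_)
  rw [← partialDeriv_taylorPoly z I]
  simp only [partialDeriv]
  rw [((c.rep_polySec hz).iteratedFDeriv ℝ _).self_of_nhds]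

theorem nonempty_jet [IsManifold (𝓡 m) ∞ M] [IsManifold (𝓡 (m + n)) ∞ E]
    (c : FiberedChart π) (k : ℕ) : Nonempty (JetSpace π k) := by
  obtain ⟨d, hd⟩ := FiberedChart.exists_mem π (c.chart.symm 0)
  exact ⟨jet k (d.polySec_isSection (k := k) (z := ((d.chart (c.chart.symm 0)).1,
    fun _ => (d.chart (c.chart.symm 0)).2)) (d.chart.map_source hd))⟩

variable [IsManifold (𝓡 m) ∞ M] [IsManifold (𝓡 (m + n)) ∞ E]

open Classical in
/-- The jet with given natural coordinates. -/
def jetSymm (z : JetCoord m n k) : JetSpace π k :=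
  if h : z ∈ c.jetTarget k then jet k (c.polySec_isSection h)
  else Classical.choice (c.nonempty_jet k)

theorem jetSymm_eq {z : JetCoord m n k} (hz : z ∈ c.jetTarget k) :
    c.jetSymm z = jet k (c.polySec_isSection hz) := dif_pos hz

theorem partialDeriv_zero_rep {φ : M → E} {x : M} :
    partialDeriv (idx0 : JetIdx m k).2 (c.rep φ) (c.base x) = c.rep φ (c.base x) :=
  iteratedFDeriv_zero_apply (𝕜 := ℝ) _

/-- The natural chart of `Jᵏπ` induced by an adapted chart of `E`. -/
def jetChart (k : ℕ) : PartialEquiv (JetSpace π k) (JetCoord m n k) where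
  toFun := c.jetCoords
  invFun := c.jetSymm
  source := c.jetSource k
  target := c.jetTarget k
  map_source' := by
    intro j hj
    obtain ⟨φ, x, h, rfl⟩ := j.exists_jet
    rw [c.jetCoords_jet h hj]
    change (c.base x, partialDeriv (idx0 : JetIdx m k).2 (c.rep φ) (c.base x)) ∈ c.chart.target
    rw [c.partialDeriv_zero_rep, ← c.chart_eq h hj]
    exact c.chart.map_source hj
  map_target' := by
    intro z hz
    rw [c.jetSymm_eq hz]
    exact c.polySec_mem hz
  left_inv' := by
    intro j hj
    obtain ⟨φ, x, h, rfl⟩ := j.exists_jet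
    have hz : c.jetCoords (jet k h) ∈ c.jetTarget k := by
      rw [c.jetCoords_jet h hj]
      change (c.base x, partialDeriv (idx0 : JetIdx m k).2 (c.rep φ) (c.base x)) ∈ c.chart.target
      rw [c.partialDeriv_zero_rep, ← c.chart_eq h hj]
      exact c.chart.map_source hj
    have hx : c.base.symm (c.jetCoords (jet k h)).1 = x := by
      rw [c.jetCoords_jet h hj, c.base.left_inv (c.base_mem h hj)]
    have hp := c.polySec_isSection hz
    have h1 := c.jetCoords_polySec hz
    have h2 := c.jetCoords_jet (k := k) h hj
    rw [c.jetCoords_jet hp (c.polySec_mem hz)] at h1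
    have h3 := c.polySec_apply hz
    have h4 := c.polySec_mem hz
    rw [c.jetSymm_eq hz]
    refine jet_eq hp h hx c ?_ h4 fun I => ?_
    · rw [h3, h2]
      change c.chart.symm (c.base x, partialDeriv (idx0 : JetIdx m k).2 (c.rep φ) (c.base x)) = _
      rw [c.partialDeriv_zero_rep, ← c.chart_eq h hj, c.chart.left_inv (show φ x ∈ c.chart.source from hj)]
    · exact congrFun (congrArg Prod.snd (h1.trans h2)) I
  right_inv' := by
    intro z hz
    rw [c.jetSymm_eq hz]
    exact c.jetCoords_polySec hz

/-- The expression in the chart `d` of the section which is polynomial in the chart `c`. -/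
def transPoly (z : JetCoord m n k) (y : Rn m) : Rn n :=
  (c.trans d (d.transBase c y, taylorPoly z (d.transBase c y))).2

/-- The change of natural coordinates. -/
def jetTrans (z : JetCoord m n k) : JetCoord m n k :=
  (c.transBase d z.1, fun I => partialDeriv I.2 (c.transPoly d z) (c.transBase d z.1))

theorem jetChart_trans_source :
    ((c.jetChart k).symm.trans (d.jetChart k)).source =
      {z | (z.1, z.2 idx0) ∈ c.overlap d} := by
  ext z
  simp only [PartialEquiv.trans_source, PartialEquiv.symm_source, Set.mem_inter_iff,
    Set.mem_preimage, Set.mem_ofPred_eq, mem_overlap]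
  refine and_congr_right fun hz => ?_
  change (c.jetSymm z).toE ∈ d.chart.source ↔ _
  rw [c.jetSymm_eq hz, JetSpace.toE_jet, c.polySec_apply hz]

theorem isOpen_jetOverlap : IsOpen {z : JetCoord m n k | (z.1, z.2 idx0) ∈ c.overlap d} :=
  (c.isOpen_overlap d).preimage (by fun_prop)

theorem jetCoords_jetSymm {z : JetCoord m n k} (hz : (z.1, z.2 idx0) ∈ c.overlap d) :
    d.jetCoords (c.jetSymm z) = c.jetTrans d z := by
  rw [mem_overlap] at hz
  have hzc : z ∈ c.jetTarget k := hz.1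
  have hd : c.polySec z (c.base.symm z.1) ∈ d.chart.source := by
    rw [c.polySec_apply hzc]
    exact hz.2
  have hp := c.polySec_isSection hzc
  rw [c.jetSymm_eq hzc, d.jetCoords_jet hp hd]
  refine Prod.ext rfl (funext fun I => ?_)
  simp only [jetTrans, partialDeriv]
  have h1 := c.rep_change d hp (c.polySec_mem hzc) hd
  have hT : d.transBase c (d.base (c.base.symm z.1)) = z.1 := by
    rw [d.transBase_base c (d.base_mem hp hd), c.base_base_symm hzc]
  have hcont : ContinuousAt (d.transBase c) (d.base (c.base.symm z.1)) :=
    (d.transBase_smooth c (d.base_mem hp hd) (c.base_mem hp (c.polySec_mem hzc))).continuousAt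
  have h2 : c.rep (c.polySec z) =ᶠ[𝓝 (d.transBase c (d.base (c.base.symm z.1)))] taylorPoly z := by
    rw [hT]; exact c.rep_polySec hzc
  have h3 : d.rep (c.polySec z) =ᶠ[𝓝 (d.base (c.base.symm z.1))]
      c.transPoly d z := by
    filter_upwards [h1, hcont.eventually h2] with y hy hy'
    rw [hy, hy', transPoly]
  rw [(h3.iteratedFDeriv ℝ _).self_of_nhds]
  rfl

theorem jetTrans_smooth {z : JetCoord m n k} (hz : (z.1, z.2 idx0) ∈ c.overlap d) :
    ContDiffAt ℝ ∞ (c.jetTrans d) z := by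
  have hz' := (c.mem_overlap d).1 hz
  have hbc : z.1 ∈ c.base.target := c.fst_mem_target hz'.1
  have hxc : c.base.symm z.1 ∈ c.base.source := c.base.map_target hbc
  have hxd : c.base.symm z.1 ∈ d.base.source := by
    rw [← c.proj_chart_symm hz'.1]
    exact d.proj_mem _ hz'.2
  have h1 : ContDiffAt ℝ ∞ (c.transBase d) z.1 := by
    have := c.transBase_smooth d hxc hxd
    rwa [c.base.right_inv hbc] at this
  have hT : d.transBase c (c.transBase d z.1) = z.1 := by
    rw [transBase, transBase, d.base.left_inv hxd, c.base.right_inv hbc]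
  have h2 : ContDiffAt ℝ ∞ (d.transBase c) (c.transBase d z.1) := d.transBase_smooth c hxd hxc
  have h1' : ContDiffAt ℝ ∞ (fun z : JetCoord m n k => c.transBase d z.1) z :=
    h1.comp z contDiffAt_fst
  refine h1'.prodMk (contDiffAt_pi.2 fun I => ?_)
  have hf : ContDiffAt ℝ ∞ (Function.uncurry (c.transPoly d (k := k))) (z, c.transBase d z.1) := by
    have h3 : ContDiffAt ℝ ∞ (fun q : JetCoord m n k × Rn m => d.transBase c q.2)
        (z, c.transBase d z.1) :=
      ContDiffAt.comp (g := d.transBase c) (f := fun q : JetCoord m n k × Rn m => q.2)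
        (z, c.transBase d z.1) h2 contDiffAt_snd
    have h4 : ContDiffAt ℝ ∞ (fun q : JetCoord m n k × Rn m => taylorPoly q.1 (d.transBase c q.2))
        (z, c.transBase d z.1) :=
      ContDiffAt.comp (g := fun q : JetCoord m n k × Rn m => taylorPoly q.1 q.2)
        (f := fun q : JetCoord m n k × Rn m => (q.1, d.transBase c q.2))
        (z, c.transBase d z.1) contDiff_taylorPoly.contDiffAt (contDiffAt_fst.prodMk h3)
    have h5 : ContDiffAt ℝ ∞ (fun w => (c.trans d w).2) (d.transBase c (c.transBase d z.1),
        taylorPoly z (d.transBase c (c.transBase d z.1))) := by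
      rw [hT, taylorPoly_self]
      exact (c.trans_smooth d hz).snd
    exact ContDiffAt.comp (g := fun w => (c.trans d w).2)
      (f := fun q : JetCoord m n k × Rn m => (d.transBase c q.2, taylorPoly q.1 (d.transBase c q.2)))
      (z, c.transBase d z.1) h5 (h3.prodMk h4)
  have h6 := contDiffAt_iteratedFDeriv_param hf I.1
  have h7 : ContDiffAt ℝ ∞ (fun z : JetCoord m n k =>
      iteratedFDeriv ℝ I.1 (c.transPoly d z) (c.transBase d z.1)) z :=
    ContDiffAt.comp z (f := fun z : JetCoord m n k => (z, c.transBase d z.1)) (g := fun q : JetCoord m n k × Rn m => iteratedFDeriv ℝ I.1 (c.transPoly d q.1) q.2)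
      h6 (contDiffAt_id.prodMk h1')
  exact h7.continuousLinearMap_comp
    (ContinuousMultilinearMap.apply ℝ _ _ fun a => stdVec (enumIdx I.2 a))

theorem jetChart_contDiffOn :
    ContDiffOn ℝ ∞ ((c.jetChart k).symm.trans (d.jetChart k))
      ((c.jetChart k).symm.trans (d.jetChart k)).source := by
  rw [jetChart_trans_source]
  intro z hz
  refine ((c.jetTrans_smooth d hz).congr_of_eventuallyEq ?_).contDiffWithinAt
  filter_upwards [(c.isOpen_jetOverlap d).mem_nhds hz] with y hy
  exact c.jetCoords_jetSymm d hy

variable (π k) in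
/-- The atlas of natural charts of `Jᵏπ`. -/
def jetCore : ChartedSpaceCore (JetCoord m n k) (JetSpace π k) where
  atlas := Set.range fun c : FiberedChart π => c.jetChart k
  chartAt j := (Classical.choose (exists_mem π j.toE)).jetChart k
  mem_chart_source j := Classical.choose_spec (exists_mem π j.toE)
  chart_mem_atlas j := Set.mem_range_self _
  open_source := by
    rintro _ _ ⟨c, rfl⟩ ⟨d, rfl⟩
    rw [jetChart_trans_source]
    exact c.isOpen_jetOverlap d
  continuousOn_toFun := by
    rintro _ _ ⟨c, rfl⟩ ⟨d, rfl⟩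
    exact (c.jetChart_contDiffOn d).continuousOn

end FiberedChart

variable [IsManifold (𝓡 m) ∞ M] [IsManifold (𝓡 (m + n)) ∞ E]

instance JetSpace.topologicalSpace (k : ℕ) : TopologicalSpace (JetSpace π k) :=
  (FiberedChart.jetCore π k).toTopologicalSpace

/-- The smooth atlas of `Jᵏπ` formed by the natural charts. -/
instance JetSpace.chartedSpace (k : ℕ) : ChartedSpace (JetCoord m n k) (JetSpace π k) :=
  (FiberedChart.jetCore π k).toChartedSpace

instance JetSpace.isManifold (k : ℕ) :
    IsManifold 𝓘(ℝ, JetCoord m n k) ∞ (JetSpace π k) := by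
  refine isManifold_of_core (FiberedChart.jetCore π k) ?_
  rintro _ ⟨c, rfl⟩ _ ⟨d, rfl⟩
  exact c.jetChart_contDiffOn d

end Jets

/-! ### The restricted symmetric multimomentum bundle -/

section Directions

variable {m n k : ℕ}

/-- The coordinate direction `∂/∂xⁱ`. -/
def dirX (i : Fin m) : JetCoord m n k := (stdVec i, 0)

open Classical in
/-- The coordinate direction `∂/∂u_I^α`. -/
def dirU (I : JetIdx m k) (α : Fin n) : JetCoord m n k := (0, Pi.single I (stdVec α))

/-- The multi-index `1_i`. -/
def idx1 (i : Fin m) : JetIdx m (k + 1) := ⟨1, multiIdx ![i]⟩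

/-- The multi-index `1_i + 1_j`. -/
def idx2 (i j : Fin m) : Sym (Fin m) 2 := multiIdx ![i, j]

/-- The factor `n(ij)`. -/
def mult (i j : Fin m) : ℝ := if i = j then 1 else 2

end Directions

section ModelForms

variable {m n : ℕ}

/-- The `m`-form `l ∧ dᵐ⁻¹x_s` on the coordinate space, where `dᵐ⁻¹x_s = i(∂/∂xˢ) dᵐx`:
the determinant of `(dx¹, …, l, …, dxᵐ)` with `l` at place `s`. -/
def elemForm (l : JetCoord m n 1 →L[ℝ] ℝ) (s : Fin m) : JetCoord m n 1 [⋀^Fin m]→L[ℝ] ℝ :=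
  { (Matrix.detRowAlternating (R := ℝ) (n := Fin m)).compLinearMap
      (LinearMap.pi fun a => if a = s then (l : JetCoord m n 1 →ₗ[ℝ] ℝ) else
        ((EuclideanSpace.proj a : Rn m →L[ℝ] ℝ).comp
          (ContinuousLinearMap.fst ℝ (Rn m) (JetIdx m 1 → Rn n)) : JetCoord m n 1 →ₗ[ℝ] ℝ)) with
    cont := by
      refine Continuous.matrix_det (continuous_matrix fun b a => ?_)
      exact (LinearMap.continuous_of_finiteDimensional _).comp (continuous_apply b) }

theorem elemForm_apply (l : JetCoord m n 1 →L[ℝ] ℝ) (s : Fin m) (v : Fin m → JetCoord m n 1) :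
    elemForm l s v = Matrix.det fun b a => if a = s then l (v b) else (v b).1 a := by
  change Matrix.det _ = _
  congr 1
  ext b a
  change (if a = s then (l : JetCoord m n 1 →ₗ[ℝ] ℝ) else _) (v b) = _
  split_ifs <;> rfl

/-- The coordinate function `u_I^α`. -/
def coordU (I : JetIdx m 1) (α : Fin n) : JetCoord m n 1 →L[ℝ] ℝ :=
  (EuclideanSpace.proj α : Rn n →L[ℝ] ℝ).comp
    ((ContinuousLinearMap.proj I).comp (ContinuousLinearMap.snd ℝ (Rn m) (JetIdx m 1 → Rn n)))

/-- The coordinates `(p_α^i, p_α^I)`, `|I| = 2`. -/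
abbrev MomCoord (m n : ℕ) : Type := (Fin m → Fin n → ℝ) × (Sym (Fin m) 2 → Fin n → ℝ)

/-- The form `p_α^i du^α ∧ dᵐ⁻¹x_i + (1 / n(ij)) p_α^{1_i+1_j} du_i^α ∧ dᵐ⁻¹x_j`. -/
def modelForm (p : MomCoord m n) : JetCoord m n 1 [⋀^Fin m]→L[ℝ] ℝ :=
  (∑ i, ∑ α, p.1 i α • elemForm (coordU idx0 α) i) +
    ∑ i, ∑ j, ∑ α, ((mult i j)⁻¹ * p.2 (idx2 i j) α) • elemForm (coordU (idx1 i) α) j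

theorem coordU_dirX (I : JetIdx m 1) (α : Fin n) (i : Fin m) : coordU I α (dirX i) = 0 := by
  simp [coordU, dirX]

open Classical in
theorem coordU_dirU (I I' : JetIdx m 1) (α α' : Fin n) :
    coordU I α (dirU I' α') = if I = I' ∧ α = α' then 1 else 0 := by
  by_cases h : I = I'
  · subst h
    simp [coordU, dirU]
  · simp [coordU, dirU, h]

theorem adjugate_update (A : Matrix (Fin m) (Fin m) ℝ) (c : Fin m → ℝ) (s k : Fin m) :
    (A.updateCol s c).adjugate s k = A.adjugate s k := by
  have h : ∀ B : Matrix (Fin m) (Fin m) ℝ,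
      B.adjugate s k = (B.updateCol s (Pi.single k 1)).det := by
    intro B
    rw [← Matrix.transpose_apply B.adjugate, Matrix.adjugate_transpose, Matrix.adjugate_apply,
      Matrix.updateRow_transpose, Matrix.det_transpose]
  rw [h, h]
  congr 1
  ext a b
  by_cases hb : b = s <;> simp [Matrix.updateCol_apply, hb]

/-- Value of an elementary form with one vertical argument `ξ`. -/
theorem elemForm_update (l : JetCoord m n 1 →L[ℝ] ℝ) (s k : Fin m) (v : Fin m → JetCoord m n 1)
    (ξ : JetCoord m n 1) (hξ : ξ.1 = 0) :
    elemForm l s (Function.update v k ξ) =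
      l ξ * (Matrix.of fun b a => (v b).1 a : Matrix (Fin m) (Fin m) ℝ).adjugate s k := by
  rw [elemForm_apply, ← adjugate_update _ (fun b => l (v b)), Matrix.adjugate_apply,
    ← Matrix.det_updateRow_smul]
  congr 1
  ext b a
  by_cases hb : b = k
  · subst hb
    by_cases ha : a = s
    · simp [ha]
    · simp [ha, hξ]
  · by_cases ha : a = s <;> simp [hb, ha, Matrix.updateRow_apply, Matrix.updateCol_apply]

theorem elemForm_update_dirX (l : JetCoord m n 1 →L[ℝ] ℝ) (s k : Fin m)
    (ξ : JetCoord m n 1) (hξ : ξ.1 = 0) :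
    elemForm l s (Function.update (fun i => dirX i) k ξ) = if s = k then l ξ else 0 := by
  rw [elemForm_update _ _ _ _ _ hξ]
  have : (Matrix.of fun b a => (dirX b : JetCoord m n 1).1 a : Matrix (Fin m) (Fin m) ℝ) = 1 := by
    ext b a
    simp [dirX, Matrix.one_apply, eq_comm]
  rw [this, Matrix.adjugate_one, Matrix.one_apply]
  simp

theorem idx1_injective : Function.Injective (idx1 : Fin m → JetIdx m 1) := by
  intro i j h
  have h1 : multiIdx ![i] = multiIdx ![j] := eq_of_heq (Sigma.mk.inj h).2
  rw [multiIdx_eq_iff] at h1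
  simpa using h1

theorem idx0_ne_idx1 (i : Fin m) : (idx0 : JetIdx m 1) ≠ idx1 i := by
  intro h
  have := congrArg (fun I : JetIdx m 1 => (I.1 : ℕ)) h
  simp [idx0, idx1] at this

theorem idx_cases (I : JetIdx m 1) : I = idx0 ∨ ∃ i, I = idx1 i := by
  obtain ⟨l, I⟩ := I
  fin_cases l
  · left
    have : I = Sym.nil := Subsingleton.elim _ _
    subst this
    rfl
  · right
    refine ⟨enumIdx I 0, Sigma.ext rfl (heq_of_eq ?_)⟩
    rw [← multiIdx_enumIdx I]
    refine congrArg multiIdx (funext fun a => ?_)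
    rw [multiIdx_enumIdx, Subsingleton.elim a 0]
    rfl

theorem modelForm_mom1 (p : MomCoord m n) (k : Fin m) (α : Fin n) :
    modelForm p (Function.update (fun i => dirX i) k (dirU idx0 α)) = p.1 k α := by
  classical
  simp [modelForm, elemForm_update_dirX _ _ _ _ (show (dirU idx0 α : JetCoord m n 1).1 = 0 from rfl),
    coordU_dirU, (idx0_ne_idx1 _).symm, ContinuousAlternatingMap.sum_apply]

theorem modelForm_mom2 (p : MomCoord m n) (i k : Fin m) (α : Fin n) :
    modelForm p (Function.update (fun i => dirX i) k (dirU (idx1 i) α)) =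
      (mult i k)⁻¹ * p.2 (idx2 i k) α := by
  classical
  simp [modelForm, elemForm_update_dirX _ _ _ _ (show (dirU (idx1 i) α : JetCoord m n 1).1 = 0 from rfl),
    coordU_dirU, idx0_ne_idx1, idx1_injective.eq_iff, ContinuousAlternatingMap.sum_apply, ite_and]

theorem elemForm_eq_zero (l : JetCoord m n 1 →L[ℝ] ℝ) (s : Fin m) (v : Fin m → JetCoord m n 1)
    {a b : Fin m} (hab : a ≠ b) (ha : (v a).1 = 0) (hb : (v b).1 = 0) : elemForm l s v = 0 := by
  have h : v = Function.update v a (v a) := (Function.update_eq_self a v).symm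
  have h0 : (Matrix.of fun b a => (v b).1 a : Matrix (Fin m) (Fin m) ℝ).adjugate s a = 0 := by
    rw [← adjugate_update _ 0, Matrix.adjugate_apply]
    refine Matrix.det_eq_zero_of_row_eq_zero b fun c => ?_
    rw [Matrix.updateRow_ne hab.symm]
    by_cases hc : c = s <;> simp [Matrix.updateCol_apply, hc, hb]
  rw [h, elemForm_update _ _ _ _ _ ha, h0, mul_zero]

theorem modelForm_eq_zero (p : MomCoord m n) (v : Fin m → JetCoord m n 1)
    {a b : Fin m} (hab : a ≠ b) (ha : (v a).1 = 0) (hb : (v b).1 = 0) : modelForm p v = 0 := by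
  simp [modelForm, elemForm_eq_zero _ _ v hab ha hb, ContinuousAlternatingMap.sum_apply]

/-- A form vanishing on two vertical vectors is determined, modulo semibasic forms, by its
components. -/
theorem eq_zero_of_components (γ : JetCoord m n 1 [⋀^Fin m]→L[ℝ] ℝ)
    (h2 : ∀ v : Fin m → JetCoord m n 1, ∀ a b, a ≠ b → (v a).1 = 0 → (v b).1 = 0 → γ v = 0)
    (h1 : ∀ k I α, γ (Function.update (fun i => dirX i) k (dirU I α)) = 0)
    (v : Fin m → JetCoord m n 1) (a : Fin m) (ha : (v a).1 = 0) : γ v = 0 := by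
  classical
  let g : JetCoord m n 1 [⋀^Fin m]→ₗ[ℝ] ℝ :=
    γ (fun i => dirX i) • (Matrix.detRowAlternating (R := ℝ) (n := Fin m)).compLinearMap
      ((EuclideanSpace.equiv (Fin m) ℝ : Rn m →ₗ[ℝ] (Fin m → ℝ)).comp (LinearMap.fst ℝ _ _))
  have hg : ∀ v, g v = γ (fun i => dirX i) * Matrix.det fun b a => (v b).1 a := fun v => rfl
  let e := ((EuclideanSpace.basisFun (Fin m) ℝ).toBasis).prod
    (Pi.basis fun _ : JetIdx m 1 => (EuclideanSpace.basisFun (Fin n) ℝ).toBasis)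
  have hel : ∀ i, e (Sum.inl i) = dirX i := by
    intro i
    simp [e, dirX]
  have her : ∀ I α, e (Sum.inr ⟨I, α⟩) = dirU I α := by
    intro I α
    simp [e, dirU]
  have key : γ.toAlternatingMap = g := by
    refine Module.Basis.ext_alternating e fun f hf => ?_
    rw [hg]
    change γ (fun i => e (f i)) = _
    by_cases hv : ∃ a I α, f a = Sum.inr ⟨I, α⟩
    · obtain ⟨a, I, α, hfa⟩ := hv
      have hrow : (Matrix.det fun b c => (e (f b)).1 c : ℝ) = 0 :=
        Matrix.det_eq_zero_of_row_eq_zero a fun c => by simp [hfa, her, dirU]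
      rw [hrow, mul_zero]
      by_cases hv2 : ∃ b, b ≠ a ∧ ∃ I α, f b = Sum.inr ⟨I, α⟩
      · obtain ⟨b, hb, I', α', hfb⟩ := hv2
        exact h2 _ a b hb.symm (by simp [hfa, her, dirU]) (by simp [hfb, her, dirU])
      · have hx : ∀ b, ∃ i, b ≠ a → f b = Sum.inl i := by
          intro b
          by_cases hb : b = a
          · exact ⟨b, fun h => absurd hb h⟩
          · rcases hfb : f b with i | ⟨I', α'⟩
            · exact ⟨i, fun _ => rfl⟩
            · exact absurd ⟨b, hb, I', α', hfb⟩ hv2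
        choose q hq using hx
        have hqi : ∀ b c, b ≠ a → c ≠ a → q b = q c → b = c := by
          intro b c hb hc h
          apply hf
          rw [hq b hb, hq c hc, h]
        obtain ⟨i, hi⟩ : ∃ i, ∀ b, b ≠ a → q b ≠ i := by
          by_contra hcon
          push Not at hcon
          have hcard : (Finset.univ : Finset (Fin m)) ⊆ (Finset.univ.erase a).image q := by
            intro i _
            obtain ⟨b, hb, hbi⟩ := hcon i
            exact Finset.mem_image.2 ⟨b, by simp [hb], hbi⟩
          have := (Finset.card_le_card hcard).trans Finset.card_image_le
          rw [Finset.card_erase_of_mem (Finset.mem_univ a)] at this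
          have hpos : 0 < (Finset.univ : Finset (Fin m)).card :=
            Finset.card_pos.2 ⟨a, Finset.mem_univ a⟩
          omega
        let τ : Fin m → Fin m := fun b => if b = a then i else q b
        have hτ : Function.Injective τ := by
          intro b c h
          by_cases hb : b = a <;> by_cases hc : c = a
          · rw [hb, hc]
          · simp only [τ, hb, hc, if_true, if_false] at h
            exact absurd h.symm (hi c hc)
          · simp only [τ, hb, hc, if_true, if_false] at h
            exact absurd h (hi b hb)
          · simp only [τ, hb, hc, if_false] at h
            exact hqi b c hb hc h
        let σ : Equiv.Perm (Fin m) := Equiv.ofBijective τ (Finite.injective_iff_bijective.1 hτ)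
        have hσ : (fun b => e (f b)) = (Function.update (fun i => dirX i) i (dirU I α)) ∘ σ := by
          ext1 b
          change e (f b) = (Function.update (fun i => dirX i) i (dirU I α) :
            Fin m → JetCoord m n 1) (τ b)
          by_cases hb : b = a
          · subst hb
            simp [τ, hfa, her]
          · simp only [τ, hb, if_false]
            rw [Function.update_of_ne (hi b hb), hq b hb, hel]
        rw [hσ]
        change γ.toAlternatingMap _ = 0
        rw [AlternatingMap.map_perm]
        change _ • γ _ = 0
        rw [h1, smul_zero]
    · have hx : ∀ b, ∃ i, f b = Sum.inl i := by
        intro b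
        rcases hfb : f b with i | ⟨I', α'⟩
        · exact ⟨i, rfl⟩
        · exact absurd ⟨b, I', α', hfb⟩ hv
      choose q hq using hx
      have hqi : Function.Injective q := by
        intro b c h
        apply hf
        rw [hq b, hq c, h]
      let σ : Equiv.Perm (Fin m) := Equiv.ofBijective q (Finite.injective_iff_bijective.1 hqi)
      have hσ : (fun b => e (f b)) = (fun i => dirX i) ∘ σ := by
        ext1 b
        change _ = dirX (q b)
        rw [hq b, hel]
      have hmat : (fun b c => (e (f b)).1 c : Matrix (Fin m) (Fin m) ℝ) =
          (1 : Matrix (Fin m) (Fin m) ℝ).submatrix σ id := by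
        ext b c
        have := congrFun hσ b
        simp only [Function.comp] at this
        rw [this]
        simp [dirX, Matrix.one_apply, eq_comm]
      rw [hmat, Matrix.det_permute, hσ]
      change γ.toAlternatingMap _ = _
      rw [AlternatingMap.map_perm]
      change _ • γ _ = _
      simp [Units.smul_def, mul_comm]
  have hv : γ v = g v := DFunLike.congr_fun key v
  have h0 : (Matrix.det fun b c => (v b).1 c : ℝ) = 0 :=
    Matrix.det_eq_zero_of_row_eq_zero a fun c => by simp [ha]
  rw [hv, hg]
  exact mul_eq_zero_of_right _ h0

end ModelForms

/-! ### Differentials of the natural coordinates -/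

section JetTangent

set_option linter.unusedSectionVars false

variable {m n : ℕ} {M E : Type*}
  [TopologicalSpace M] [ChartedSpace (Rn m) M] [TopologicalSpace E] [ChartedSpace (Rn (m + n)) E]
  [IsManifold (𝓡 m) ∞ M] [IsManifold (𝓡 (m + n)) ∞ E]
  {π : FiberedManifold m n M E}

namespace FiberedChart

variable (c d : FiberedChart π) {k : ℕ}

/-- The natural chart as an open partial homeomorphism. -/
def jetHomeo (k : ℕ) : OpenPartialHomeomorph (JetSpace π k) (JetCoord m n k) :=
  (jetCore π k).openPartialHomeomorph (c.jetChart k) (Set.mem_range_self c)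

theorem jetHomeo_mem_atlas (k : ℕ) :
    c.jetHomeo k ∈ atlas (JetCoord m n k) (JetSpace π k) :=
  Set.mem_iUnion₂.2 ⟨c.jetChart k, Set.mem_range_self c, rfl⟩

theorem isOpen_jetSource (k : ℕ) : IsOpen (c.jetSource k : Set (JetSpace π k)) :=
  (c.jetHomeo k).open_source

theorem jetHomeo_mdifferentiable (k : ℕ) :
    (c.jetHomeo k).MDifferentiable 𝓘(ℝ, JetCoord m n k) 𝓘(ℝ, JetCoord m n k) :=
  mdifferentiable_of_mem_atlas (c.jetHomeo_mem_atlas k)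

/-- The differential `(dxⁱ, du_I^α)` of the natural coordinates. -/
def dcoord (j : JetSpace π k) :
    TangentSpace 𝓘(ℝ, JetCoord m n k) j →L[ℝ] JetCoord m n k :=
  mfderiv 𝓘(ℝ, JetCoord m n k) 𝓘(ℝ, JetCoord m n k) c.jetCoords j

/-- The coordinate frame: the inverse of the differential of the natural coordinates, sending
`dirX i` to `∂/∂xⁱ` and `dirU I α` to `∂/∂u_I^α`. -/
def frame (j : JetSpace π k) : JetCoord m n k →L[ℝ] TangentSpace 𝓘(ℝ, JetCoord m n k) j :=
  (c.dcoord j).inverse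

variable {c d}

/-- The differential of the natural coordinates as an equivalence. -/
def dcoordEquiv {j : JetSpace π k} (hj : j ∈ c.jetSource k) :
    TangentSpace 𝓘(ℝ, JetCoord m n k) j ≃L[ℝ] JetCoord m n k :=
  (c.jetHomeo_mdifferentiable k).mfderiv hj

theorem coe_dcoordEquiv {j : JetSpace π k} (hj : j ∈ c.jetSource k) :
    (dcoordEquiv hj : TangentSpace 𝓘(ℝ, JetCoord m n k) j →L[ℝ] JetCoord m n k) = c.dcoord j :=
  rfl

theorem frame_dcoord {j : JetSpace π k} (hj : j ∈ c.jetSource k)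
    (v : TangentSpace 𝓘(ℝ, JetCoord m n k) j) : c.frame j (c.dcoord j v) = v := by
  rw [frame, ← coe_dcoordEquiv hj, ContinuousLinearMap.inverse_equiv]
  exact (dcoordEquiv hj).symm_apply_apply v

theorem dcoord_frame {j : JetSpace π k} (hj : j ∈ c.jetSource k) (w : JetCoord m n k) :
    c.dcoord j (c.frame j w) = w := by
  rw [frame, ← coe_dcoordEquiv hj, ContinuousLinearMap.inverse_equiv]
  exact (dcoordEquiv hj).apply_symm_apply w

theorem jetCoords_mem_overlap {j : JetSpace π k} (hc : j ∈ c.jetSource k)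
    (hd : j ∈ d.jetSource k) :
    ((c.jetCoords j).1, (c.jetCoords j).2 idx0) ∈ c.overlap d := by
  have h : c.jetCoords j ∈ ((c.jetChart k).symm.trans (d.jetChart k)).source := by
    rw [PartialEquiv.trans_source]
    refine ⟨(c.jetChart k).map_source hc, ?_⟩
    change c.jetSymm (c.jetCoords j) ∈ d.jetSource k
    rwa [show c.jetSymm (c.jetCoords j) = j from (c.jetChart k).left_inv hc]
  rwa [jetChart_trans_source] at h

theorem jetCoords_eq_jetTrans {j : JetSpace π k} (hc : j ∈ c.jetSource k)
    (hd : j ∈ d.jetSource k) : d.jetCoords j = c.jetTrans d (c.jetCoords j) := by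
  rw [← c.jetCoords_jetSymm d (jetCoords_mem_overlap hc hd),
    show c.jetSymm (c.jetCoords j) = j from (c.jetChart k).left_inv hc]

theorem dcoord_eq {j : JetSpace π k} (hc : j ∈ c.jetSource k) (hd : j ∈ d.jetSource k)
    (v : TangentSpace 𝓘(ℝ, JetCoord m n k) j) :
    d.dcoord j v = fderiv ℝ (c.jetTrans d) (c.jetCoords j) (c.dcoord j v) := by
  have h1 : (d.jetCoords : JetSpace π k → JetCoord m n k) =ᶠ[𝓝 j]
      c.jetTrans d ∘ c.jetCoords := by
    filter_upwards [(c.isOpen_jetSource k).mem_nhds hc, (d.isOpen_jetSource k).mem_nhds hd]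
      with i hi hi'
    exact jetCoords_eq_jetTrans hi hi'
  have h2 : MDifferentiableAt 𝓘(ℝ, JetCoord m n k) 𝓘(ℝ, JetCoord m n k) c.jetCoords j :=
    (c.jetHomeo_mdifferentiable k).mdifferentiableAt hc
  have h3 : DifferentiableAt ℝ (c.jetTrans d) (c.jetCoords j) :=
    (c.jetTrans_smooth d (jetCoords_mem_overlap hc hd)).differentiableAt (by simp)
  have h4 := mfderiv_comp (I := 𝓘(ℝ, JetCoord m n k)) j h3.mdifferentiableAt h2
  rw [mfderiv_eq_fderiv] at h4
  change mfderiv 𝓘(ℝ, JetCoord m n k) 𝓘(ℝ, JetCoord m n k) d.jetCoords j v = _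
  rw [h1.mfderiv_eq, h4]
  rfl

theorem dcoord_frame_change {j : JetSpace π k} (hc : j ∈ c.jetSource k) (hd : j ∈ d.jetSource k)
    (w : JetCoord m n k) :
    d.dcoord j (c.frame j w) = fderiv ℝ (c.jetTrans d) (c.jetCoords j) w := by
  rw [dcoord_eq hc hd, dcoord_frame hc]

theorem base_jetCoords {j : JetSpace π k} (hc : j ∈ c.jetSource k) :
    (c.jetCoords j).1 = c.base j.toBase := by
  obtain ⟨φ, x, h, rfl⟩ := j.exists_jet
  rw [c.jetCoords_jet h hc]
  rfl

theorem toBase_mem {j : JetSpace π k} (hc : j ∈ c.jetSource k) : j.toBase ∈ c.base.source := by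
  obtain ⟨φ, x, h, rfl⟩ := j.exists_jet
  exact c.base_mem h hc

theorem jetCoords_proj {j : JetSpace π k} (hc : j ∈ c.jetSource k) (l : ℕ) (hl : l ≤ k) :
    c.jetCoords (j.proj l hl) = (c.jetCoords j).trunc l hl := by
  obtain ⟨φ, x, h, rfl⟩ := j.exists_jet
  rw [JetSpace.proj_jet, c.jetCoords_jet h hc, c.jetCoords_jet h hc]
  rfl

theorem proj_mem_jetSource {j : JetSpace π k} (hc : j ∈ c.jetSource k) (l : ℕ) (hl : l ≤ k) :
    j.proj l hl ∈ c.jetSource l := by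
  obtain ⟨φ, x, h, rfl⟩ := j.exists_jet
  exact hc

end FiberedChart

/-- Tangent vectors of `Jᵏπ` which are vertical over `M`. -/
def IsVertical {k : ℕ} (j : JetSpace π k) (v : TangentSpace 𝓘(ℝ, JetCoord m n k) j) : Prop :=
  mfderiv 𝓘(ℝ, JetCoord m n k) (𝓡 m) (JetSpace.toBase : JetSpace π k → M) j v = 0

theorem isVertical_iff {c : FiberedChart π} {k : ℕ} {j : JetSpace π k} (hc : j ∈ c.jetSource k)
    (v : TangentSpace 𝓘(ℝ, JetCoord m n k) j) :
    IsVertical j v ↔ (c.dcoord j v).1 = 0 := by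
  have hb := c.base.map_source (FiberedChart.toBase_mem hc)
  have h1 : (fun i : JetSpace π k => i.toBase) =ᶠ[𝓝 j] c.base.symm ∘ Prod.fst ∘ c.jetCoords := by
    filter_upwards [(c.isOpen_jetSource k).mem_nhds hc] with i hi
    change _ = c.base.symm (c.jetCoords i).1
    rw [FiberedChart.base_jetCoords hi, c.base.left_inv (FiberedChart.toBase_mem hi)]
  have h2 : (Prod.fst ∘ c.jetCoords : JetSpace π k → Rn m) =ᶠ[𝓝 j] c.base ∘ JetSpace.toBase := by
    filter_upwards [(c.isOpen_jetSource k).mem_nhds hc] with i hi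
    exact FiberedChart.base_jetCoords hi
  have hd : MDifferentiableAt 𝓘(ℝ, JetCoord m n k) 𝓘(ℝ, JetCoord m n k) c.jetCoords j :=
    (c.jetHomeo_mdifferentiable k).mdifferentiableAt hc
  have hf : MDifferentiableAt 𝓘(ℝ, JetCoord m n k) (𝓡 m)
      (Prod.fst : JetCoord m n k → Rn m) (c.jetCoords j) :=
    differentiableAt_fst.mdifferentiableAt
  have hp := hf.comp j hd
  have hfd := mfderiv_comp j hf hd
  have hbs : MDifferentiableAt (𝓡 m) (𝓡 m) c.base.symm ((Prod.fst ∘ c.jetCoords) j) := by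
    refine (c.smooth_base_symm.contMDiffAt (c.base.open_target.mem_nhds ?_)).mdifferentiableAt
      (by simp)
    change (c.jetCoords j).1 ∈ _
    rwa [FiberedChart.base_jetCoords hc]
  have hbb : MDifferentiableAt (𝓡 m) (𝓡 m) c.base j.toBase :=
    (c.smooth_base.contMDiffAt (c.base.open_source.mem_nhds
      (FiberedChart.toBase_mem hc))).mdifferentiableAt (by simp)
  have ht : MDifferentiableAt 𝓘(ℝ, JetCoord m n k) (𝓡 m)
      (JetSpace.toBase : JetSpace π k → M) j := (hbs.comp j hp).congr_of_eventuallyEq h1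
  have e1 := h1.mfderiv_eq (I := 𝓘(ℝ, JetCoord m n k)) (I' := 𝓡 m)
  rw [mfderiv_comp j hbs hp] at e1
  have e2 := h2.mfderiv_eq (I := 𝓘(ℝ, JetCoord m n k)) (I' := 𝓡 m)
  rw [mfderiv_comp j hbb ht] at e2
  have e3 : ∀ v, mfderiv 𝓘(ℝ, JetCoord m n k) (𝓡 m) (Prod.fst ∘ c.jetCoords) j v =
      (c.dcoord j v).1 := by
    intro v
    rw [hfd, mfderiv_eq_fderiv, fderiv_fst]
    rfl
  constructor
  · intro h
    rw [← e3, e2]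
    change mfderiv _ _ _ _ (mfderiv _ _ (JetSpace.toBase : JetSpace π k → M) j v) = 0
    rw [show mfderiv _ _ (JetSpace.toBase : JetSpace π k → M) j v = 0 from h, map_zero]
  · intro h
    rw [← e3] at h
    change mfderiv _ _ (fun i : JetSpace π k => i.toBase) j v = 0
    rw [e1]
    change mfderiv _ _ _ _ (mfderiv 𝓘(ℝ, JetCoord m n k) (𝓡 m) (Prod.fst ∘ c.jetCoords) j v) = 0
    rw [h]
    exact map_zero (mfderiv (𝓡 m) (𝓡 m) c.base.symm ((Prod.fst ∘ c.jetCoords) j))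

end JetTangent

/-! ### First prolongation of a change of charts -/

section FirstOrder

set_option linter.unusedSectionVars false

variable {m n : ℕ} {M E : Type*}
  [TopologicalSpace M] [ChartedSpace (Rn m) M] [TopologicalSpace E] [ChartedSpace (Rn (m + n)) E]
  [IsManifold (𝓡 m) ∞ M] [IsManifold (𝓡 (m + n)) ∞ E]
  {π : FiberedManifold m n M E}

theorem partialDeriv_one {m n : ℕ} (r : Fin m) (s : Rn m → Rn n) (x : Rn m) :
    partialDeriv (multiIdx ![r]) s x = fderiv ℝ s x (stdVec r) := by
  have h : enumIdx (multiIdx ![r]) 0 = r := by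
    have := (multiIdx_eq_iff _ _).1 (multiIdx_enumIdx (multiIdx ![r]))
    simpa using this
  rw [partialDeriv, iteratedFDeriv_one_apply, h]

theorem fderiv_taylorPoly {m n k : ℕ} (z : JetCoord m n (k + 1)) (v : Rn m) :
    fderiv ℝ (taylorPoly z) z.1 v = symMultilinear (fun I => z.2 ⟨1, I⟩) fun _ => v := by
  have := iteratedFDeriv_taylorPoly z (l := 1) (by omega)
  have h := congrArg (fun T : Rn m [×1]→L[ℝ] Rn n => T fun _ => v) this
  simp only [iteratedFDeriv_one_apply] at h
  exact h

namespace FiberedChart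

variable (c d : FiberedChart π)

theorem mem_base_of_overlap {z : Rn m × Rn n} (hz : z ∈ c.overlap d) :
    z.1 ∈ c.base.target ∧ c.base.symm z.1 ∈ c.base.source ∧ c.base.symm z.1 ∈ d.base.source := by
  rw [mem_overlap] at hz
  have hbc : z.1 ∈ c.base.target := c.fst_mem_target hz.1
  refine ⟨hbc, c.base.map_target hbc, ?_⟩
  rw [← c.proj_chart_symm hz.1]
  exact d.proj_mem _ hz.2

theorem transBase_transBase {x : Rn m} (hc : x ∈ c.base.target)
    (hd : c.base.symm x ∈ d.base.source) : d.transBase c (c.transBase d x) = x := by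
  rw [transBase, transBase, d.base.left_inv hd, c.base.right_inv hc]

theorem fderiv_jetTrans_fst {k : ℕ} {z : JetCoord m n k} (hz : (z.1, z.2 idx0) ∈ c.overlap d)
    (w : JetCoord m n k) :
    (fderiv ℝ (c.jetTrans d) z w).1 = fderiv ℝ (c.transBase d) z.1 w.1 := by
  obtain ⟨h1, h2, h3⟩ := c.mem_base_of_overlap d hz
  have hT : DifferentiableAt ℝ (c.jetTrans d) z :=
    (c.jetTrans_smooth d hz).differentiableAt (by simp)
  have hb : DifferentiableAt ℝ (c.transBase d) z.1 := by
    have := (c.transBase_smooth d h2 h3).differentiableAt (by simp)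
    rwa [c.base.right_inv h1] at this
  have e1 : HasFDerivAt (fun z : JetCoord m n k => (c.jetTrans d z).1) _ z := hT.hasFDerivAt.fst
  have e2 : HasFDerivAt (fun z : JetCoord m n k => (c.jetTrans d z).1) _ z :=
    hb.hasFDerivAt.comp z (hasFDerivAt_fst (p := z))
  exact DFunLike.congr_fun (e1.unique e2) w

/-- The derivative of the change of charts along the fibres of `π`. -/
def vertDeriv (z : Rn m × Rn n) (u : Rn n) : Rn n := fderiv ℝ (fun z => (c.trans d z).2) z (0, u)

theorem jetTrans_line {z w : JetCoord m n 1} (hz : (z.1, z.2 idx0) ∈ c.overlap d)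
    (h1 : w.1 = 0) (h0 : w.2 idx0 = 0) (t : ℝ) (r : Fin m) :
    (c.jetTrans d (z + t • w)).2 (idx1 r) = (c.jetTrans d z).2 (idx1 r) +
      t • c.vertDeriv d (z.1, z.2 idx0) (symMultilinear (fun I => w.2 ⟨1, I⟩) fun _ =>
        fderiv ℝ (d.transBase c) (c.transBase d z.1) (stdVec r)) := by
  obtain ⟨hb, hbc, hbd⟩ := c.mem_base_of_overlap d hz
  have hST := c.transBase_transBase d hb hbd
  have key : ∀ y : JetCoord m n 1, y.1 = z.1 → y.2 idx0 = z.2 idx0 →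
      (c.jetTrans d y).2 (idx1 r) = fderiv ℝ (fun z => (c.trans d z).2) (z.1, z.2 idx0)
        (fderiv ℝ (d.transBase c) (c.transBase d z.1) (stdVec r),
          symMultilinear (fun I => y.2 ⟨1, I⟩) fun _ =>
            fderiv ℝ (d.transBase c) (c.transBase d z.1) (stdVec r)) := by
    intro y hy1 hy0
    change partialDeriv (multiIdx ![r]) (c.transPoly d y) (c.transBase d y.1) = _
    rw [partialDeriv_one, hy1]
    have hS : DifferentiableAt ℝ (d.transBase c) (c.transBase d z.1) :=
      (d.transBase_smooth c hbd hbc).differentiableAt (by simp)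
    have hP : DifferentiableAt ℝ (taylorPoly y) (d.transBase c (c.transBase d z.1)) :=
      (contDiff_taylorPoly_apply (N := 1) y).differentiable (by simp) _
    have hq := hS.hasFDerivAt.prodMk (hP.hasFDerivAt.comp _ hS.hasFDerivAt)
    have hF : DifferentiableAt ℝ (fun z => (c.trans d z).2) (d.transBase c (c.transBase d z.1),
        taylorPoly y (d.transBase c (c.transBase d z.1))) := by
      rw [hST, ← hy1, taylorPoly_self, hy0, hy1]
      exact (c.trans_smooth d hz).snd.differentiableAt (by simp)
    have := (hF.hasFDerivAt.comp (c.transBase d z.1) hq).fderiv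
    change fderiv ℝ (c.transPoly d y) _ = _ at this
    rw [this]
    simp only [ContinuousLinearMap.comp_apply, ContinuousLinearMap.prod_apply]
    rw [hST, ← hy1, fderiv_taylorPoly, taylorPoly_self, hy0]
  have hlin : symMultilinear (fun I => (z + t • w).2 ⟨1, I⟩) (fun _ =>
        fderiv ℝ (d.transBase c) (c.transBase d z.1) (stdVec r)) =
      symMultilinear (fun I => z.2 ⟨1, I⟩) (fun _ =>
        fderiv ℝ (d.transBase c) (c.transBase d z.1) (stdVec r)) +
      t • symMultilinear (fun I => w.2 ⟨1, I⟩) (fun _ =>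
        fderiv ℝ (d.transBase c) (c.transBase d z.1) (stdVec r)) := by
    simp only [symMultilinear_apply, Finset.smul_sum, ← Finset.sum_add_distrib]
    refine Finset.sum_congr rfl fun f _ => ?_
    change _ • (z.2 _ + t • w.2 _) = _
    rw [smul_add, smul_comm]
  rw [key z rfl rfl, key (z + t • w) (by simp [h1]) (by simp [h0]), hlin, vertDeriv,
    ← (fderiv ℝ (fun z => (c.trans d z).2) (z.1, z.2 idx0)).map_smul,
    ← (fderiv ℝ (fun z => (c.trans d z).2) (z.1, z.2 idx0)).map_add]
  simp

theorem fderiv_jetTrans_idx1 {z w : JetCoord m n 1} (hz : (z.1, z.2 idx0) ∈ c.overlap d)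
    (h1 : w.1 = 0) (h0 : w.2 idx0 = 0) (r : Fin m) :
    (fderiv ℝ (c.jetTrans d) z w).2 (idx1 r) =
      c.vertDeriv d (z.1, z.2 idx0) (symMultilinear (fun I => w.2 ⟨1, I⟩) fun _ =>
        fderiv ℝ (d.transBase c) (c.transBase d z.1) (stdVec r)) := by
  have hT : DifferentiableAt ℝ (c.jetTrans d) z :=
    (c.jetTrans_smooth d hz).differentiableAt (by simp)
  have e1 : HasDerivAt (fun t : ℝ => c.jetTrans d (z + t • w)) (fderiv ℝ (c.jetTrans d) z w) 0 :=
    hT.hasFDerivAt.hasLineDerivAt w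
  have e2 : HasDerivAt (fun t : ℝ => (c.jetTrans d (z + t • w)).2 (idx1 r))
      ((fderiv ℝ (c.jetTrans d) z w).2 (idx1 r)) 0 := (hasDerivAt_pi.1 e1.snd) (idx1 r)
  simp only [c.jetTrans_line d hz h1 h0] at e2
  have e3 := ((hasDerivAt_id (0 : ℝ)).smul_const (c.vertDeriv d (z.1, z.2 idx0)
    (symMultilinear (fun I => w.2 ⟨1, I⟩) fun _ =>
      fderiv ℝ (d.transBase c) (c.transBase d z.1) (stdVec r)))).const_add
        ((c.jetTrans d z).2 (idx1 r))
  rw [e2.unique e3, one_smul]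

theorem fderiv_jetTrans_idx0 {z w : JetCoord m n 1} (hz : (z.1, z.2 idx0) ∈ c.overlap d)
    (h1 : w.1 = 0) (h0 : w.2 idx0 = 0) : (fderiv ℝ (c.jetTrans d) z w).2 idx0 = 0 := by
  have hT : DifferentiableAt ℝ (c.jetTrans d) z :=
    (c.jetTrans_smooth d hz).differentiableAt (by simp)
  have e1 : HasDerivAt (fun t : ℝ => c.jetTrans d (z + t • w)) (fderiv ℝ (c.jetTrans d) z w) 0 :=
    hT.hasFDerivAt.hasLineDerivAt w
  have e2 : HasDerivAt (fun t : ℝ => (c.jetTrans d (z + t • w)).2 idx0)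
      ((fderiv ℝ (c.jetTrans d) z w).2 idx0) 0 := (hasDerivAt_pi.1 e1.snd) idx0
  obtain ⟨hb, _, hbd⟩ := c.mem_base_of_overlap d hz
  have h : ∀ y : JetCoord m n 1, y.1 = z.1 → y.2 idx0 = z.2 idx0 →
      (c.jetTrans d y).2 idx0 = (c.trans d (z.1, z.2 idx0)).2 := by
    intro y hy1 hy0
    refine (iteratedFDeriv_zero_apply (𝕜 := ℝ) _).trans ?_
    change c.transPoly d y (c.transBase d y.1) = _
    rw [transPoly, hy1, c.transBase_transBase d hb hbd, ← hy1, taylorPoly_self, hy0]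
  have e4 : (fun t : ℝ => (c.jetTrans d (z + t • w)).2 idx0) =
      fun _ => (c.trans d (z.1, z.2 idx0)).2 :=
    funext fun t => h _ (by simp [h1]) (by simp [h0])
  rw [e4] at e2
  exact e2.unique (hasDerivAt_const _ _)

theorem fderiv_jetTrans_dirU {z : JetCoord m n 1} (hz : (z.1, z.2 idx0) ∈ c.overlap d)
    (i r : Fin m) (α : Fin n) :
    (fderiv ℝ (c.jetTrans d) z (dirU (idx1 i) α)).2 (idx1 r) =
      fderiv ℝ (d.transBase c) (c.transBase d z.1) (stdVec r) i •
        c.vertDeriv d (z.1, z.2 idx0) (stdVec α) := by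
  classical
  rw [c.fderiv_jetTrans_idx1 d hz rfl (by simp [dirU, idx0_ne_idx1])]
  have h : symMultilinear (fun I => (dirU (idx1 i) α : JetCoord m n 1).2 ⟨1, I⟩) (fun _ =>
      fderiv ℝ (d.transBase c) (c.transBase d z.1) (stdVec r)) =
      fderiv ℝ (d.transBase c) (c.transBase d z.1) (stdVec r) i • stdVec α := by
    rw [symMultilinear_apply, Finset.sum_eq_single (fun _ => i)]
    · have : (⟨1, multiIdx fun _ => i⟩ : JetIdx m 1) = idx1 i := by
        rw [idx1]
        congr 2
        ext a
        simp
      rw [this]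
      simp [dirU]
    · intro f _ hf
      have : (⟨1, multiIdx f⟩ : JetIdx m 1) ≠ idx1 i := by
        intro h
        apply hf
        have h1 : multiIdx f = multiIdx ![i] := eq_of_heq (Sigma.mk.inj h).2
        rw [multiIdx_eq_iff] at h1
        have h2 : f (0 : Fin 1) = i := by simpa using h1
        funext a
        rw [← h2]
        exact congrArg f (Subsingleton.elim (α := Fin 1) a 0)
      simp [dirU, this]
    · simp
  rw [h, vertDeriv, vertDeriv,
    ← (fderiv ℝ (fun z => (c.trans d z).2) (z.1, z.2 idx0)).map_smul]
  simp

end FiberedChart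

end FirstOrder

/-! ### Restricted symmetric multimomenta and the bundle `𝒲ᵣ` -/

section Momenta

set_option linter.unusedSectionVars false

variable {m n : ℕ} {M E : Type*}
  [TopologicalSpace M] [ChartedSpace (Rn m) M] [TopologicalSpace E] [ChartedSpace (Rn (m + n)) E]
  [IsManifold (𝓡 m) ∞ M] [IsManifold (𝓡 (m + n)) ∞ E]
  {π : FiberedManifold m n M E}

/-- Alternating `m`-forms at a point of `J¹π`. -/
abbrev JForm (j : JetSpace π 1) : Type :=
  TangentSpace 𝓘(ℝ, JetCoord m n 1) j [⋀^Fin m]→L[ℝ] ℝ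

/-- The component `p_α^i` of an `m`-form on `J¹π`: the coefficient of `du^α ∧ dᵐ⁻¹x_i`. -/
def FiberedChart.mom1 (c : FiberedChart π) {j : JetSpace π 1} (θ : JForm j) (i : Fin m)
    (α : Fin n) : ℝ :=
  θ (Function.update (fun a => c.frame j (dirX a)) i (c.frame j (dirU idx0 α)))

/-- The component `p_α^{ij}` of an `m`-form on `J¹π`: the coefficient of
`du_i^α ∧ dᵐ⁻¹x_j`. -/
def FiberedChart.mom2 (c : FiberedChart π) {j : JetSpace π 1} (θ : JForm j) (i k : Fin m)
    (α : Fin n) : ℝ :=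
  θ (Function.update (fun a => c.frame j (dirX a)) k (c.frame j (dirU (idx1 i) α)))

/-- The fibre at `j` of `Λᵐ₁(J¹π)`: the `m`-forms vanishing on one vertical vector (the semibasic
ones). -/
def Lambda1 (j : JetSpace π 1) : Submodule ℝ (JForm j) where
  carrier := {θ | ∀ v : Fin m → TangentSpace 𝓘(ℝ, JetCoord m n 1) j, ∀ a,
    IsVertical j (v a) → θ v = 0}
  add_mem' := by
    intro θ θ' h h' v a hv
    change θ v + θ' v = (0 : ℝ)
    rw [h v a hv, h' v a hv, add_zero]
  zero_mem' _ _ _ := rfl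
  smul_mem' t θ h v a hv := by
    change t • θ v = (0 : ℝ)
    rw [h v a hv, smul_zero]

/-- The fibre at `j` of `Λᵐ₂(J¹π)`: the `m`-forms vanishing on two vertical vectors. -/
def Lambda2 (j : JetSpace π 1) : Submodule ℝ (JForm j) where
  carrier := {θ | ∀ v : Fin m → TangentSpace 𝓘(ℝ, JetCoord m n 1) j, ∀ a b, a ≠ b →
    IsVertical j (v a) → IsVertical j (v b) → θ v = 0}
  add_mem' := by
    intro θ θ' h h' v a b hab hv hv'
    change θ v + θ' v = (0 : ℝ)
    rw [h v a b hab hv hv', h' v a b hab hv hv', add_zero]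
  zero_mem' _ _ _ _ _ _ := rfl
  smul_mem' t θ h v a b hab hv hv' := by
    change t • θ v = (0 : ℝ)
    rw [h v a b hab hv hv', smul_zero]

/-- The fibre at `j` of the extended `2`-symmetric multimomentum bundle `J²π†`: the forms in
`Λᵐ₂(J¹π)` whose components satisfy `p_α^{ij} = p_α^{ji}`. -/
def J2dagger (j : JetSpace π 1) : Submodule ℝ (JForm j) where
  carrier := {θ | θ ∈ Lambda2 j ∧ ∀ c : FiberedChart π, j ∈ c.jetSource 1 → ∀ i k α,
    c.mom2 θ i k α = c.mom2 θ k i α}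
  add_mem' := by
    intro θ θ' h h'
    refine ⟨add_mem h.1 h'.1, fun c hc i k α => ?_⟩
    change c.mom2 θ i k α + c.mom2 θ' i k α = c.mom2 θ k i α + c.mom2 θ' k i α
    rw [h.2 c hc, h'.2 c hc]
  zero_mem' := ⟨zero_mem _, fun _ _ _ _ _ => rfl⟩
  smul_mem' := by
    intro t θ h
    refine ⟨Submodule.smul_mem _ _ h.1, fun c hc i k α => ?_⟩
    change t • c.mom2 θ i k α = t • c.mom2 θ k i α
    rw [h.2 c hc]

/-- Two symmetric forms are equivalent if they differ by an element of `Λᵐ₁(J¹π)`. -/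
def J2ddaggerSetoid (j : JetSpace π 1) : Setoid (J2dagger j) where
  r θ θ' := (θ : JForm j) - (θ' : JForm j) ∈ Lambda1 j
  iseqv :=
    { refl := fun θ => by
        rw [sub_self]
        exact zero_mem _
      symm := fun {θ θ'} h => by
        rw [← neg_sub]
        exact neg_mem h
      trans := fun {θ θ' θ''} h h' => by
        rw [← sub_add_sub_cancel (θ : JForm j) (θ' : JForm j)]
        exact add_mem h h' }

/-- The fibre at `j` of the restricted `2`-symmetric multimomentum bundle
`J²π‡ = J²π† / Λᵐ₁(J¹π)`. -/
def J2ddagger (j : JetSpace π 1) : Type := Quotient (J2ddaggerSetoid j)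

/-- The projection `J²π† → J²π‡`. -/
def J2ddagger.mk {j : JetSpace π 1} (θ : J2dagger j) : J2ddagger j :=
  Quotient.mk (J2ddaggerSetoid j) θ

/-- The coordinates `(p_α^i, p_α^I)` of a form; here `p_α^{1_i+1_j} = n(ij) p_α^{ij}`. -/
def FiberedChart.components (c : FiberedChart π) {j : JetSpace π 1} (θ : JForm j) :
    MomCoord m n :=
  (fun i α => c.mom1 θ i α,
    fun I α => mult (enumIdx I 0) (enumIdx I 1) * c.mom2 θ (enumIdx I 0) (enumIdx I 1) α)

/-- The form with coordinates `p` and vanishing `dᵐx`-component. -/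
def FiberedChart.formOf (c : FiberedChart π) (j : JetSpace π 1) (p : MomCoord m n) : JForm j :=
  (modelForm p).compContinuousLinearMap (c.dcoord j)

theorem idx2_comm (i k : Fin m) : idx2 i k = idx2 k i := by
  rw [idx2, idx2, multiIdx_eq_iff]
  simpa using List.Perm.swap k i []

theorem mult_comm (i k : Fin m) : mult i k = mult k i := by
  simp only [mult, eq_comm]

theorem mult_ne_zero (i k : Fin m) : mult i k ≠ 0 := by
  unfold mult
  split_ifs <;> norm_num

theorem idx2_enumIdx (I : Sym (Fin m) 2) : idx2 (enumIdx I 0) (enumIdx I 1) = I := by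
  conv_rhs => rw [← multiIdx_enumIdx I]
  rw [idx2]
  congr 1
  funext a
  fin_cases a <;> rfl

theorem enumIdx_idx2 (i k : Fin m) :
    (enumIdx (idx2 i k) 0 = i ∧ enumIdx (idx2 i k) 1 = k) ∨
      (enumIdx (idx2 i k) 0 = k ∧ enumIdx (idx2 i k) 1 = i) := by
  have h := idx2_enumIdx (idx2 i k)
  generalize enumIdx (idx2 i k) 0 = a at h ⊢
  generalize enumIdx (idx2 i k) 1 = b at h ⊢
  rw [idx2, idx2, multiIdx_eq_iff] at h
  have h' : List.Perm [a, b] [i, k] := by simpa using h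
  have ha : a ∈ [i, k] := h'.subset (by simp)
  simp only [List.mem_cons, List.not_mem_nil, or_false] at ha
  rcases ha with rfl | rfl
  · left
    have := (List.perm_cons _).1 h'
    exact ⟨rfl, by simpa using this⟩
  · right
    have := (List.perm_cons _).1 (h'.trans (List.Perm.swap _ _ _))
    exact ⟨rfl, by simpa using this⟩

namespace FiberedChart

variable {c d : FiberedChart π} {j : JetSpace π 1}

theorem isVertical_frame (hj : j ∈ c.jetSource 1) (I : JetIdx m 1) (α : Fin n) :
    IsVertical j (c.frame j (dirU I α)) := by
  rw [isVertical_iff hj, dcoord_frame hj]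
  rfl

theorem comp_update (k : Fin m) (w : Fin m → JetCoord m n 1)
    (ξ : JetCoord m n 1) :
    (fun b => d.dcoord j ((Function.update (fun a => c.frame j (w a)) k (c.frame j ξ) :
        Fin m → TangentSpace 𝓘(ℝ, JetCoord m n 1) j) b)) =
      Function.update (fun a => d.dcoord j (c.frame j (w a))) k (d.dcoord j (c.frame j ξ)) := by
  funext b
  by_cases hb : b = k
  · subst hb
    simp
  · simp [hb]

/-- Components in the chart `d` of a form given by its coordinates in the chart `c`. -/
theorem formOf_update (hc : j ∈ c.jetSource 1) (hd : j ∈ d.jetSource 1) (p : MomCoord m n)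
    (k : Fin m) (ξ : JetCoord m n 1) :
    c.formOf j p (Function.update (fun a => d.frame j (dirX a)) k (d.frame j ξ)) =
      modelForm p (Function.update
        (fun a => fderiv ℝ (d.jetTrans c) (d.jetCoords j) (dirX a)) k
        (fderiv ℝ (d.jetTrans c) (d.jetCoords j) ξ)) := by
  change modelForm p (fun b => c.dcoord j (_ : TangentSpace 𝓘(ℝ, JetCoord m n 1) j)) = _
  rw [comp_update]
  simp only [dcoord_frame_change hd hc]

theorem formOf_mem_Lambda2 (hc : j ∈ c.jetSource 1) (p : MomCoord m n) :
    c.formOf j p ∈ Lambda2 j := by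
  intro v a b hab ha hb
  exact modelForm_eq_zero p _ hab ((isVertical_iff hc _).1 ha) ((isVertical_iff hc _).1 hb)

theorem mom1_formOf (hc : j ∈ c.jetSource 1) (p : MomCoord m n) (i : Fin m) (α : Fin n) :
    c.mom1 (c.formOf j p) i α = p.1 i α := by
  change modelForm p (fun b => c.dcoord j (_ : TangentSpace 𝓘(ℝ, JetCoord m n 1) j)) = _
  rw [comp_update]
  simp only [dcoord_frame hc]
  exact modelForm_mom1 p i α

theorem mom2_formOf (hc : j ∈ c.jetSource 1) (p : MomCoord m n) (i k : Fin m) (α : Fin n) :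
    c.mom2 (c.formOf j p) i k α = (mult i k)⁻¹ * p.2 (idx2 i k) α := by
  change modelForm p (fun b => c.dcoord j (_ : TangentSpace 𝓘(ℝ, JetCoord m n 1) j)) = _
  rw [comp_update]
  simp only [dcoord_frame hc]
  exact modelForm_mom2 p i k α

theorem components_formOf (hc : j ∈ c.jetSource 1) (p : MomCoord m n) :
    c.components (c.formOf j p) = p := by
  refine Prod.ext ?_ ?_
  · funext i α
    exact mom1_formOf hc p i α
  · funext I α
    change mult _ _ * c.mom2 _ _ _ _ = _
    rw [mom2_formOf hc, idx2_enumIdx, mul_inv_cancel_left₀ (mult_ne_zero _ _)]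

/-- The symmetry of the components `p_α^{ij}` does not depend on the chart. -/
theorem mom2_formOf_symm (hc : j ∈ c.jetSource 1) (hd : j ∈ d.jetSource 1) (p : MomCoord m n)
    (i k : Fin m) (α : Fin n) : d.mom2 (c.formOf j p) i k α = d.mom2 (c.formOf j p) k i α := by
  have hz := jetCoords_mem_overlap hd hc
  obtain ⟨hb, hbd, hbc⟩ := d.mem_base_of_overlap c hz
  set z := d.jetCoords j with hzdef
  set y := d.transBase c z.1 with hy
  let Q : Matrix (Fin m) (Fin m) ℝ :=
    Matrix.of fun a b => fderiv ℝ (c.transBase d) y (stdVec a) b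
  let N : Matrix (Fin m) (Fin m) ℝ :=
    Matrix.of fun b a => (fderiv ℝ (d.jetTrans c) z (dirX b)).1 a
  have hNQ : N * Q = 1 := by
    have hST : (fun x => c.transBase d (d.transBase c x)) =ᶠ[𝓝 z.1] id := by
      filter_upwards [d.base.open_target.mem_nhds hb,
        (d.base.continuousAt_symm hb).eventually (c.base.open_source.mem_nhds hbc)] with x h1 h2
      exact d.transBase_transBase c h1 h2
    have hT : DifferentiableAt ℝ (d.transBase c) z.1 := by
      have := (d.transBase_smooth c hbd hbc).differentiableAt (by simp)
      rwa [d.base.right_inv hb] at this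
    have hS : DifferentiableAt ℝ (c.transBase d) (d.transBase c z.1) :=
      (c.transBase_smooth d hbc hbd).differentiableAt (by simp)
    have hcomp := (hS.hasFDerivAt.comp z.1 hT.hasFDerivAt).congr_of_eventuallyEq hST.symm
    have heq := hcomp.unique (hasFDerivAt_id z.1)
    ext b e
    have h1 : fderiv ℝ (c.transBase d) y (fderiv ℝ (d.transBase c) z.1 (stdVec b)) = stdVec b :=
      DFunLike.congr_fun heq (stdVec b)
    have h2 : fderiv ℝ (d.transBase c) z.1 (stdVec b) = ∑ a, N b a • stdVec a := by
      have h3 : ∀ a, N b a = fderiv ℝ (d.transBase c) z.1 (stdVec b) a := by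
        intro a
        change (fderiv ℝ (d.jetTrans c) z (dirX b)).1 a = _
        rw [d.fderiv_jetTrans_fst c hz]
        rfl
      simp only [h3]
      ext a
      simp [Finset.sum_apply, Pi.single_apply]
    rw [h2] at h1
    have h4 := congrArg (fun v : Rn m => v e) h1
    simp only [map_sum, map_smul] at h4
    rw [Matrix.mul_apply, Matrix.one_apply]
    simpa [Pi.single_apply, Q, eq_comm] using h4
  have hadj : ∀ s k, N.adjugate s k = N.det * Q s k := by
    intro s k
    have : N.adjugate = N.det • Q := by
      calc N.adjugate = N.adjugate * (N * Q) := by rw [hNQ, mul_one]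
        _ = N.det • Q := by rw [← mul_assoc, Matrix.adjugate_mul, smul_mul_assoc, one_mul]
    rw [this]
    rfl
  have key : ∀ i k, d.mom2 (c.formOf j p) i k α = ∑ r, ∑ s, ∑ β,
      ((mult r s)⁻¹ * p.2 (idx2 r s) β) *
        ((Q r i * d.vertDeriv c (z.1, z.2 idx0) (stdVec α) β) * (N.det * Q s k)) := by
    intro i k
    have hξ1 : (fderiv ℝ (d.jetTrans c) z (dirU (idx1 i) α)).1 = 0 := by
      rw [d.fderiv_jetTrans_fst c hz]
      exact map_zero (fderiv ℝ (d.transBase c) z.1)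
    have hξ0 : (fderiv ℝ (d.jetTrans c) z (dirU (idx1 i) α)).2 idx0 = 0 :=
      d.fderiv_jetTrans_idx0 c hz rfl (by simp [dirU, idx0_ne_idx1])
    rw [mom2, formOf_update hc hd, ← hzdef, modelForm]
    have e0 : ∀ s β, elemForm (coordU idx0 β) s (Function.update
        (fun a => fderiv ℝ (d.jetTrans c) z (dirX a)) k
        (fderiv ℝ (d.jetTrans c) z (dirU (idx1 i) α))) = 0 := by
      intro s β
      rw [elemForm_update _ _ _ _ _ hξ1]
      have : coordU idx0 β (fderiv ℝ (d.jetTrans c) z (dirU (idx1 i) α)) = 0 := by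
        change (fderiv ℝ (d.jetTrans c) z (dirU (idx1 i) α)).2 idx0 β = 0
        rw [hξ0]
        rfl
      rw [this, zero_mul]
    have e1 : ∀ r s β, elemForm (coordU (idx1 r) β) s (Function.update
        (fun a => fderiv ℝ (d.jetTrans c) z (dirX a)) k
        (fderiv ℝ (d.jetTrans c) z (dirU (idx1 i) α))) =
        (Q r i * d.vertDeriv c (z.1, z.2 idx0) (stdVec α) β) * (N.det * Q s k) := by
      intro r s β
      rw [elemForm_update _ _ _ _ _ hξ1]
      have : coordU (idx1 r) β (fderiv ℝ (d.jetTrans c) z (dirU (idx1 i) α)) =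
          Q r i * d.vertDeriv c (z.1, z.2 idx0) (stdVec α) β := by
        change (fderiv ℝ (d.jetTrans c) z (dirU (idx1 i) α)).2 (idx1 r) β = _
        rw [d.fderiv_jetTrans_dirU c hz]
        rfl
      rw [this]
      congr 1
      exact hadj s k
    simp only [ContinuousAlternatingMap.add_apply, ContinuousAlternatingMap.sum_apply,
      ContinuousAlternatingMap.smul_apply, e0, e1, Finset.sum_const_zero, zero_add,
      smul_eq_mul, mul_zero]
  rw [key, key, Finset.sum_comm]
  refine Finset.sum_congr rfl fun s _ => Finset.sum_congr rfl fun r _ =>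
    Finset.sum_congr rfl fun β _ => ?_
  rw [mult_comm, idx2_comm]
  ring

theorem formOf_mem (hc : j ∈ c.jetSource 1) (p : MomCoord m n) : c.formOf j p ∈ J2dagger j :=
  ⟨formOf_mem_Lambda2 hc p, fun _ hd i k α => mom2_formOf_symm hc hd p i k α⟩

/-- A symmetric form is determined modulo `Λᵐ₁(J¹π)` by its components. -/
theorem sub_formOf_mem (hc : j ∈ c.jetSource 1) {θ : JForm j} (hθ : θ ∈ J2dagger j) :
    θ - c.formOf j (c.components θ) ∈ Lambda1 j := by
  have hmem := (J2dagger j).sub_mem hθ (formOf_mem hc (c.components θ))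
  set τ := θ - c.formOf j (c.components θ) with hτ
  have h1 : ∀ i α, c.mom1 τ i α = 0 := by
    intro i α
    change c.mom1 θ i α - c.mom1 (c.formOf j (c.components θ)) i α = 0
    rw [mom1_formOf hc]
    exact sub_self _
  have h2 : ∀ i k α, c.mom2 τ i k α = 0 := by
    intro i k α
    change c.mom2 θ i k α - c.mom2 (c.formOf j (c.components θ)) i k α = 0
    rw [mom2_formOf hc]
    change _ - _ * (mult _ _ * c.mom2 θ _ _ α) = (0 : ℝ)
    rcases enumIdx_idx2 i k with ⟨h1, h2⟩ | ⟨h1, h2⟩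
    · rw [h1, h2, inv_mul_cancel_left₀ (mult_ne_zero _ _), sub_self]
    · rw [h1, h2, mult_comm, inv_mul_cancel_left₀ (mult_ne_zero _ _), hθ.2 c hc, sub_self]
  intro v a ha
  let γ : JetCoord m n 1 [⋀^Fin m]→L[ℝ] ℝ := τ.compContinuousLinearMap (c.frame j)
  have hγ := eq_zero_of_components γ
    (fun v a b hab ha hb => hmem.1 _ a b hab
      (by rw [isVertical_iff hc]; change (c.dcoord j (c.frame j (v a))).1 = 0; rwa [dcoord_frame hc])
      (by rw [isVertical_iff hc]; change (c.dcoord j (c.frame j (v b))).1 = 0; rwa [dcoord_frame hc]))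
    (fun k I α => by
      have hupd : (fun b => c.frame j ((Function.update (fun i => dirX i) k (dirU I α) :
          Fin m → JetCoord m n 1) b)) =
          Function.update (fun a => c.frame j (dirX a)) k (c.frame j (dirU I α)) := by
        funext b
        by_cases hb : b = k
        · subst hb
          simp
        · simp [hb]
      change τ (fun b => c.frame j _) = 0
      rw [hupd]
      rcases idx_cases I with rfl | ⟨i, rfl⟩
      · exact h1 k α
      · exact h2 i k α)
    (fun b => c.dcoord j (v b)) a ((isVertical_iff hc _).1 ha)
  have : τ v = γ fun b => c.dcoord j (v b) := by
    change τ v = τ fun b => c.frame j (c.dcoord j (v b))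
    simp only [frame_dcoord hc]
  rw [this, hγ]

/-- Components only depend on the class modulo `Λᵐ₁(J¹π)`. -/
theorem components_congr (hc : j ∈ c.jetSource 1) {θ θ' : JForm j} (h : θ - θ' ∈ Lambda1 j) :
    c.components θ = c.components θ' := by
  have h0 : ∀ k I α, θ (Function.update (fun a => c.frame j (dirX a)) k (c.frame j (dirU I α))) =
      θ' (Function.update (fun a => c.frame j (dirX a)) k (c.frame j (dirU I α))) := by
    intro k I α
    refine sub_eq_zero.1 (h _ k ?_)
    rw [Function.update_self]
    exact isVertical_frame hc I α
  refine Prod.ext ?_ ?_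
  · funext i α
    exact h0 _ _ _
  · funext I α
    exact congrArg (fun t => mult (enumIdx I 0) (enumIdx I 1) * t) (h0 _ _ _)

end FiberedChart

end Momenta

/-! ### The manifold `𝒲ᵣ = J³π ×_{J¹π} J²π‡` -/

section Unified

set_option linter.unusedSectionVars false

variable {m n : ℕ} {M E : Type*}
  [TopologicalSpace M] [ChartedSpace (Rn m) M] [TopologicalSpace E] [ChartedSpace (Rn (m + n)) E]
  [IsManifold (𝓡 m) ∞ M] [IsManifold (𝓡 (m + n)) ∞ E]

/-- The projection `π³₁ : J³π → J¹π`. -/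
abbrev JetSpace.toJ1 {π : FiberedManifold m n M E} (j : JetSpace π 3) : JetSpace π 1 :=
  j.proj 1 (by norm_num)

/-- The projection `π³₂ : J³π → J²π`. -/
abbrev JetSpace.toJ2 {π : FiberedManifold m n M E} (j : JetSpace π 3) : JetSpace π 2 :=
  j.proj 2 (by norm_num)

/-- The restricted `2`-symmetric jet-multimomentum bundle `𝒲ᵣ = J³π ×_{J¹π} J²π‡`. -/
structure RestrictedBundle (π : FiberedManifold m n M E) where
  jet : JetSpace π 3
  mom : J2ddagger jet.toJ1

/-- The coordinates `(xⁱ, u_I^α, p_α^i, p_α^K)`, `|I| ≤ 3`, `|K| = 2`, of `𝒲ᵣ`. -/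
abbrev WCoord (m n : ℕ) : Type := JetCoord m n 3 × MomCoord m n

variable {π : FiberedManifold m n M E}

namespace FiberedChart

variable (c d : FiberedChart π)

/-- The coordinates `(p_α^i, p_α^I)` of a restricted momentum. -/
def momCoords {j : JetSpace π 1} (q : J2ddagger j) : MomCoord m n :=
  c.components (Quotient.out (s := J2ddaggerSetoid j) q : J2dagger j).1

theorem momCoords_mk {j : JetSpace π 1} (hc : j ∈ c.jetSource 1) (θ : J2dagger j) :
    c.momCoords (J2ddagger.mk θ) = c.components θ.1 := by
  have h : (J2ddaggerSetoid j).r (Quotient.out (s := J2ddaggerSetoid j) (J2ddagger.mk θ)) θ :=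
    Quotient.mk_out (s := J2ddaggerSetoid j) θ
  exact components_congr hc h

open Classical in
/-- The restricted momentum with given coordinates. -/
def momSymm (j : JetSpace π 1) (p : MomCoord m n) : J2ddagger j :=
  if h : j ∈ c.jetSource 1 then J2ddagger.mk ⟨c.formOf j p, formOf_mem h p⟩
  else J2ddagger.mk 0

theorem momSymm_eq {j : JetSpace π 1} (hc : j ∈ c.jetSource 1) (p : MomCoord m n) :
    c.momSymm j p = J2ddagger.mk ⟨c.formOf j p, formOf_mem hc p⟩ := dif_pos hc

theorem momCoords_momSymm {j : JetSpace π 1} (hc : j ∈ c.jetSource 1) (p : MomCoord m n) :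
    c.momCoords (c.momSymm j p) = p := by
  rw [momSymm_eq c hc, momCoords_mk c hc, components_formOf hc]

theorem momSymm_momCoords {j : JetSpace π 1} (hc : j ∈ c.jetSource 1) (q : J2ddagger j) :
    c.momSymm j (c.momCoords q) = q := by
  obtain ⟨θ, rfl⟩ : ∃ θ, q = J2ddagger.mk θ :=
    ⟨_, (Quotient.out_eq (s := J2ddaggerSetoid j) q).symm⟩
  rw [momCoords_mk c hc, momSymm_eq c hc]
  refine Quotient.sound (s := J2ddaggerSetoid j) ?_
  change c.formOf j (c.components θ.1) - θ.1 ∈ Lambda1 j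
  rw [← neg_sub]
  exact neg_mem (sub_formOf_mem hc θ.2)

/-- The natural coordinates on `𝒲ᵣ` induced by an adapted chart. -/
def wCoords (w : RestrictedBundle π) : WCoord m n := (c.jetCoords w.jet, c.momCoords w.mom)

/-- The point of `𝒲ᵣ` with given natural coordinates. -/
def wSymm (z : WCoord m n) : RestrictedBundle π :=
  ⟨c.jetSymm z.1, c.momSymm (c.jetSymm z.1).toJ1 z.2⟩

/-- The domain of the natural coordinates on `𝒲ᵣ`. -/
def wSource : Set (RestrictedBundle π) := {w | w.jet ∈ c.jetSource 3}

/-- The natural chart of `𝒲ᵣ` induced by an adapted chart. -/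
def wChart : PartialEquiv (RestrictedBundle π) (WCoord m n) where
  toFun := c.wCoords
  invFun := c.wSymm
  source := c.wSource
  target := {z | z.1 ∈ c.jetTarget 3}
  map_source' _ hw := (c.jetChart 3).map_source hw
  map_target' _ hz := (c.jetChart 3).map_target hz
  left_inv' := by
    rintro ⟨j, q⟩ hj
    have h1 : c.jetSymm (c.jetCoords j) = j := (c.jetChart 3).left_inv hj
    change (⟨c.jetSymm (c.jetCoords j),
      c.momSymm (c.jetSymm (c.jetCoords j)).toJ1 (c.momCoords q)⟩ : RestrictedBundle π) = ⟨j, q⟩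
    rw [h1, momSymm_momCoords c (proj_mem_jetSource hj 1 (by norm_num))]
  right_inv' := by
    intro z hz
    have hj : c.jetSymm z.1 ∈ c.jetSource 3 := (c.jetChart 3).map_target hz
    refine Prod.ext ((c.jetChart 3).right_inv hz) ?_
    exact c.momCoords_momSymm (proj_mem_jetSource hj 1 (by norm_num)) z.2

theorem wChart_trans_source :
    (c.wChart.symm.trans d.wChart).source =
      {z | (z.1.1, z.1.2 idx0) ∈ c.overlap d} := by
  have h := c.jetChart_trans_source d (k := 3)
  ext z
  exact Set.ext_iff.1 h z.1

/-- The change of the coordinates `(p_α^i, p_α^I)`. -/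
def momTrans (z : WCoord m n) : MomCoord m n :=
  let T : JetCoord m n 1 →L[ℝ] JetCoord m n 1 :=
    fderiv ℝ (d.jetTrans c) ((c.jetTrans d z.1).trunc 1 (by norm_num))
  (fun i α => modelForm z.2 (Function.update (fun a => T (dirX a)) i (T (dirU idx0 α))),
    fun I α => mult (enumIdx I 0) (enumIdx I 1) * modelForm z.2
      (Function.update (fun a => T (dirX a)) (enumIdx I 1) (T (dirU (idx1 (enumIdx I 0)) α))))

theorem wCoords_wSymm {z : WCoord m n} (hz : (z.1.1, z.1.2 idx0) ∈ c.overlap d) :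
    d.wCoords (c.wSymm z) = (c.jetTrans d z.1, c.momTrans d z) := by
  have h1 := c.jetCoords_jetSymm d hz
  have hs : z.1 ∈ ((c.jetChart 3).symm.trans (d.jetChart 3)).source := by
    rw [c.jetChart_trans_source d]
    exact hz
  have hc : c.jetSymm z.1 ∈ c.jetSource 3 := (c.jetChart 3).map_target hs.1
  have hd : c.jetSymm z.1 ∈ d.jetSource 3 := hs.2
  refine Prod.ext h1 ?_
  change d.momCoords (c.momSymm (c.jetSymm z.1).toJ1 z.2) = _
  have hc1 := proj_mem_jetSource hc 1 (by norm_num)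
  have hd1 := proj_mem_jetSource hd 1 (by norm_num)
  rw [momSymm_eq c hc1, momCoords_mk d hd1]
  have hT : (c.jetTrans d z.1).trunc 1 (by norm_num) = d.jetCoords (c.jetSymm z.1).toJ1 := by
    rw [jetCoords_proj hd, h1]
  simp only [momTrans, hT, ← formOf_update hc1 hd1]
  rfl

theorem contDiff_modelForm {N : WithTop ℕ∞} :
    ContDiff ℝ N fun q : MomCoord m n × (Fin m → JetCoord m n 1) => modelForm q.1 q.2 := by
  have h : ∀ (l : JetCoord m n 1 →L[ℝ] ℝ) (s : Fin m),
      ContDiff ℝ N fun q : MomCoord m n × (Fin m → JetCoord m n 1) => elemForm l s q.2 :=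
    fun l s => ((elemForm l s).toContinuousMultilinearMap.contDiff).comp contDiff_snd
  simp only [modelForm, ContinuousAlternatingMap.add_apply, ContinuousAlternatingMap.sum_apply,
    ContinuousAlternatingMap.smul_apply]
  refine ContDiff.add (ContDiff.sum fun i _ => ContDiff.sum fun α _ => ?_)
    (ContDiff.sum fun i _ => ContDiff.sum fun k _ => ContDiff.sum fun α _ => ?_)
  · have h1 : ContDiff ℝ N fun q : MomCoord m n × (Fin m → JetCoord m n 1) => q.1.1 i α := by
      fun_prop
    exact h1.smul (h _ _)
  · have h1 : ContDiff ℝ N fun q : MomCoord m n × (Fin m → JetCoord m n 1) =>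
        (mult i k)⁻¹ * q.1.2 (idx2 i k) α := by fun_prop
    exact h1.smul (h _ _)

theorem contDiffAt_modelForm {z : WCoord m n} {f : WCoord m n → Fin m → JetCoord m n 1}
    (hf : ContDiffAt ℝ ∞ f z) : ContDiffAt ℝ ∞ (fun z => modelForm z.2 (f z)) z :=
  ContDiffAt.comp (g := fun q : MomCoord m n × (Fin m → JetCoord m n 1) => modelForm q.1 q.2)
    (f := fun z => (z.2, f z)) z contDiff_modelForm.contDiffAt (contDiffAt_snd.prodMk hf)

theorem momTrans_smooth {z : WCoord m n} (hz : (z.1.1, z.1.2 idx0) ∈ c.overlap d) :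
    ContDiffAt ℝ ∞ (c.momTrans d) z := by
  have h0 : ContDiffAt ℝ ∞ (fun z : WCoord m n => (c.jetTrans d z.1).trunc 1 (by norm_num)) z := by
    have h1 : ContDiff ℝ ∞ (fun y : JetCoord m n 3 => y.trunc 1 (by norm_num)) := by
      unfold JetCoord.trunc
      fun_prop
    exact h1.contDiffAt.comp z ((c.jetTrans_smooth d hz).comp z contDiffAt_fst)
  have hz' : (((c.jetTrans d z.1).trunc 1 (by norm_num)).1,
      ((c.jetTrans d z.1).trunc 1 (by norm_num)).2 idx0) ∈ d.overlap c := by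
    have hs : z.1 ∈ ((c.jetChart 3).symm.trans (d.jetChart 3)).source := by
      rw [c.jetChart_trans_source d]
      exact hz
    have := jetCoords_mem_overlap (k := 3) (c := d) (d := c) (j := c.jetSymm z.1) hs.2
      ((c.jetChart 3).map_target hs.1)
    rwa [c.jetCoords_jetSymm d hz] at this
  have hT : ContDiffAt ℝ ∞ (fun z : WCoord m n =>
      fderiv ℝ (d.jetTrans c) ((c.jetTrans d z.1).trunc 1 (by norm_num))) z :=
    ((d.jetTrans_smooth c hz').fderiv_right (m := ∞) (by simp)).comp z h0
  have hv : ∀ k ξ, ContDiffAt ℝ ∞ (fun z : WCoord m n => modelForm z.2 (Function.update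
      (fun a => fderiv ℝ (d.jetTrans c) ((c.jetTrans d z.1).trunc 1 (by norm_num)) (dirX a)) k
      (fderiv ℝ (d.jetTrans c) ((c.jetTrans d z.1).trunc 1 (by norm_num)) ξ))) z := by
    intro k ξ
    have hu : ContDiffAt ℝ ∞ (fun z : WCoord m n => (Function.update
        (fun a => fderiv ℝ (d.jetTrans c) ((c.jetTrans d z.1).trunc 1 (by norm_num)) (dirX a)) k
        (fderiv ℝ (d.jetTrans c) ((c.jetTrans d z.1).trunc 1 (by norm_num)) ξ) :
          Fin m → JetCoord m n 1)) z := by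
      refine contDiffAt_pi.2 fun b => ?_
      by_cases hb : b = k
      · subst hb
        simp only [Function.update_self]
        exact hT.clm_apply contDiffAt_const
      · simp only [Function.update_of_ne hb]
        exact hT.clm_apply contDiffAt_const
    exact contDiffAt_modelForm hu
  refine ContDiffAt.prodMk ?_ ?_
  · exact contDiffAt_pi.2 fun i => contDiffAt_pi.2 fun α => hv _ _
  · exact contDiffAt_pi.2 fun I => contDiffAt_pi.2 fun α => contDiffAt_const.mul (hv _ _)

theorem wChart_contDiffOn :
    ContDiffOn ℝ ∞ (c.wChart.symm.trans d.wChart) (c.wChart.symm.trans d.wChart).source := by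
  rw [wChart_trans_source]
  intro z hz
  have hs : ContDiffAt ℝ ∞ (fun z : WCoord m n => (c.jetTrans d z.1, c.momTrans d z)) z :=
    ((c.jetTrans_smooth d hz).comp z contDiffAt_fst).prodMk (c.momTrans_smooth d hz)
  refine (hs.congr_of_eventuallyEq ?_).contDiffWithinAt
  have ho : IsOpen {z : WCoord m n | (z.1.1, z.1.2 idx0) ∈ c.overlap d} :=
    (c.isOpen_overlap d).preimage (by fun_prop)
  filter_upwards [ho.mem_nhds hz] with y hy
  exact c.wCoords_wSymm d hy

variable (π) in
/-- The atlas of natural charts of `𝒲ᵣ`. -/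
def wCore : ChartedSpaceCore (WCoord m n) (RestrictedBundle π) where
  atlas := Set.range fun c : FiberedChart π => c.wChart
  chartAt w := (Classical.choose (exists_mem π w.jet.toE)).wChart
  mem_chart_source w := Classical.choose_spec (exists_mem π w.jet.toE)
  chart_mem_atlas w := Set.mem_range_self _
  open_source := by
    rintro _ _ ⟨c, rfl⟩ ⟨d, rfl⟩
    rw [wChart_trans_source]
    exact (c.isOpen_overlap d).preimage (by fun_prop)
  continuousOn_toFun := by
    rintro _ _ ⟨c, rfl⟩ ⟨d, rfl⟩
    exact (c.wChart_contDiffOn d).continuousOn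

end FiberedChart

instance RestrictedBundle.topologicalSpace : TopologicalSpace (RestrictedBundle π) :=
  (FiberedChart.wCore π).toTopologicalSpace

/-- The smooth atlas of `𝒲ᵣ` formed by the natural charts. -/
instance RestrictedBundle.chartedSpace : ChartedSpace (WCoord m n) (RestrictedBundle π) :=
  (FiberedChart.wCore π).toChartedSpace

instance RestrictedBundle.isManifold :
    IsManifold 𝓘(ℝ, WCoord m n) ∞ (RestrictedBundle π) := by
  refine isManifold_of_core (FiberedChart.wCore π) ?_
  rintro _ ⟨c, rfl⟩ _ ⟨d, rfl⟩
  exact c.wChart_contDiffOn d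

end Unified

/-! ### Differential forms on manifolds -/

section Forms

/-- The exterior derivative of an `r`-form on a manifold, computed in the preferred chart at each
point. -/
def extDerivManifold {H : Type*} [NormedAddCommGroup H] [NormedSpace ℝ H] {N : Type*}
    [TopologicalSpace N] [ChartedSpace H N] {r : ℕ}
    (θ : ∀ w : N, TangentSpace 𝓘(ℝ, H) w [⋀^Fin r]→L[ℝ] ℝ) (w : N) :
    TangentSpace 𝓘(ℝ, H) w [⋀^Fin (r + 1)]→L[ℝ] ℝ :=
  let e := extChartAt 𝓘(ℝ, H) w
  let θe : H → H [⋀^Fin r]→L[ℝ] ℝ := fun z =>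
    (θ (e.symm z)).compContinuousLinearMap (mfderiv 𝓘(ℝ, H) 𝓘(ℝ, H) e.symm z)
  (extDeriv θe (e w)).compContinuousLinearMap (mfderiv 𝓘(ℝ, H) 𝓘(ℝ, H) e w)

/-- The coefficient of an `m`-form `η` on `M` with respect to `dᵐx` in a chart. -/
def topCoeff {m : ℕ} {M : Type*} [TopologicalSpace M] [ChartedSpace (Rn m) M]
    (η : ∀ x : M, TangentSpace (𝓡 m) x [⋀^Fin m]→L[ℝ] ℝ) (e : OpenPartialHomeomorph M (Rn m))
    (y : Rn m) : ℝ :=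
  η (e.symm y) fun i => mfderiv (𝓡 m) (𝓡 m) e.symm y (stdVec i)

/-- A (smooth, nowhere vanishing) volume form on an `m`-dimensional manifold. -/
structure VolumeForm (m : ℕ) (M : Type*) [TopologicalSpace M] [ChartedSpace (Rn m) M] where
  form : ∀ x : M, TangentSpace (𝓡 m) x [⋀^Fin m]→L[ℝ] ℝ
  smooth : ∀ e ∈ atlas (Rn m) M, ContDiffOn ℝ ∞ (topCoeff form e) e.target
  ne_zero : ∀ x, form x ≠ 0

/-- A smooth vector field on a manifold. -/
structure SmoothVectorField (H : Type*) [NormedAddCommGroup H] [NormedSpace ℝ H] (N : Type*)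
    [TopologicalSpace N] [ChartedSpace H N] [IsManifold 𝓘(ℝ, H) ∞ N] where
  field : ∀ w : N, TangentSpace 𝓘(ℝ, H) w
  smooth : ContMDiff 𝓘(ℝ, H) 𝓘(ℝ, H).tangent ∞
    (fun w => (⟨w, field w⟩ : TangentBundle 𝓘(ℝ, H) N))

/-- A vector field is tangent to a submanifold `S` if at each point of `S` its value is the
velocity of a smooth curve lying in `S`. -/
def SmoothVectorField.TangentTo {H : Type*} [NormedAddCommGroup H] [NormedSpace ℝ H] {N : Type*}
    [TopologicalSpace N] [ChartedSpace H N] [IsManifold 𝓘(ℝ, H) ∞ N]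
    (X : SmoothVectorField H N) (S : Set N) : Prop :=
  ∀ w ∈ S, ∃ γ : ℝ → N, γ 0 = w ∧ (∀ᶠ t in 𝓝 0, γ t ∈ S) ∧
    ContMDiffAt 𝓘(ℝ, ℝ) 𝓘(ℝ, H) ∞ γ 0 ∧
      (mfderiv 𝓘(ℝ, ℝ) 𝓘(ℝ, H) γ 0 (1 : ℝ) : H) = X.field w

end Forms

/-! ### The Hamiltonian section and the form `Ω_r` -/

section Unified

set_option linter.unusedSectionVars false

variable {m n : ℕ} {M E : Type*}
  [TopologicalSpace M] [ChartedSpace (Rn m) M] [TopologicalSpace E] [ChartedSpace (Rn (m + n)) E]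
  [IsManifold (𝓡 m) ∞ M] [IsManifold (𝓡 (m + n)) ∞ E]
  {π : FiberedManifold m n M E}

open Classical in
/-- The first prolongation `y ↦ j¹_y φ` of a local section (a constant where `φ` is not a smooth
section). -/
def LocalSection.prolong (s : LocalSection π) (y : M) : JetSpace π 1 :=
  if h : IsSectionAt π s.toFun y then jet 1 h else jet 1 s.isSection

/-- The differential `T_x(j¹φ) : T_xM → T_{j¹_xφ}J¹π` at a jet `j³_xφ`. -/
def JetSpace.holonomicLift (j : JetSpace π 3) :
    TangentSpace (𝓡 m) j.toBase →L[ℝ] TangentSpace 𝓘(ℝ, JetCoord m n 1) j.toJ1 :=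
  mfderiv (𝓡 m) 𝓘(ℝ, JetCoord m n 1) j.repr.prolong j.toBase

variable (π) in
/-- The symmetric jet-multimomentum bundle `𝒲 = J³π ×_{J¹π} J²π†`. -/
structure ExtendedBundle where
  jet : JetSpace π 3
  mom : J2dagger jet.toJ1

/-- The projection `μ_𝒲 : 𝒲 → 𝒲ᵣ`. -/
def ExtendedBundle.toRestricted (w : ExtendedBundle π) : RestrictedBundle π :=
  ⟨w.jet, J2ddagger.mk w.mom⟩

/-- The coupling form `Ĉ(j³_xφ, θ) = (j¹φ)^* θ`, an `m`-form on `T_xM`. -/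
def ExtendedBundle.coupling (w : ExtendedBundle π) :
    TangentSpace (𝓡 m) w.jet.toBase [⋀^Fin m]→L[ℝ] ℝ :=
  (w.mom : JForm w.jet.toJ1).compContinuousLinearMap w.jet.holonomicLift

variable (L : JetSpace π 2 → ℝ) (η : VolumeForm m M)

/-- The Hamiltonian submanifold `𝒲_o` of `𝒲`, where the coupling form equals the Lagrangian
density `L η`. -/
def hamiltonianSubmanifold : Set (ExtendedBundle π) :=
  {w | w.coupling = L w.jet.toJ2 • η.form w.jet.toBase}

/-- The Hamiltonian section `ĥ : 𝒲ᵣ → 𝒲`: `ĥ(w)` is the unique point of `𝒲_o` over `w`. -/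
def hamiltonianSection (w : RestrictedBundle π) : ExtendedBundle π :=
  ⟨w.jet, Classical.epsilon fun θ : J2dagger w.jet.toJ1 =>
    J2ddagger.mk θ = w.mom ∧
      (⟨w.jet, θ⟩ : ExtendedBundle π) ∈ hamiltonianSubmanifold L η⟩

/-- The projection `𝒲ᵣ → J¹π`. -/
def RestrictedBundle.toJ1 (w : RestrictedBundle π) : JetSpace π 1 := w.jet.toJ1

/-- The form `Θ_r = ĥ^* Θ`, where `Θ` is the pull-back to `𝒲` of the tautological form
`θ ↦ θ ∘ Λᵐ T(π_{J¹π})` of `J²π† ⊆ Λᵐ₂(J¹π)`.  Thus `Θ_r` at `w` is the pull-back to `T_w𝒲ᵣ` of the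
momentum component of `ĥ(w)`. -/
def thetaR (w : RestrictedBundle π) : TangentSpace 𝓘(ℝ, WCoord m n) w [⋀^Fin m]→L[ℝ] ℝ :=
  (hamiltonianSection L η w).mom.1.compContinuousLinearMap
    (mfderiv 𝓘(ℝ, WCoord m n) 𝓘(ℝ, JetCoord m n 1) RestrictedBundle.toJ1 w)

/-- The form `Ω_r = ĥ^* Ω = -dΘ_r`. -/
def omegaR (w : RestrictedBundle π) : TangentSpace 𝓘(ℝ, WCoord m n) w [⋀^Fin (m + 1)]→L[ℝ] ℝ :=
  -extDerivManifold (thetaR L η) w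

/-! ### The Legendre map and the field equation -/

/-- The coordinate total derivative `d/dxʲ` of a function on `J²π`. -/
def totalDeriv (j : Fin m) (f : JetCoord m n 2 → ℝ) (z : JetCoord m n 3) : ℝ :=
  fderiv ℝ f (z.trunc 2 (by norm_num)) (stdVec j, fun I => z.2 ⟨I.1.succ, j ::ₛ I.2⟩)

/-- The coordinate expression of the Lagrangian density: the function `L̂` such that the density is
`L̂ dᵐx`. -/
def FiberedChart.lagrangian (c : FiberedChart π) (y : JetCoord m n 2) : ℝ :=
  L (c.jetSymm y) * topCoeff η.form c.base y.1

/-- The coordinate expression of the restricted Legendre map `ℱℒ : J³π → J²π‡`. -/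
def FiberedChart.legendre (c : FiberedChart π) (z : JetCoord m n 3) : MomCoord m n :=
  (fun i α =>
    fderiv ℝ (c.lagrangian L η) (z.trunc 2 (by norm_num)) (dirU ⟨1, multiIdx ![i]⟩ α) -
      ∑ j, (mult i j)⁻¹ * totalDeriv j
        (fun y => fderiv ℝ (c.lagrangian L η) y (dirU ⟨2, idx2 i j⟩ α)) z,
    fun I α => fderiv ℝ (c.lagrangian L η) (z.trunc 2 (by norm_num)) (dirU ⟨2, I⟩ α))

/-- The submanifold `𝒲_ℒ` of `𝒲ᵣ`, the graph of the restricted Legendre map. -/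
def legendreGraph : Set (RestrictedBundle π) :=
  {w | ∀ c : FiberedChart π, w ∈ c.wSource →
    c.momCoords w.mom = c.legendre L η (c.jetCoords w.jet)}

/-- `ψ` is a smooth section of `ρ_M^r : 𝒲ᵣ → M` over `U`. -/
def IsSectionOn (ψ : M → RestrictedBundle π) (U : Set M) : Prop :=
  ContMDiffOn (𝓡 m) 𝓘(ℝ, WCoord m n) ∞ ψ U ∧ ∀ x ∈ U, (ψ x).jet.toBase = x

/-- `ψ` is holonomic over `U`: its component in `J³π` is `j³φ`, with `φ` the projection of `ψ`
to `E`. -/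
def IsHolonomicOn (ψ : M → RestrictedBundle π) (U : Set M) : Prop :=
  ∀ x ∈ U, ∃ h : IsSectionAt π (fun y => (ψ y).jet.toE) x, (ψ x).jet = jet 3 h

/-- The equation `ψ^* i(X) Ω_r = 0` over `U`. -/
def FieldEquation (ψ : M → RestrictedBundle π) (U : Set M)
    (X : SmoothVectorField (WCoord m n) (RestrictedBundle π)) : Prop :=
  ∀ x ∈ U, ∀ v : Fin m → TangentSpace (𝓡 m) x,
    omegaR L η (ψ x) (Fin.cons (X.field (ψ x)) fun k =>
      mfderiv (𝓡 m) 𝓘(ℝ, WCoord m n) ψ x (v k)) = 0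

end Unified

/-! ### The Hamiltonian section is well defined -/

section HamiltonianSection

set_option linter.unusedSectionVars false

variable {m n : ℕ} {M E : Type*}
  [TopologicalSpace M] [ChartedSpace (Rn m) M] [TopologicalSpace E] [ChartedSpace (Rn (m + n)) E]
  [IsManifold (𝓡 m) ∞ M] [IsManifold (𝓡 (m + n)) ∞ E]
  {π : FiberedManifold m n M E}

theorem mdifferentiableAt_toBase {k : ℕ} (j : JetSpace π k) :
    MDifferentiableAt 𝓘(ℝ, JetCoord m n k) (𝓡 m) (JetSpace.toBase : JetSpace π k → M) j := by
  obtain ⟨c, hc⟩ := FiberedChart.exists_mem π j.toE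
  have h1 : (fun i : JetSpace π k => i.toBase) =ᶠ[𝓝 j] c.base.symm ∘ Prod.fst ∘ c.jetCoords := by
    filter_upwards [(c.isOpen_jetSource k).mem_nhds hc] with i hi
    change _ = c.base.symm (c.jetCoords i).1
    rw [FiberedChart.base_jetCoords hi, c.base.left_inv (FiberedChart.toBase_mem hi)]
  have hd : MDifferentiableAt 𝓘(ℝ, JetCoord m n k) 𝓘(ℝ, JetCoord m n k) c.jetCoords j :=
    (c.jetHomeo_mdifferentiable k).mdifferentiableAt hc
  have hf : MDifferentiableAt 𝓘(ℝ, JetCoord m n k) (𝓡 m)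
      (Prod.fst : JetCoord m n k → Rn m) (c.jetCoords j) :=
    differentiableAt_fst.mdifferentiableAt
  have hbs : MDifferentiableAt (𝓡 m) (𝓡 m) c.base.symm ((Prod.fst ∘ c.jetCoords) j) := by
    refine (c.smooth_base_symm.contMDiffAt (c.base.open_target.mem_nhds ?_)).mdifferentiableAt
      (by simp)
    change (c.jetCoords j).1 ∈ _
    rw [FiberedChart.base_jetCoords hc]
    exact c.base.map_source (FiberedChart.toBase_mem hc)
  exact (hbs.comp j (hf.comp j hd)).congr_of_eventuallyEq h1

theorem LocalSection.prolong_eq (s : LocalSection π) :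
    ∀ᶠ y in 𝓝 s.pt, ∃ h : IsSectionAt π s.toFun y, s.prolong y = jet 1 h := by
  filter_upwards [eventually_eventually_nhds.2 s.isSection] with y hy
  exact ⟨hy, dif_pos hy⟩

theorem LocalSection.mdifferentiableAt_prolong (s : LocalSection π) :
    MDifferentiableAt (𝓡 m) 𝓘(ℝ, JetCoord m n 1) s.prolong s.pt := by
  obtain ⟨c, hc⟩ := FiberedChart.exists_mem π (s.toFun s.pt)
  have hx := c.base_mem s.isSection hc
  let F : M → JetCoord m n 1 := fun y =>
    (c.base y, fun I => partialDeriv I.2 (c.rep s.toFun) (c.base y))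
  have h1 : s.prolong =ᶠ[𝓝 s.pt] (c.jetHomeo 1).symm ∘ F := by
    filter_upwards [s.prolong_eq, c.eventually_section s.isSection hc] with y ⟨hy, he⟩ ⟨_, hyc⟩
    rw [he]
    change _ = c.jetSymm (F y)
    rw [show F y = c.jetCoords (jet 1 hy) from (c.jetCoords_jet hy hyc).symm]
    exact ((c.jetChart 1).left_inv (show jet 1 hy ∈ c.jetSource 1 from hyc)).symm
  have hb : ContMDiffAt (𝓡 m) (𝓡 m) ∞ c.base s.pt :=
    c.smooth_base.contMDiffAt (c.base.open_source.mem_nhds hx)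
  have hr := (c.rep_smooth s.isSection hc).self_of_nhds
  have hG : ContDiffAt ℝ ∞ (fun y : Rn m =>
      ((y, fun I => partialDeriv I.2 (c.rep s.toFun) y) : JetCoord m n 1)) (c.base s.pt) := by
    refine contDiffAt_id.prodMk (contDiffAt_pi.2 fun I => ?_)
    have := hr.iteratedFDeriv_right (m := ∞) (i := (I.1 : ℕ))
      (by exact_mod_cast le_top)
    exact this.continuousLinearMap_comp
      (ContinuousMultilinearMap.apply ℝ _ _ fun a => stdVec (enumIdx I.2 a))
  have hF : MDifferentiableAt (𝓡 m) 𝓘(ℝ, JetCoord m n 1) F s.pt :=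
    (hG.differentiableAt (by simp)).mdifferentiableAt.comp s.pt (hb.mdifferentiableAt (by simp))
  have hFt : F s.pt ∈ (c.jetHomeo 1).target := by
    rw [show F s.pt = c.jetCoords (jet 1 s.isSection) from (c.jetCoords_jet s.isSection hc).symm]
    exact (c.jetChart 1).map_source hc
  exact (((c.jetHomeo_mdifferentiable 1).mdifferentiableAt_symm hFt).comp s.pt
    hF).congr_of_eventuallyEq h1

theorem JetSpace.pt_repr {k : ℕ} (j : JetSpace π k) : j.repr.pt = j.toBase :=
  congrArg JetSpace.toBase j.jet_repr

theorem JetSpace.prolong_repr (j : JetSpace π 3) : j.repr.prolong j.toBase = j.toJ1 := by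
  rw [← j.pt_repr]
  obtain ⟨h, he⟩ := j.repr.prolong_eq.self_of_nhds
  rw [he]
  exact congrArg JetSpace.toJ1 j.jet_repr

/-- The holonomic lift is a right inverse of the differential of `J¹π → M`. -/
theorem JetSpace.toBase_holonomicLift (j : JetSpace π 3) (v : TangentSpace (𝓡 m) j.toBase) :
    mfderiv 𝓘(ℝ, JetCoord m n 1) (𝓡 m) (JetSpace.toBase : JetSpace π 1 → M) j.toJ1
      (j.holonomicLift v) = v := by
  have h1 : MDifferentiableAt (𝓡 m) 𝓘(ℝ, JetCoord m n 1) j.repr.prolong j.toBase := by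
    rw [← j.pt_repr]
    exact j.repr.mdifferentiableAt_prolong
  have h2 : (JetSpace.toBase : JetSpace π 1 → M) ∘ j.repr.prolong =ᶠ[𝓝 j.toBase] id := by
    rw [← j.pt_repr]
    filter_upwards [j.repr.prolong_eq] with y ⟨hy, he⟩
    change (j.repr.prolong y).toBase = y
    rw [he]
    rfl
  have h3 := mfderiv_comp j.toBase (mdifferentiableAt_toBase (j.repr.prolong j.toBase)) h1
  rw [h2.mfderiv_eq, mfderiv_id] at h3
  have h4 := (DFunLike.congr_fun h3 v).symm
  have h5 := j.prolong_repr
  rw [← h5]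
  exact h4

theorem Lambda1_le (j : JetSpace π 1) : Lambda1 j ≤ J2dagger j := by
  intro θ hθ
  refine ⟨fun v a _ _ ha _ => hθ v a ha, fun c hc i k α => ?_⟩
  have h : ∀ i k, c.mom2 θ i k α = 0 := by
    intro i k
    refine hθ _ k ?_
    rw [Function.update_self]
    exact FiberedChart.isVertical_frame hc _ _
  rw [h, h]

theorem Lambda1_congr {j : JetSpace π 1} {θ : JForm j} (hθ : θ ∈ Lambda1 j)
    (v v' : Fin m → TangentSpace 𝓘(ℝ, JetCoord m n 1) j)
    (h : ∀ a, IsVertical j (v a - v' a)) : θ v = θ v' := by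
  have key : ∀ s : Finset (Fin m), θ (s.piecewise v v') = θ v' := by
    intro s
    induction s using Finset.induction_on with
    | empty => simp
    | insert a s _ ih =>
      rw [← ih, Finset.piecewise_insert, ← sub_eq_zero]
      by_cases has : a ∈ s
      · rw [show Function.update (s.piecewise v v') a (v a) = s.piecewise v v' by
          rw [← Finset.piecewise_eq_of_mem s v v' has, Function.update_eq_self], sub_self]
      · have h1 : s.piecewise v v' = Function.update (s.piecewise v v') a (v' a) := by
          rw [← Finset.piecewise_eq_of_notMem s v v' has, Function.update_eq_self]
        have h2 := θ.toMultilinearMap.map_update_sub (s.piecewise v v') a (v a) (v' a)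
        have h3 : θ (Function.update (s.piecewise v v') a (v a - v' a)) = 0 := by
          refine hθ _ a ?_
          rw [Function.update_self]
          exact h a
        conv_lhs => rw [h1]
        rw [Function.update_idem]
        exact h2.symm.trans h3
  have := key Finset.univ
  rwa [Finset.piecewise_univ] at this

variable (L : JetSpace π 2 → ℝ) (η : VolumeForm m M)

/-- Over each point of `𝒲ᵣ` there is exactly one point of `𝒲_o`. -/
theorem existsUnique_hamiltonianSubmanifold (w : RestrictedBundle π) :
    ∃! θ : J2dagger w.jet.toJ1, J2ddagger.mk θ = w.mom ∧
      (⟨w.jet, θ⟩ : ExtendedBundle π) ∈ hamiltonianSubmanifold L η := by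
  obtain ⟨j, q⟩ := w
  obtain ⟨θ0, rfl⟩ : ∃ θ, q = J2ddagger.mk θ :=
    ⟨_, (Quotient.out_eq (s := J2ddaggerSetoid j.toJ1) q).symm⟩
  let κ : TangentSpace (𝓡 m) j.toBase [⋀^Fin m]→L[ℝ] ℝ :=
    L j.toJ2 • η.form j.toBase - (⟨j, θ0⟩ : ExtendedBundle π).coupling
  let σ : JForm j.toJ1 := κ.compContinuousLinearMap
    (mfderiv 𝓘(ℝ, JetCoord m n 1) (𝓡 m) (JetSpace.toBase : JetSpace π 1 → M) j.toJ1)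
  have hσ : σ ∈ Lambda1 j.toJ1 := by
    intro v a ha
    exact κ.map_coord_zero a ha
  let θ1 : J2dagger j.toJ1 := ⟨θ0.1 + σ, add_mem θ0.2 (Lambda1_le _ hσ)⟩
  have hlift : ∀ v : Fin m → TangentSpace (𝓡 m) j.toBase,
      θ1.1 (fun a => j.holonomicLift (v a)) = (L j.toJ2 • η.form j.toBase) v := by
    intro v
    have h0 : θ1.1 (fun a => j.holonomicLift (v a)) =
        θ0.1 (fun a => j.holonomicLift (v a)) + κ (fun a => mfderiv 𝓘(ℝ, JetCoord m n 1) (𝓡 m)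
          (JetSpace.toBase : JetSpace π 1 → M) j.toJ1 (j.holonomicLift (v a))) := rfl
    rw [h0]
    simp only [j.toBase_holonomicLift]
    have h1 : κ v = (L j.toJ2 • η.form j.toBase) v -
        θ0.1 (fun a => j.holonomicLift (v a)) := rfl
    have h2 : κ (fun a => v a) = κ v := rfl
    rw [h2, h1]
    exact add_sub_cancel _ _
  refine ⟨θ1, ⟨?_, ?_⟩, ?_⟩
  · refine Quotient.sound (s := J2ddaggerSetoid j.toJ1) ?_
    change θ0.1 + σ - θ0.1 ∈ Lambda1 j.toJ1
    rwa [add_sub_cancel_left]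
  · exact ContinuousAlternatingMap.ext hlift
  · rintro θ ⟨h1, h2⟩
    have h3 : θ.1 - θ0.1 ∈ Lambda1 j.toJ1 := Quotient.exact (s := J2ddaggerSetoid j.toJ1) h1
    have h4 : θ.1 - θ1.1 ∈ Lambda1 j.toJ1 := by
      have := sub_mem h3 hσ
      rwa [sub_sub] at this
    refine Subtype.ext (sub_eq_zero.1 (ContinuousAlternatingMap.ext fun v => ?_))
    let T := mfderiv 𝓘(ℝ, JetCoord m n 1) (𝓡 m) (JetSpace.toBase : JetSpace π 1 → M) j.toJ1
    rw [Lambda1_congr h4 v (fun a => j.holonomicLift (T (v a)))]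
    · have h5 : θ.1 (fun a => j.holonomicLift (T (v a))) =
          (L j.toJ2 • η.form j.toBase) fun a => T (v a) :=
        DFunLike.congr_fun (show _ = L j.toJ2 • η.form j.toBase from h2) fun a => T (v a)
      change θ.1 (fun a => j.holonomicLift (T (v a))) -
        θ1.1 (fun a => j.holonomicLift (T (v a))) = 0
      rw [h5]
      exact sub_eq_zero.2 (hlift fun a => T (v a)).symm
    · intro a
      change T (v a - j.holonomicLift (T (v a))) = 0
      rw [map_sub]
      exact sub_eq_zero.2 (j.toBase_holonomicLift (T (v a))).symm

theorem hamiltonianSection_spec (w : RestrictedBundle π) :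
    (hamiltonianSection L η w).toRestricted = w ∧
      hamiltonianSection L η w ∈ hamiltonianSubmanifold L η := by
  obtain ⟨h1, h2⟩ := Classical.epsilon_spec (existsUnique_hamiltonianSubmanifold L η w).exists
  refine ⟨?_, h2⟩
  obtain ⟨j, q⟩ := w
  exact congrArg (RestrictedBundle.mk j) h1

end HamiltonianSection

end FieldTheory

end

open FieldTheory

noncomputable section

namespace FieldTheory

/-! ### The Poincaré–Cartan form in coordinates -/

section CoordinateForms

variable {m n k : ℕ}

theorem modelForm_add (p q : MomCoord m n) : modelForm (p + q) = modelForm p + modelForm q := by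
  simp only [modelForm, Prod.fst_add, Prod.snd_add, Pi.add_apply, add_smul, mul_add,
    Finset.sum_add_distrib]
  abel

theorem modelForm_smul (t : ℝ) (p : MomCoord m n) : modelForm (t • p) = t • modelForm p := by
  simp only [modelForm, Prod.smul_fst, Prod.smul_snd, Pi.smul_apply, smul_add, Finset.smul_sum,
    smul_smul, smul_eq_mul]
  simp only [mul_left_comm]

/-- `modelForm` as a linear map of the momenta. -/
def modelFormL : MomCoord m n →L[ℝ] JetCoord m n 1 [⋀^Fin m]→L[ℝ] ℝ :=
  LinearMap.toContinuousLinearMap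
    { toFun := modelForm
      map_add' := modelForm_add
      map_smul' := modelForm_smul }

theorem modelFormL_apply (p : MomCoord m n) : modelFormL p = modelForm p := rfl

/-- The form `dᵐx` on the coordinate space of `J¹π`. -/
def coordVolume : JetCoord m n 1 [⋀^Fin m]→L[ℝ] ℝ :=
  { (Matrix.detRowAlternating (R := ℝ) (n := Fin m)).compLinearMap
      (LinearMap.pi (φ := fun _ : Fin m => ℝ) fun a => ((EuclideanSpace.proj a : Rn m →L[ℝ] ℝ).comp
          (ContinuousLinearMap.fst ℝ (Rn m) (JetIdx m 1 → Rn n)) : JetCoord m n 1 →ₗ[ℝ] ℝ)) with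
    cont := by
      refine Continuous.matrix_det (continuous_matrix fun b a => ?_)
      change Continuous fun v : Fin m → JetCoord m n 1 => (v b).1 a
      fun_prop }

theorem coordVolume_apply (v : Fin m → JetCoord m n 1) :
    coordVolume v = Matrix.det fun b a => (v b).1 a := rfl

theorem coordVolume_eq_zero (v : Fin m → JetCoord m n 1) (a : Fin m) (ha : (v a).1 = 0) :
    coordVolume v = 0 :=
  Matrix.det_eq_zero_of_row_eq_zero a fun c => by simp [ha]

theorem coordVolume_eq_one (v : Fin m → JetCoord m n 1) (h : ∀ i, (v i).1 = stdVec i) :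
    coordVolume v = 1 := by
  rw [coordVolume_apply, ← Matrix.det_one (n := Fin m)]
  congr 1
  ext b a
  simp [h, Matrix.one_apply, eq_comm]

/-- Forgetting the coordinates of higher order, as a linear map. -/
def truncL (l : ℕ) (h : l ≤ k) : JetCoord m n k →L[ℝ] JetCoord m n l :=
  (ContinuousLinearMap.fst ℝ (Rn m) (JetIdx m k → Rn n)).prod (ContinuousLinearMap.pi fun I =>
    (ContinuousLinearMap.proj (φ := fun _ : JetIdx m k => Rn n) ⟨I.1.castLE (by omega), I.2⟩).comp
      (ContinuousLinearMap.snd ℝ (Rn m) (JetIdx m k → Rn n)))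

/-- The vector `∂/∂xⁱ + u_{I+1_i}^α ∂/∂u_I^α`. -/
def JetCoord.total (i : Fin m) (z : JetCoord m n (k + 1)) : JetCoord m n k :=
  (stdVec i, fun I => z.2 ⟨I.1.succ, i ::ₛ I.2⟩)

/-- The linear part of `JetCoord.total`. -/
def totalL (i : Fin m) : JetCoord m n (k + 1) →L[ℝ] JetCoord m n k :=
  (0 : JetCoord m n (k + 1) →L[ℝ] Rn m).prod (ContinuousLinearMap.pi fun I =>
    (ContinuousLinearMap.proj (φ := fun _ : JetIdx m (k + 1) => Rn n) ⟨I.1.succ, i ::ₛ I.2⟩).comp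
      (ContinuousLinearMap.snd ℝ (Rn m) (JetIdx m (k + 1) → Rn n)))

theorem total_eq (i : Fin m) (z : JetCoord m n (k + 1)) : z.total i = dirX i + totalL i z := by
  refine Prod.ext ?_ ?_
  · exact (add_zero _).symm
  · exact (zero_add _).symm

theorem modelForm_update_of_std (p : MomCoord m n) (v : Fin m → JetCoord m n 1)
    (hv : ∀ i, (v i).1 = stdVec i) (k : Fin m) (ξ : JetCoord m n 1) (hξ : ξ.1 = 0) :
    modelForm p (Function.update v k ξ) = ∑ α, p.1 k α * ξ.2 idx0 α +
      ∑ i, ∑ α, (mult i k)⁻¹ * p.2 (idx2 i k) α * ξ.2 (idx1 i) α := by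
  classical
  have hadj : (Matrix.of fun b a => (v b).1 a : Matrix (Fin m) (Fin m) ℝ) = 1 := by
    ext b a
    simp [hv, Matrix.one_apply, eq_comm]
  have h : ∀ (l : JetCoord m n 1 →L[ℝ] ℝ) (s : Fin m),
      elemForm l s (Function.update v k ξ) = if s = k then l ξ else 0 := by
    intro l s
    rw [elemForm_update _ _ _ _ _ hξ, hadj, Matrix.adjugate_one, Matrix.one_apply]
    simp
  simp [modelForm, h, ContinuousAlternatingMap.sum_apply, coordU]

/-- The projection `𝒲ᵣ → J¹π` in coordinates. -/
def wToJ1 : WCoord m n →L[ℝ] JetCoord m n 1 :=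
  (truncL 1 (by norm_num)).comp (ContinuousLinearMap.fst ℝ (JetCoord m n 3) (MomCoord m n))

/-- The function `L̂ - p_α^i u_i^α - p_α^I u_I^α`. -/
def negHamiltonian (ℓ : JetCoord m n 2 → ℝ) (z : WCoord m n) : ℝ :=
  ℓ (z.1.trunc 2 (by norm_num)) -
    modelForm z.2 fun i => (z.1.trunc 2 (by norm_num)).total i

/-- The coordinate expression of `Θ_r`. -/
def modelTheta (ℓ : JetCoord m n 2 → ℝ) (z : WCoord m n) : WCoord m n [⋀^Fin m]→L[ℝ] ℝ :=
  (modelForm z.2 + negHamiltonian ℓ z • coordVolume).compContinuousLinearMap wToJ1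

theorem modelTheta_apply (ℓ : JetCoord m n 2 → ℝ) (z : WCoord m n) (v : Fin m → WCoord m n) :
    modelTheta ℓ z v = modelForm z.2 (fun a => wToJ1 (v a)) +
      negHamiltonian ℓ z * coordVolume (fun a => wToJ1 (v a)) := rfl

theorem hasFDerivAt_modelForm (z : WCoord m n) (v : Fin m → JetCoord m n 1) :
    ∃ D : WCoord m n →L[ℝ] ℝ, HasFDerivAt (fun z : WCoord m n => modelForm z.2 v) D z ∧
      ∀ ξ, D ξ = modelForm ξ.2 v := by
  let D : WCoord m n →L[ℝ] ℝ := LinearMap.toContinuousLinearMap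
    { toFun := fun z => modelForm z.2 v
      map_add' := fun z z' => by
        rw [Prod.snd_add, modelForm_add]
        rfl
      map_smul' := fun t z => by
        rw [Prod.smul_snd, modelForm_smul]
        rfl }
  exact ⟨D, D.hasFDerivAt, fun _ => rfl⟩

theorem hasFDerivAt_negHamiltonian {ℓ : JetCoord m n 2 → ℝ} {z : WCoord m n}
    (hℓ : DifferentiableAt ℝ ℓ (z.1.trunc 2 (by norm_num))) :
    ∃ D : WCoord m n →L[ℝ] ℝ, HasFDerivAt (negHamiltonian ℓ) D z ∧
      ∀ ξ, D ξ = fderiv ℝ ℓ (z.1.trunc 2 (by norm_num)) (ξ.1.trunc 2 (by norm_num)) -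
        (modelForm ξ.2 (fun i => (z.1.trunc 2 (by norm_num)).total i) +
          ∑ i, modelForm z.2 (Function.update (fun i => (z.1.trunc 2 (by norm_num)).total i) i
            (totalL i (ξ.1.trunc 2 (by norm_num))))) := by
  let T : WCoord m n →L[ℝ] JetCoord m n 2 :=
    (truncL 2 (by norm_num)).comp (ContinuousLinearMap.fst ℝ (JetCoord m n 3) (MomCoord m n))
  have h1 : HasFDerivAt (fun z => ℓ (T z)) _ z :=
    (show DifferentiableAt ℝ ℓ (T z) from hℓ).hasFDerivAt.comp z T.hasFDerivAt
  have hq : HasFDerivAt (fun z : WCoord m n => modelForm z.2)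
      (modelFormL.comp (ContinuousLinearMap.snd ℝ (JetCoord m n 3) (MomCoord m n))) z :=
    (modelFormL.comp (ContinuousLinearMap.snd ℝ (JetCoord m n 3) (MomCoord m n))).hasFDerivAt
  have hv : ∀ i, HasFDerivAt (fun z : WCoord m n => (T z).total i) ((totalL i).comp T) z := by
    intro i
    have := ((totalL i).comp T).hasFDerivAt (x := z) |>.const_add (dirX i)
    refine this.congr_of_eventuallyEq (Filter.Eventually.of_forall fun y => ?_)
    exact total_eq i (T y)
  refine ⟨_, h1.sub (hq.continuousAlternatingMap_apply hv), fun ξ => ?_⟩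
  simp only [sub_apply, add_apply, sum_apply, ContinuousLinearMap.comp_apply]
  rfl

theorem differentiableAt_modelTheta {ℓ : JetCoord m n 2 → ℝ} {z : WCoord m n}
    (hℓ : DifferentiableAt ℝ ℓ (z.1.trunc 2 (by norm_num))) :
    DifferentiableAt ℝ (modelTheta ℓ) z := by
  obtain ⟨D, hD, -⟩ := hasFDerivAt_negHamiltonian hℓ
  have h1 : DifferentiableAt ℝ (fun z : WCoord m n => modelForm z.2) z :=
    (modelFormL.comp (ContinuousLinearMap.snd ℝ (JetCoord m n 3)
      (MomCoord m n))).differentiableAt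
  have h2 : DifferentiableAt ℝ (fun z : WCoord m n => modelForm z.2 +
      negHamiltonian ℓ z • (coordVolume : JetCoord m n 1 [⋀^Fin m]→L[ℝ] ℝ)) z :=
    h1.add (hD.differentiableAt.smul_const _)
  exact (ContinuousAlternatingMap.compContinuousLinearMapCLM
    (wToJ1 : WCoord m n →L[ℝ] JetCoord m n 1)).differentiableAt.comp z h2

theorem fderiv_modelTheta {ℓ : JetCoord m n 2 → ℝ} {z : WCoord m n}
    (hℓ : DifferentiableAt ℝ ℓ (z.1.trunc 2 (by norm_num))) (v : Fin m → WCoord m n)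
    (ξ : WCoord m n) :
    fderiv ℝ (fun z => modelTheta ℓ z v) z ξ = modelForm ξ.2 (fun a => wToJ1 (v a)) +
      fderiv ℝ (negHamiltonian ℓ) z ξ * coordVolume (fun a => wToJ1 (v a)) := by
  obtain ⟨D, hD, -⟩ := hasFDerivAt_negHamiltonian hℓ
  obtain ⟨D', hD', h⟩ := hasFDerivAt_modelForm z fun a => wToJ1 (v a)
  have h2 := hD'.fun_add (hD.mul_const (coordVolume fun a => wToJ1 (v a)))
  simp only [modelTheta_apply]
  rw [h2.fderiv, hD.fderiv, add_apply, smul_apply, h, smul_eq_mul, mul_comm]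

theorem removeNth_succ_cons {α : Type*} (ξ : α) (T : Fin m → α) (k : Fin m) :
    ∃ σ : Equiv.Perm (Fin m), Equiv.Perm.sign σ = (-1) ^ (k : ℕ) ∧
      (k.succ.removeNth (Fin.cons ξ T : Fin (m + 1) → α)) = Function.update T k ξ ∘ σ := by
  obtain _ | m := m
  · exact k.elim0
  · refine ⟨k.cycleRange.symm, by simp, ?_⟩
    rw [← Fin.cons_removeNth_eq_comp_cycleRange_symm, Fin.removeNth_update, Function.update_self]
    exact Fin.cons_comp_succ_succAbove ξ T k

theorem fderiv_apply_removeNth (Ω : WCoord m n → WCoord m n [⋀^Fin m]→L[ℝ] ℝ) (z ξ : WCoord m n)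
    (T : Fin m → WCoord m n) (k : Fin m) (η : WCoord m n) :
    (-1) ^ (k.succ : ℕ) • fderiv ℝ (fun z => Ω z (k.succ.removeNth
      (Fin.cons ξ T : Fin (m + 1) → WCoord m n))) z η =
        -fderiv ℝ (fun z => Ω z (Function.update T k ξ)) z η := by
  obtain ⟨σ, hσ, h⟩ := removeNth_succ_cons ξ T k
  have h1 : ∀ z, Ω z (k.succ.removeNth (Fin.cons ξ T : Fin (m + 1) → WCoord m n)) =
      (-1 : ℝ) ^ (k : ℕ) * Ω z (Function.update T k ξ) := by
    intro z
    rw [h]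
    have := (Ω z).toAlternatingMap.map_perm (Function.update T k ξ) σ
    rw [hσ] at this
    refine Eq.trans this ?_
    rcases Nat.even_or_odd (k : ℕ) with hk | hk <;> simp [hk.neg_one_pow]
  simp only [h1]
  rcases Nat.even_or_odd (k : ℕ) with hk | hk <;> simp [hk.neg_one_pow, pow_succ]

/-- The exterior derivative, expanded along its first argument. -/
theorem extDeriv_cons {Ω : WCoord m n → WCoord m n [⋀^Fin m]→L[ℝ] ℝ} {z : WCoord m n}
    (hω : DifferentiableAt ℝ Ω z) (ξ : WCoord m n) (T : Fin m → WCoord m n) :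
    extDeriv Ω z (Fin.cons ξ T) = fderiv ℝ (fun z => Ω z T) z ξ -
      ∑ k, fderiv ℝ (fun z => Ω z (Function.update T k ξ)) z (T k) := by
  rw [extDeriv_apply hω, Fin.sum_univ_succ]
  simp only [Fin.cons_succ, fderiv_apply_removeNth, Finset.sum_neg_distrib]
  simp [sub_eq_add_neg]

theorem wToJ1_update (T : Fin m → WCoord m n) (k : Fin m) (ξ : WCoord m n) :
    (fun a => wToJ1 (Function.update T k ξ a)) =
      Function.update (fun a => wToJ1 (T a)) k (wToJ1 ξ) := by
  funext a
  by_cases ha : a = k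
  · subst ha
    simp
  · simp [ha]

/-- The contraction of `dΘ_r` with a vector vertical over `J³π` vanishes on holonomic tangent
planes. -/
theorem extDeriv_modelTheta_of_fst_eq_zero {ℓ : JetCoord m n 2 → ℝ} {z : WCoord m n}
    (hℓ : DifferentiableAt ℝ ℓ (z.1.trunc 2 (by norm_num))) {T : Fin m → WCoord m n}
    (hT : ∀ i, wToJ1 (T i) = (z.1.trunc 2 (by norm_num)).total i) {ξ : WCoord m n}
    (hξ : ξ.1 = 0) : extDeriv (modelTheta ℓ) z (Fin.cons ξ T) = 0 := by
  obtain ⟨D, hD, h⟩ := hasFDerivAt_negHamiltonian hℓ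
  have h0 : wToJ1 ξ = 0 := by
    change truncL 1 (by norm_num) ξ.1 = 0
    rw [hξ, map_zero]
  have h1 : ∀ k, (fun a => wToJ1 (Function.update T k ξ a)) k = 0 := by simp [h0]
  rw [extDeriv_cons (differentiableAt_modelTheta hℓ), fderiv_modelTheta hℓ, hD.fderiv, h,
    Finset.sum_eq_zero (s := Finset.univ) (f := fun k => fderiv ℝ (fun z => modelTheta ℓ z
      (Function.update T k ξ)) z (T k))]
  · have hξ2 : (ξ.1.trunc 2 (by norm_num) : JetCoord m n 2) = 0 := by
      rw [hξ]
      rfl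
    have hs : ∀ i, modelForm z.2 (Function.update (fun i =>
        (z.1.trunc 2 (by norm_num)).total i) i (0 : JetCoord m n 1)) = 0 :=
      fun i => (modelForm z.2).map_update_zero _ i
    rw [coordVolume_eq_one]
    · simp [hξ2, hs, hT]
    · intro i
      rw [hT]
      rfl
  · intro k _
    rw [fderiv_modelTheta hℓ, (modelForm (T k).2).map_coord_zero k (h1 k),
      (coordVolume (m := m) (n := n)).map_coord_zero k (h1 k)]
    simp

/-- The contraction of `dΘ_r` with a vector tangent to the fibres of `J³π → M`, on a holonomic
tangent plane. -/
theorem extDeriv_modelTheta_of_vertical {ℓ : JetCoord m n 2 → ℝ} {z : WCoord m n}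
    (hℓ : DifferentiableAt ℝ ℓ (z.1.trunc 2 (by norm_num))) {T : Fin m → WCoord m n}
    (hT : ∀ i, wToJ1 (T i) = (z.1.trunc 2 (by norm_num)).total i) {ζ : JetCoord m n 3}
    (hζ : ζ.1 = 0) : extDeriv (modelTheta ℓ) z (Fin.cons (ζ, 0) T) =
      fderiv ℝ ℓ (z.1.trunc 2 (by norm_num)) (ζ.trunc 2 (by norm_num)) -
        ∑ k, (∑ α, z.2.1 k α * ζ.2 (idx1 k) α +
          ∑ i, ∑ α, (mult i k)⁻¹ * z.2.2 (idx2 i k) α * ζ.2 ⟨2, idx2 i k⟩ α) -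
        ∑ k, (∑ α, (T k).2.1 k α * ζ.2 idx0 α +
          ∑ i, ∑ α, (mult i k)⁻¹ * (T k).2.2 (idx2 i k) α * ζ.2 (idx1 i) α) := by
  obtain ⟨D, hD, h⟩ := hasFDerivAt_negHamiltonian hℓ
  have hstd : ∀ i, ((z.1.trunc 2 (by norm_num)).total i : JetCoord m n 1).1 = stdVec i :=
    fun i => rfl
  have hv : ∀ k, (fun a => wToJ1 (Function.update T k (ζ, 0) a)) = Function.update
      (fun i => (z.1.trunc 2 (by norm_num)).total i) k (ζ.trunc 1 (by norm_num)) := by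
    intro k
    rw [wToJ1_update]
    simp only [hT]
    rfl
  have hvol : ∀ k, coordVolume (Function.update (fun i =>
      (z.1.trunc 2 (by norm_num)).total i) k (ζ.trunc 1 (by norm_num) : JetCoord m n 1)) = 0 := by
    intro k
    refine coordVolume_eq_zero _ k ?_
    rw [Function.update_self]
    exact hζ
  rw [extDeriv_cons (differentiableAt_modelTheta hℓ)]
  simp only [fderiv_modelTheta hℓ, hv, hvol, mul_zero, add_zero]
  rw [coordVolume_eq_one _ (fun i => by rw [hT]; rfl), hD.fderiv, h]
  have e0 : ∀ v : Fin m → JetCoord m n 1, modelForm (0 : MomCoord m n) v = 0 := by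
    intro v
    rw [← modelFormL_apply, map_zero]
    rfl
  have e1 : ∀ i k, (totalL k (ζ.trunc 2 (by norm_num)) : JetCoord m n 1).2 (idx1 i) =
      ζ.2 ⟨2, idx2 i k⟩ := by
    intro i k
    have : (k ::ₛ (multiIdx ![i] : Sym (Fin m) 1) : Sym (Fin m) 2) = idx2 i k := by
      rw [idx2_comm]
      rfl
    rw [← this]
    rfl
  have e2 : ∀ k, (totalL k (ζ.trunc 2 (by norm_num)) : JetCoord m n 1).2 idx0 =
      ζ.2 (idx1 k) := fun k => rfl
  have f1 : ∀ k, modelForm z.2 (Function.update (fun i => (z.1.trunc 2 (by norm_num)).total i) k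
      (totalL k (ζ.trunc 2 (by norm_num)))) = _ := fun k =>
    modelForm_update_of_std z.2 _ hstd k _ (rfl :
      (totalL k (ζ.trunc 2 (by norm_num)) : JetCoord m n 1).1 = 0)
  have f2 : ∀ k, modelForm (T k).2 (Function.update (fun i =>
      (z.1.trunc 2 (by norm_num)).total i) k (ζ.trunc 1 (by norm_num))) = _ := fun k =>
    modelForm_update_of_std (T k).2 _ hstd k _ hζ
  simp only [f1, f2, e0, e1, e2]
  rw [zero_add, mul_one, zero_add]
  rfl

end CoordinateForms

/-! ### Derivatives of partial derivatives -/

section PartialDerivatives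

variable {m n k : ℕ}

theorem multiIdx_cons {l : ℕ} (i : Fin m) (f : Fin l → Fin m) :
    multiIdx (Fin.cons i f : Fin (l + 1) → Fin m) = i ::ₛ multiIdx f := by
  have h : List.ofFn (Fin.cons i f : Fin (l + 1) → Fin m) = i :: List.ofFn f := by
    rw [List.ofFn_succ]
    rfl
  exact Subtype.ext (congrArg (fun t : List (Fin m) => (t : Multiset (Fin m))) h)

theorem differentiableAt_partialDeriv {l : ℕ} {s : Rn m → Rn n} {x : Rn m}
    (hs : ContDiffAt ℝ ∞ s x) (I : Sym (Fin m) l) : DifferentiableAt ℝ (partialDeriv I s) x := by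
  have h : DifferentiableAt ℝ (iteratedFDeriv ℝ l s) x :=
    hs.differentiableAt_iteratedFDeriv (by exact_mod_cast ENat.natCast_lt_top l)
  exact h.continuousMultilinear_apply_const _

theorem fderiv_partialDeriv {l : ℕ} {s : Rn m → Rn n} {x : Rn m}
    (hs : ∀ᶠ y in 𝓝 x, ContDiffAt ℝ ∞ s y) (I : Sym (Fin m) l) (i : Fin m) :
    fderiv ℝ (partialDeriv I s) x (stdVec i) = partialDeriv (i ::ₛ I) s x := by
  have h : DifferentiableAt ℝ (iteratedFDeriv ℝ l s) x :=
    hs.self_of_nhds.differentiableAt_iteratedFDeriv (by exact_mod_cast ENat.natCast_lt_top l)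
  have h1 : fderiv ℝ (partialDeriv I s) x (stdVec i) = iteratedFDeriv ℝ (l + 1) s x
      fun a => stdVec ((Fin.cons i (enumIdx I) : Fin (l + 1) → Fin m) a) := by
    rw [iteratedFDeriv_succ_apply_left]
    change fderiv ℝ (fun y => iteratedFDeriv ℝ l s y fun a => stdVec (enumIdx I a)) x _ = _
    rw [fderiv_continuousMultilinear_apply_const_apply h]
    rfl
  rw [h1, partialDeriv]
  refine iteratedFDeriv_perm hs _ _ ?_
  have h2 : multiIdx (Fin.cons i (enumIdx I) : Fin (l + 1) → Fin m) =
      multiIdx (enumIdx (i ::ₛ I)) := by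
    rw [multiIdx_cons, multiIdx_enumIdx, multiIdx_enumIdx]
  have := ((multiIdx_eq_iff _ _).1 h2).map stdVec
  simpa only [List.map_ofFn, Function.comp_def] using this

/-- The coordinate expression of the `k`-jet prolongation of a section. -/
def jetRep (k : ℕ) (s : Rn m → Rn n) (x : Rn m) : JetCoord m n k :=
  (x, fun I => partialDeriv I.2 s x)

theorem contDiffAt_jetRep {s : Rn m → Rn n} {x : Rn m} (hs : ContDiffAt ℝ ∞ s x) :
    ContDiffAt ℝ ∞ (jetRep k s) x := by
  refine contDiffAt_id.prodMk (contDiffAt_pi.2 fun I => ?_)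
  have := hs.iteratedFDeriv_right (m := ∞) (i := (I.1 : ℕ)) (by exact_mod_cast le_top)
  exact this.continuousLinearMap_comp
    (ContinuousMultilinearMap.apply ℝ _ _ fun a => stdVec (enumIdx I.2 a))

theorem fderiv_jetRep {s : Rn m → Rn n} {x : Rn m} (hs : ∀ᶠ y in 𝓝 x, ContDiffAt ℝ ∞ s y)
    (i : Fin m) : fderiv ℝ (jetRep k s) x (stdVec i) = (jetRep (k + 1) s x).total i := by
  have h1 : HasFDerivAt (jetRep k s) _ x := (hasFDerivAt_id x).prodMk
    (hasFDerivAt_pi.2 fun I : JetIdx m k =>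
      (differentiableAt_partialDeriv hs.self_of_nhds I.2).hasFDerivAt)
  rw [h1.fderiv]
  exact Prod.ext rfl (funext fun I => fderiv_partialDeriv hs I.2 i)

theorem alternating_apply_eq_det (f : Rn m [⋀^Fin m]→L[ℝ] ℝ) (v : Fin m → Rn m) :
    f v = f (fun i => stdVec i) * Matrix.det fun b a => v b a := by
  have h := congrArg (fun g : Rn m [⋀^Fin m]→ₗ[ℝ] ℝ => g v)
    (f.toAlternatingMap.eq_smul_basis_det (EuclideanSpace.basisFun (Fin m) ℝ).toBasis)
  refine h.trans ?_
  have h1 : f.toAlternatingMap (EuclideanSpace.basisFun (Fin m) ℝ).toBasis =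
      f (fun i => stdVec i) := by
    change f _ = _
    congr 1
    funext i
    simp
  rw [AlternatingMap.smul_apply, h1, smul_eq_mul, Module.Basis.det_apply, ← Matrix.det_transpose]
  rfl

end PartialDerivatives

/-! ### Smoothness of the natural charts and of the Lagrangian -/

section Smoothness

set_option linter.unusedSectionVars false

variable {m n : ℕ} {M E : Type*}
  [TopologicalSpace M] [ChartedSpace (Rn m) M] [TopologicalSpace E] [ChartedSpace (Rn (m + n)) E]
  [IsManifold (𝓡 m) ∞ M] [IsManifold (𝓡 (m + n)) ∞ E]
  {π : FiberedManifold m n M E}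

namespace FiberedChart

variable (c d : FiberedChart π) {k : ℕ}

theorem contMDiffOn_jetSymm : ContMDiffOn 𝓘(ℝ, JetCoord m n k) 𝓘(ℝ, JetCoord m n k) ∞
    (c.jetSymm : _ → JetSpace π k) (c.jetTarget k) :=
  contMDiffOn_symm_of_mem_maximalAtlas
    (IsManifold.subset_maximalAtlas (c.jetHomeo_mem_atlas k) : c.jetHomeo k ∈ _)

theorem isOpen_jetTarget (k : ℕ) : IsOpen (c.jetTarget k : Set (JetCoord m n k)) :=
  c.chart.open_target.preimage (by fun_prop)

theorem jetSymm_jetCoords {j : JetSpace π k} (hj : j ∈ c.jetSource k) :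
    c.jetSymm (c.jetCoords j) = j :=
  (c.jetChart k).left_inv hj

theorem jetCoords_mem {j : JetSpace π k} (hj : j ∈ c.jetSource k) :
    c.jetCoords j ∈ c.jetTarget k :=
  (c.jetChart k).map_source hj

/-- The natural chart of `𝒲ᵣ` as an open partial homeomorphism. -/
def wHomeo : OpenPartialHomeomorph (RestrictedBundle π) (WCoord m n) :=
  (wCore π).openPartialHomeomorph c.wChart (Set.mem_range_self c)

theorem wHomeo_mem_atlas : c.wHomeo ∈ atlas (WCoord m n) (RestrictedBundle π) :=
  Set.mem_iUnion₂.2 ⟨c.wChart, Set.mem_range_self c, rfl⟩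

theorem isOpen_wSource : IsOpen (c.wSource : Set (RestrictedBundle π)) := c.wHomeo.open_source

theorem isOpen_wTarget : IsOpen {z : WCoord m n | z.1 ∈ c.jetTarget 3} := c.wHomeo.open_target

theorem contMDiffOn_wCoords : ContMDiffOn 𝓘(ℝ, WCoord m n) 𝓘(ℝ, WCoord m n) ∞
    (c.wCoords : RestrictedBundle π → _) c.wSource :=
  contMDiffOn_of_mem_maximalAtlas
    (IsManifold.subset_maximalAtlas c.wHomeo_mem_atlas : c.wHomeo ∈ _)

theorem contMDiffOn_wSymm : ContMDiffOn 𝓘(ℝ, WCoord m n) 𝓘(ℝ, WCoord m n) ∞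
    (c.wSymm : _ → RestrictedBundle π) {z | z.1 ∈ c.jetTarget 3} :=
  contMDiffOn_symm_of_mem_maximalAtlas
    (IsManifold.subset_maximalAtlas c.wHomeo_mem_atlas : c.wHomeo ∈ _)

theorem wSymm_wCoords {w : RestrictedBundle π} (hw : w ∈ c.wSource) :
    c.wSymm (c.wCoords w) = w :=
  c.wChart.left_inv hw

theorem wCoords_wSymm_self {z : WCoord m n} (hz : z.1 ∈ c.jetTarget 3) :
    c.wCoords (c.wSymm z) = z :=
  c.wChart.right_inv hz

theorem wSymm_mem {z : WCoord m n} (hz : z.1 ∈ c.jetTarget 3) : c.wSymm z ∈ c.wSource :=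
  c.wChart.map_target hz

theorem wCoords_mem {w : RestrictedBundle π} (hw : w ∈ c.wSource) :
    (c.wCoords w).1 ∈ c.jetTarget 3 :=
  c.wChart.map_source hw

theorem trunc_mem_jetTarget {l : ℕ} (h : l ≤ k) {z : JetCoord m n k} (hz : z ∈ c.jetTarget k) :
    z.trunc l h ∈ c.jetTarget l := hz

end FiberedChart

theorem contDiffOn_topCoeff (η : VolumeForm m M) {b : OpenPartialHomeomorph M (Rn m)}
    (hb : ContMDiffOn (𝓡 m) (𝓡 m) ∞ b.symm b.target) :
    ContDiffOn ℝ ∞ (topCoeff η.form b) b.target := by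
  intro y0 hy0
  let e := chartAt (Rn m) (b.symm y0)
  let T : Rn m → Rn m := e ∘ b.symm
  have hO : ∀ᶠ y in 𝓝 y0, y ∈ b.target ∧ b.symm y ∈ e.source :=
    Filter.Eventually.and (b.open_target.mem_nhds hy0)
      ((b.continuousAt_symm hy0).eventually (e.open_source.mem_nhds (mem_chart_source _ _)))
  have hT : ∀ y, y ∈ b.target ∧ b.symm y ∈ e.source → ContDiffAt ℝ ∞ T y := by
    rintro y ⟨h1, h2⟩
    rw [← contMDiffAt_iff_contDiffAt]
    exact ((contMDiffOn_chart (I := 𝓡 m) (n := ∞) (x := b.symm y0)).contMDiffAt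
      (e.open_source.mem_nhds h2)).comp y (hb.contMDiffAt (b.open_target.mem_nhds h1))
  have key : topCoeff η.form b =ᶠ[𝓝 y0] fun y => topCoeff η.form e (T y) *
      Matrix.det fun i a => fderiv ℝ T y (stdVec i) a := by
    filter_upwards [eventually_eventually_nhds.2 hO] with y hy
    have h1 : b.symm =ᶠ[𝓝 y] e.symm ∘ T := by
      filter_upwards [hy] with y' hy'
      exact (e.left_inv hy'.2).symm
    have hTy := hT y hy.self_of_nhds
    have h2 : MDifferentiableAt (𝓡 m) (𝓡 m) e.symm (T y) :=
      ((contMDiffOn_chart_symm (I := 𝓡 m) (n := ∞) (x := b.symm y0)).contMDiffAt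
        (e.open_target.mem_nhds (e.map_source hy.self_of_nhds.2))).mdifferentiableAt (by simp)
    have h3 := h1.mfderiv_eq (I := 𝓡 m) (I' := 𝓡 m)
    rw [mfderiv_comp y h2 (hTy.differentiableAt (by simp)).mdifferentiableAt,
      mfderiv_eq_fderiv] at h3
    let f : Rn m [⋀^Fin m]→L[ℝ] ℝ :=
      (η.form (e.symm (T y))).compContinuousLinearMap (mfderiv (𝓡 m) (𝓡 m) e.symm (T y))
    have h4 : topCoeff η.form b y = f fun i => fderiv ℝ T y (stdVec i) := by
      have : ∀ (x : M) (hx : x = b.symm y) (u : Fin m → Rn m), η.form (b.symm y) u =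
        η.form x u := by
        rintro x rfl u
        rfl
      rw [topCoeff, h3]
      exact this _ h1.self_of_nhds.symm _
    rw [h4, alternating_apply_eq_det]
    rfl
  refine (ContDiffAt.congr_of_eventuallyEq ?_ key).contDiffWithinAt
  have hT0 := hT y0 hO.self_of_nhds
  refine ContDiffAt.mul ?_ ?_
  · exact ((η.smooth e (chart_mem_atlas _ _)).contDiffAt (e.open_target.mem_nhds
      (e.map_source hO.self_of_nhds.2))).comp y0 hT0
  · have hdet : (fun y => Matrix.det fun i a => fderiv ℝ T y (stdVec i) a) = fun y =>
        ∑ σ : Equiv.Perm (Fin m), Equiv.Perm.sign σ • ∏ i, fderiv ℝ T y (stdVec (σ i)) i :=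
      funext fun y => Matrix.det_apply _
    rw [hdet]
    refine ContDiffAt.sum fun σ _ => ContDiffAt.const_smul _ (contDiffAt_prod fun i _ => ?_)
    have h5 : ContDiffAt ℝ ∞ (fun y => fderiv ℝ T y (stdVec (σ i))) y0 :=
      (hT0.fderiv_right (m := ∞) (by simp)).clm_apply contDiffAt_const
    exact h5.continuousLinearMap_comp (EuclideanSpace.proj i : Rn m →L[ℝ] ℝ)

variable {L : JetSpace π 2 → ℝ} (η : VolumeForm m M)

theorem contDiffAt_lagrangian (hL : ContMDiff 𝓘(ℝ, JetCoord m n 2) 𝓘(ℝ, ℝ) ∞ L)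
    (c : FiberedChart π) {y : JetCoord m n 2} (hy : y ∈ c.jetTarget 2) :
    ContDiffAt ℝ ∞ (c.lagrangian L η) y := by
  refine ContDiffAt.mul ?_ ?_
  · rw [← contMDiffAt_iff_contDiffAt]
    exact hL.contMDiffAt.comp y
      (c.contMDiffOn_jetSymm.contMDiffAt ((c.isOpen_jetTarget 2).mem_nhds hy))
  · exact ((contDiffOn_topCoeff η c.smooth_base_symm).contDiffAt
      (c.base.open_target.mem_nhds (c.fst_mem_target hy))).comp y contDiffAt_fst

theorem contDiffAt_legendre (hL : ContMDiff 𝓘(ℝ, JetCoord m n 2) 𝓘(ℝ, ℝ) ∞ L)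
    (c : FiberedChart π) {z : JetCoord m n 3} (hz : z ∈ c.jetTarget 3) :
    ContDiffAt ℝ ∞ (c.legendre L η) z := by
  have hz2 : z.trunc 2 (by norm_num) ∈ c.jetTarget 2 := hz
  have hl := contDiffAt_lagrangian η hL c hz2
  have hT : ContDiffAt ℝ ∞ (fun z : JetCoord m n 3 => z.trunc 2 (by norm_num)) z :=
    (truncL (m := m) (n := n) (k := 3) 2 (by norm_num)).contDiff.contDiffAt
  have h1 : ∀ u : JetCoord m n 2, ContDiffAt ℝ ∞
      (fun y => fderiv ℝ (c.lagrangian L η) y u) (z.trunc 2 (by norm_num)) := fun u =>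
    (hl.fderiv_right (m := ∞) (by simp)).clm_apply contDiffAt_const
  have h2 : ∀ u : JetCoord m n 2, ContDiffAt ℝ ∞ (fun z : JetCoord m n 3 =>
      fderiv ℝ (c.lagrangian L η) (z.trunc 2 (by norm_num)) u) z := fun u =>
    (h1 u).comp z hT
  have h3 : ∀ (u : JetCoord m n 2) (j : Fin m), ContDiffAt ℝ ∞
      (totalDeriv j fun y => fderiv ℝ (c.lagrangian L η) y u) z := by
    intro u j
    refine ContDiffAt.clm_apply (((h1 u).fderiv_right (m := ∞) (by simp)).comp z hT) ?_
    exact contDiffAt_const.prodMk (contDiffAt_pi.2 fun I => by fun_prop)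
  refine ContDiffAt.prodMk ?_ ?_
  · exact contDiffAt_pi.2 fun i => contDiffAt_pi.2 fun α => (h2 _).sub
      (ContDiffAt.sum fun j _ => contDiffAt_const.mul (h3 _ j))
  · exact contDiffAt_pi.2 fun I => contDiffAt_pi.2 fun α => h2 _

end Smoothness

/-! ### The coordinate expression of `Θ_r` -/

section LocalTheta

set_option linter.unusedSectionVars false

variable {m n : ℕ} {M E : Type*}
  [TopologicalSpace M] [ChartedSpace (Rn m) M] [TopologicalSpace E] [ChartedSpace (Rn (m + n)) E]
  [IsManifold (𝓡 m) ∞ M] [IsManifold (𝓡 (m + n)) ∞ E]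
  {π : FiberedManifold m n M E}

theorem LocalSection.dcoord_mfderiv_prolong {c : FiberedChart π} (s : LocalSection π)
    (hs : s.toFun s.pt ∈ c.chart.source) {x : M} (hx : s.pt = x) {j : JetSpace π 1}
    (hj : s.prolong x = j) (i : Fin m) :
    c.dcoord j (mfderiv (𝓡 m) 𝓘(ℝ, JetCoord m n 1) s.prolong x
      (mfderiv (𝓡 m) (𝓡 m) c.base.symm (c.base x) (stdVec i))) =
        (jetRep 2 (c.rep s.toFun) (c.base x)).total i := by
  subst hx hj
  have hb := c.base_mem s.isSection hs
  have hbt := c.base.map_source hb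
  have hmem : s.prolong s.pt ∈ c.jetSource 1 := by
    obtain ⟨h, he⟩ := s.prolong_eq.self_of_nhds
    rw [he]
    exact hs
  have hsymm : c.base.symm (c.base s.pt) = s.pt := c.base.left_inv hb
  have h1 : c.jetCoords ∘ s.prolong ∘ c.base.symm =ᶠ[𝓝 (c.base s.pt)]
      jetRep 1 (c.rep s.toFun) := by
    filter_upwards [c.eventually_base_symm hb s.prolong_eq,
      c.eventually_base_symm hb (c.eventually_section s.isSection hs)]
      with y ⟨hy, h, he⟩ ⟨_, _, hyc⟩
    change c.jetCoords (s.prolong (c.base.symm y)) = _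
    rw [he, c.jetCoords_jet h hyc, c.base.right_inv hy]
    rfl
  have hB : MDifferentiableAt (𝓡 m) (𝓡 m) c.base.symm (c.base s.pt) :=
    (c.smooth_base_symm.contMDiffAt (c.base.open_target.mem_nhds hbt)).mdifferentiableAt (by simp)
  have hP : MDifferentiableAt (𝓡 m) 𝓘(ℝ, JetCoord m n 1) s.prolong
      (c.base.symm (c.base s.pt)) := by
    rw [hsymm]
    exact s.mdifferentiableAt_prolong
  have hJ : MDifferentiableAt 𝓘(ℝ, JetCoord m n 1) 𝓘(ℝ, JetCoord m n 1) c.jetCoords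
      (s.prolong (c.base.symm (c.base s.pt))) := by
    rw [hsymm]
    exact (c.jetHomeo_mdifferentiable 1).mdifferentiableAt hmem
  have h2 := h1.mfderiv_eq (I := 𝓡 m) (I' := 𝓘(ℝ, JetCoord m n 1))
  rw [mfderiv_comp (g := c.jetCoords) (f := s.prolong ∘ c.base.symm) _ hJ (hP.comp _ hB),
    mfderiv_comp _ hP hB, mfderiv_eq_fderiv] at h2
  rw [← fderiv_jetRep (c.rep_smooth s.isSection hs)]
  have h3 := DFunLike.congr_fun h2 (stdVec i)
  refine Eq.trans ?_ h3
  have key : ∀ (x : M) (hx : x = s.pt) (u : Rn m),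
      c.dcoord (s.prolong s.pt) (mfderiv (𝓡 m) 𝓘(ℝ, JetCoord m n 1) s.prolong s.pt u) =
      mfderiv 𝓘(ℝ, JetCoord m n 1) 𝓘(ℝ, JetCoord m n 1) c.jetCoords (s.prolong x)
        (mfderiv (𝓡 m) 𝓘(ℝ, JetCoord m n 1) s.prolong x u) := by
    rintro x rfl u
    rfl
  exact key _ hsymm _

/-- The coordinate expression of the holonomic lift. -/
theorem FiberedChart.dcoord_holonomicLift {c : FiberedChart π} {j : JetSpace π 3}
    (hj : j ∈ c.jetSource 3) (i : Fin m) :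
    c.dcoord j.toJ1 (j.holonomicLift
      (mfderiv (𝓡 m) (𝓡 m) c.base.symm (c.base j.toBase) (stdVec i))) =
        ((c.jetCoords j).trunc 2 (by norm_num)).total i := by
  have hs : j.repr.toFun j.repr.pt ∈ c.chart.source := by
    have h : (jet 3 j.repr.isSection).toE ∈ c.chart.source := by
      rw [j.jet_repr]
      exact hj
    exact h
  refine (j.repr.dcoord_mfderiv_prolong hs j.pt_repr j.prolong_repr i).trans ?_
  rw [← j.pt_repr]
  rfl

theorem FiberedChart.mdifferentiableAt_wCoords {c : FiberedChart π} {w : RestrictedBundle π}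
    (hw : w ∈ c.wSource) : MDifferentiableAt 𝓘(ℝ, WCoord m n) 𝓘(ℝ, WCoord m n) c.wCoords w :=
  (c.contMDiffOn_wCoords.contMDiffAt (c.isOpen_wSource.mem_nhds hw)).mdifferentiableAt (by simp)

theorem FiberedChart.mdifferentiableAt_wSymm {c : FiberedChart π} {z : WCoord m n}
    (hz : z.1 ∈ c.jetTarget 3) :
    MDifferentiableAt 𝓘(ℝ, WCoord m n) 𝓘(ℝ, WCoord m n) (c.wSymm : _ → RestrictedBundle π) z :=
  (c.contMDiffOn_wSymm.contMDiffAt (c.isOpen_wTarget.mem_nhds hz)).mdifferentiableAt (by simp)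

theorem FiberedChart.dcoord_toJ1 {c : FiberedChart π} {w : RestrictedBundle π}
    (hw : w ∈ c.wSource) (v : TangentSpace 𝓘(ℝ, WCoord m n) w) :
    c.dcoord w.toJ1 (mfderiv 𝓘(ℝ, WCoord m n) 𝓘(ℝ, JetCoord m n 1) RestrictedBundle.toJ1 w v) =
      wToJ1 (mfderiv 𝓘(ℝ, WCoord m n) 𝓘(ℝ, WCoord m n) c.wCoords w v) := by
  have hw1 : w.toJ1 ∈ c.jetSource 1 := proj_mem_jetSource hw 1 (by norm_num)
  have h1 : c.jetCoords ∘ RestrictedBundle.toJ1 =ᶠ[𝓝 w] wToJ1 ∘ c.wCoords := by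
    filter_upwards [c.isOpen_wSource.mem_nhds hw] with w' hw'
    exact c.jetCoords_proj hw' 1 (by norm_num)
  have h2 : RestrictedBundle.toJ1 =ᶠ[𝓝 w] c.jetSymm ∘ wToJ1 ∘ c.wCoords := by
    filter_upwards [c.isOpen_wSource.mem_nhds hw, h1] with w' hw' h
    change _ = c.jetSymm ((wToJ1 ∘ c.wCoords) w')
    rw [← h]
    exact (c.jetSymm_jetCoords (proj_mem_jetSource hw' 1 (by norm_num))).symm
  have hL : MDifferentiableAt 𝓘(ℝ, WCoord m n) 𝓘(ℝ, JetCoord m n 1)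
      (wToJ1 : WCoord m n → JetCoord m n 1) (c.wCoords w) :=
    wToJ1.differentiableAt.mdifferentiableAt
  have hW := c.mdifferentiableAt_wCoords hw
  have ht : (wToJ1 ∘ c.wCoords) w ∈ (c.jetTarget 1 : Set (JetCoord m n 1)) := by
    rw [← h1.self_of_nhds]
    exact c.jetCoords_mem hw1
  have hJ : MDifferentiableAt 𝓘(ℝ, WCoord m n) 𝓘(ℝ, JetCoord m n 1)
      (RestrictedBundle.toJ1 : RestrictedBundle π → _) w := by
    refine MDifferentiableAt.congr_of_eventuallyEq ?_ h2
    refine MDifferentiableAt.comp w (g := c.jetSymm) (f := wToJ1 ∘ c.wCoords) ?_ (hL.comp w hW)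
    exact (c.contMDiffOn_jetSymm.contMDiffAt
      ((c.isOpen_jetTarget 1).mem_nhds ht)).mdifferentiableAt (by simp)
  have hc : MDifferentiableAt 𝓘(ℝ, JetCoord m n 1) 𝓘(ℝ, JetCoord m n 1) c.jetCoords w.toJ1 :=
    (c.jetHomeo_mdifferentiable 1).mdifferentiableAt hw1
  have h3 := h1.mfderiv_eq (I := 𝓘(ℝ, WCoord m n)) (I' := 𝓘(ℝ, JetCoord m n 1))
  rw [mfderiv_comp w hc hJ, mfderiv_comp w hL hW, mfderiv_eq_fderiv,
    ContinuousLinearMap.fderiv] at h3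
  exact DFunLike.congr_fun h3 v

/-- A form vanishing on vertical vectors is a multiple of `dᵐx`. -/
theorem eq_mul_coordVolume (γ : JetCoord m n 1 [⋀^Fin m]→L[ℝ] ℝ)
    (hγ : ∀ v v' : Fin m → JetCoord m n 1, (∀ a, (v a).1 = (v' a).1) → γ v = γ v')
    (z : JetCoord m n 2) (v : Fin m → JetCoord m n 1) :
    γ v = γ (fun i => z.total i) * coordVolume v := by
  let f : Rn m [⋀^Fin m]→L[ℝ] ℝ := γ.compContinuousLinearMap
    (ContinuousLinearMap.inl ℝ (Rn m) (JetIdx m 1 → Rn n))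
  have h := alternating_apply_eq_det f fun a => (v a).1
  rw [hγ v fun a => ContinuousLinearMap.inl ℝ (Rn m) (JetIdx m 1 → Rn n) (v a).1]
  · refine h.trans ?_
    rw [hγ (fun i => z.total i) fun a => ContinuousLinearMap.inl ℝ _ _ (stdVec a)]
    · rfl
    · exact fun a => rfl
  · exact fun a => rfl

open FiberedChart

variable (L : JetSpace π 2 → ℝ) (η : VolumeForm m M)

theorem FiberedChart.lagrangian_jetCoords {c : FiberedChart π} {j : JetSpace π 3}
    (hj : j ∈ c.jetSource 3) :
    c.lagrangian L η ((c.jetCoords j).trunc 2 (by norm_num)) = L j.toJ2 *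
      η.form j.toBase fun i => mfderiv (𝓡 m) (𝓡 m) c.base.symm (c.base j.toBase) (stdVec i) := by
  have h1 : c.jetSymm ((c.jetCoords j).trunc 2 (by norm_num)) = j.toJ2 := by
    rw [← FiberedChart.jetCoords_proj hj, c.jetSymm_jetCoords (proj_mem_jetSource hj 2 (by norm_num))]
  have h2 : ((c.jetCoords j).trunc 2 (by norm_num) : JetCoord m n 2).1 = c.base j.toBase :=
    base_jetCoords hj
  rw [FiberedChart.lagrangian, h1, h2]
  congr 1
  have : ∀ (x : M) (hx : x = j.toBase) (u : Fin m → Rn m), η.form x u =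
      η.form j.toBase u := by
    rintro x rfl u
    rfl
  exact this _ (c.base.left_inv (toBase_mem hj)) _

/-- The coordinate expression of `Θ_r`. -/
theorem thetaR_apply {c : FiberedChart π} {w : RestrictedBundle π} (hw : w ∈ c.wSource)
    (v : Fin m → TangentSpace 𝓘(ℝ, WCoord m n) w) :
    thetaR L η w v = modelTheta (c.lagrangian L η) (c.wCoords w)
      fun a => mfderiv 𝓘(ℝ, WCoord m n) 𝓘(ℝ, WCoord m n) c.wCoords w (v a) := by
  have hw1 : w.jet.toJ1 ∈ c.jetSource 1 := proj_mem_jetSource hw 1 (by norm_num)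
  obtain ⟨θ, h1, h2, h0⟩ : ∃ θ : J2dagger w.jet.toJ1, J2ddagger.mk θ = w.mom ∧
      (θ : JForm w.jet.toJ1).compContinuousLinearMap w.jet.holonomicLift =
        L w.jet.toJ2 • η.form w.jet.toBase ∧
      thetaR L η w v = θ.1 fun a =>
        (mfderiv 𝓘(ℝ, WCoord m n) 𝓘(ℝ, JetCoord m n 1) RestrictedBundle.toJ1 w (v a) :
          TangentSpace 𝓘(ℝ, JetCoord m n 1) w.jet.toJ1) := by
    obtain ⟨h1, h2⟩ := Classical.epsilon_spec (existsUnique_hamiltonianSubmanifold L η w).exists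
    exact ⟨(hamiltonianSection L η w).mom, h1, h2, rfl⟩
  have hp : c.momCoords w.mom = c.components θ.1 := by
    rw [← h1, c.momCoords_mk hw1]
  have hσ : θ.1 - c.formOf w.jet.toJ1 (c.momCoords w.mom) ∈ Lambda1 w.jet.toJ1 := by
    rw [hp]
    exact sub_formOf_mem hw1 θ.2
  let γ : JetCoord m n 1 [⋀^Fin m]→L[ℝ] ℝ :=
    (θ.1 - c.formOf w.jet.toJ1 (c.momCoords w.mom)).compContinuousLinearMap
      (c.frame w.jet.toJ1)
  have hγ : ∀ u u' : Fin m → JetCoord m n 1, (∀ a, (u a).1 = (u' a).1) → γ u = γ u' := by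
    intro u u' h
    refine Lambda1_congr hσ (fun a => c.frame w.jet.toJ1 (u a))
      (fun a => c.frame w.jet.toJ1 (u' a)) fun a => ?_
    rw [isVertical_iff hw1, map_sub, dcoord_frame hw1, dcoord_frame hw1, Prod.fst_sub, h, sub_self]
  have hθγ : ∀ u : Fin m → TangentSpace 𝓘(ℝ, JetCoord m n 1) w.jet.toJ1, θ.1 u =
      modelForm (c.momCoords w.mom) (fun a => c.dcoord w.jet.toJ1 (u a)) +
        γ fun a => c.dcoord w.jet.toJ1 (u a) := by
    intro u
    have h3 : (γ fun a => c.dcoord w.jet.toJ1 (u a)) = θ.1 u -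
        modelForm (c.momCoords w.mom) (fun a => c.dcoord w.jet.toJ1 (u a)) := by
      change (θ.1 - c.formOf w.jet.toJ1 (c.momCoords w.mom))
        (fun a => c.frame w.jet.toJ1 (c.dcoord w.jet.toJ1 (u a))) = _
      simp only [frame_dcoord hw1]
      rfl
    rw [h3]
    ring
  have htot : γ (fun i => ((c.jetCoords w.jet).trunc 2 (by norm_num)).total i) =
      negHamiltonian (c.lagrangian L η) (c.wCoords w) := by
    have h4 := DFunLike.congr_fun h2 fun i =>
      mfderiv (𝓡 m) (𝓡 m) c.base.symm (c.base w.jet.toBase) (stdVec i)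
    have h5 := hθγ fun i => w.jet.holonomicLift
      (mfderiv (𝓡 m) (𝓡 m) c.base.symm (c.base w.jet.toBase) (stdVec i))
    simp only [dcoord_holonomicLift hw] at h5
    have h6 := c.lagrangian_jetCoords L η hw
    change γ _ = c.lagrangian L η ((c.jetCoords w.jet).trunc 2 (by norm_num)) -
      modelForm (c.momCoords w.mom) _
    rw [h6]
    refine eq_sub_of_add_eq' (h5.symm.trans ?_)
    exact h4
  rw [h0]
  refine (hθγ _).trans ?_
  have h7 : ∀ a, c.dcoord w.jet.toJ1
      (mfderiv 𝓘(ℝ, WCoord m n) 𝓘(ℝ, JetCoord m n 1) RestrictedBundle.toJ1 w (v a)) =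
      wToJ1 (mfderiv 𝓘(ℝ, WCoord m n) 𝓘(ℝ, WCoord m n) c.wCoords w (v a)) :=
    fun a => dcoord_toJ1 hw (v a)
  refine (congrArg (fun u => modelForm (c.momCoords w.mom) u + γ u) (funext h7)).trans ?_
  rw [eq_mul_coordVolume γ hγ ((c.jetCoords w.jet).trunc 2 (by norm_num)), htot]
  rfl

end LocalTheta

/-! ### The coordinate expression of `Ω_r` -/

section LocalOmega

set_option linter.unusedSectionVars false

variable {m n : ℕ} {M E : Type*}
  [TopologicalSpace M] [ChartedSpace (Rn m) M] [TopologicalSpace E] [ChartedSpace (Rn (m + n)) E]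
  [IsManifold (𝓡 m) ∞ M] [IsManifold (𝓡 (m + n)) ∞ E]
  {π : FiberedManifold m n M E} {L : JetSpace π 2 → ℝ} (η : VolumeForm m M)

open FiberedChart

theorem differentiableAt_lagrangian (hL : ContMDiff 𝓘(ℝ, JetCoord m n 2) 𝓘(ℝ, ℝ) ∞ L)
    {c : FiberedChart π} {z : JetCoord m n 3} (hz : z ∈ c.jetTarget 3) :
    DifferentiableAt ℝ (c.lagrangian L η) (z.trunc 2 (by norm_num)) :=
  (contDiffAt_lagrangian η hL c (trunc_mem_jetTarget c (by norm_num) hz)).differentiableAt (by simp)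

/-- The coordinate expression of the exterior derivative of `Θ_r` does not depend on the chart. -/
theorem extDeriv_thetaR (hL : ContMDiff 𝓘(ℝ, JetCoord m n 2) 𝓘(ℝ, ℝ) ∞ L)
    {c d : FiberedChart π} {w : RestrictedBundle π} (hc : w ∈ c.wSource) (hd : w ∈ d.wSource)
    (v : Fin (m + 1) → TangentSpace 𝓘(ℝ, WCoord m n) w) :
    extDeriv (fun z => ((thetaR L η (d.wSymm z)).compContinuousLinearMap
      (mfderiv 𝓘(ℝ, WCoord m n) 𝓘(ℝ, WCoord m n) (d.wSymm : _ → RestrictedBundle π) z) :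
        WCoord m n [⋀^Fin m]→L[ℝ] ℝ)) (d.wCoords w)
      (fun a => mfderiv 𝓘(ℝ, WCoord m n) 𝓘(ℝ, WCoord m n) d.wCoords w (v a)) =
    extDeriv (modelTheta (c.lagrangian L η)) (c.wCoords w)
      (fun a => mfderiv 𝓘(ℝ, WCoord m n) 𝓘(ℝ, WCoord m n) c.wCoords w (v a)) := by
  let Φ : WCoord m n → WCoord m n := c.wCoords ∘ d.wSymm
  have hz0 : (d.wCoords w).1 ∈ d.jetTarget 3 := d.wCoords_mem hd
  have hw0 : d.wSymm (d.wCoords w) = w := d.wSymm_wCoords hd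
  have hO : ∀ᶠ z in 𝓝 (d.wCoords w), z.1 ∈ d.jetTarget 3 ∧ d.wSymm z ∈ c.wSource := by
    refine Filter.Eventually.and (d.isOpen_wTarget.mem_nhds hz0) ?_
    have h := (d.contMDiffOn_wSymm.contMDiffAt (d.isOpen_wTarget.mem_nhds hz0)).continuousAt
    refine h.eventually (c.isOpen_wSource.mem_nhds ?_)
    rwa [hw0]
  have hΦ : ContDiffAt ℝ ∞ Φ (d.wCoords w) := by
    rw [← contMDiffAt_iff_contDiffAt]
    refine ContMDiffAt.comp (d.wCoords w) ?_
      (d.contMDiffOn_wSymm.contMDiffAt (d.isOpen_wTarget.mem_nhds hz0))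
    rw [hw0]
    exact c.contMDiffOn_wCoords.contMDiffAt (c.isOpen_wSource.mem_nhds hc)
  have hΦ0 : Φ (d.wCoords w) = c.wCoords w := congrArg c.wCoords hw0
  have h1 : (fun z => ((thetaR L η (d.wSymm z)).compContinuousLinearMap
      (mfderiv 𝓘(ℝ, WCoord m n) 𝓘(ℝ, WCoord m n) (d.wSymm : _ → RestrictedBundle π) z) :
        WCoord m n [⋀^Fin m]→L[ℝ] ℝ)) =ᶠ[𝓝 (d.wCoords w)]
      fun z => (modelTheta (c.lagrangian L η) (Φ z)).compContinuousLinearMap (fderiv ℝ Φ z) := by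
    filter_upwards [hO] with z ⟨hz, hzc⟩
    have h2 := mfderiv_comp z (mdifferentiableAt_wCoords hzc) (mdifferentiableAt_wSymm hz)
    change mfderiv 𝓘(ℝ, WCoord m n) 𝓘(ℝ, WCoord m n) Φ z = _ at h2
    rw [mfderiv_eq_fderiv] at h2
    refine ContinuousAlternatingMap.ext fun u => ?_
    rw [h2]
    exact thetaR_apply L η hzc fun a =>
      mfderiv 𝓘(ℝ, WCoord m n) 𝓘(ℝ, WCoord m n) (d.wSymm : _ → RestrictedBundle π) z (u a)
  have hdiff : DifferentiableAt ℝ (modelTheta (c.lagrangian L η)) (Φ (d.wCoords w)) := by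
    rw [hΦ0]
    exact differentiableAt_modelTheta (differentiableAt_lagrangian η hL (c.wCoords_mem hc))
  rw [h1.extDeriv_eq, extDeriv_pullback hdiff hΦ
    (by simp only [minSmoothness_of_isRCLikeNormedField]
        exact WithTop.coe_le_coe.2 (le_top : (2 : ℕ∞) ≤ ⊤)), hΦ0]
  have h3 : Φ ∘ d.wCoords =ᶠ[𝓝 w] c.wCoords := by
    filter_upwards [d.isOpen_wSource.mem_nhds hd] with w' hw'
    exact congrArg c.wCoords (d.wSymm_wCoords hw')
  have h4 := h3.mfderiv_eq (I := 𝓘(ℝ, WCoord m n)) (I' := 𝓘(ℝ, WCoord m n))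
  rw [mfderiv_comp w (hΦ.differentiableAt (by simp)).mdifferentiableAt
    (mdifferentiableAt_wCoords hd), mfderiv_eq_fderiv] at h4
  exact congrArg (fun u => extDeriv (modelTheta (c.lagrangian L η)) (c.wCoords w) u)
    (funext fun a => DFunLike.congr_fun h4 (v a))

/-- The coordinate expression of `Ω_r`. -/
theorem omegaR_apply (hL : ContMDiff 𝓘(ℝ, JetCoord m n 2) 𝓘(ℝ, ℝ) ∞ L)
    {c : FiberedChart π} {w : RestrictedBundle π} (hc : w ∈ c.wSource)
    (v : Fin (m + 1) → TangentSpace 𝓘(ℝ, WCoord m n) w) :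
    omegaR L η w v = -extDeriv (modelTheta (c.lagrangian L η)) (c.wCoords w)
      (fun a => mfderiv 𝓘(ℝ, WCoord m n) 𝓘(ℝ, WCoord m n) c.wCoords w (v a)) := by
  rw [← extDeriv_thetaR η hL hc (Classical.choose_spec (exists_mem π w.jet.toE)) v]
  rfl

end LocalOmega

/-! ### Sums over multi-indices -/

section Sums

variable {m n : ℕ}

theorem sum_sym_two (g : Sym (Fin m) 2 → ℝ) :
    ∑ k, ∑ i, (mult i k)⁻¹ * g (idx2 i k) = ∑ I, g I := by
  classical
  rw [← Finset.sum_product', Finset.univ_product_univ,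
    ← Finset.sum_fiberwise Finset.univ (fun q : Fin m × Fin m => idx2 q.2 q.1)]
  refine Finset.sum_congr rfl fun I _ => ?_
  have h1 : ∀ q ∈ (Finset.univ : Finset (Fin m × Fin m)).filter (fun q => idx2 q.2 q.1 = I),
      (mult q.2 q.1)⁻¹ * g (idx2 q.2 q.1) = (mult q.2 q.1)⁻¹ * g I := by
    intro q hq
    rw [(Finset.mem_filter.1 hq).2]
  rw [Finset.sum_congr rfl h1, ← Finset.sum_mul]
  obtain ⟨a, b, rfl⟩ : ∃ a b, idx2 a b = I := ⟨_, _, idx2_enumIdx I⟩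
  have h2 : (Finset.univ : Finset (Fin m × Fin m)).filter (fun q => idx2 q.2 q.1 = idx2 a b) =
      {(a, b), (b, a)} := by
    ext ⟨i, k⟩
    simp only [Finset.mem_filter, Finset.mem_univ, true_and, Finset.mem_insert,
      Finset.mem_singleton, Prod.mk.injEq]
    constructor
    · intro h
      have h3 := enumIdx_idx2 k i
      have h4 := enumIdx_idx2 a b
      rw [h] at h3
      omega
    · rintro (⟨rfl, rfl⟩ | ⟨rfl, rfl⟩)
      · exact idx2_comm _ _
      · rfl
  rw [h2]
  by_cases hab : a = b
  · subst hab
    simp [mult]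
  · rw [Finset.sum_pair (by simp [hab])]
    simp [mult, hab, Ne.symm hab]
    norm_num [← add_mul]

theorem sum_sym_one (g : Sym (Fin m) 1 → ℝ) : ∑ I, g I = ∑ i, g (multiIdx ![i]) := by
  symm
  refine Fintype.sum_bijective (fun i => multiIdx ![i]) ⟨fun i j h => ?_, fun I => ?_⟩ _ _
    fun _ => rfl
  · have : multiIdx ![i] = multiIdx ![j] := h
    rw [multiIdx_eq_iff] at this
    simpa using this
  · refine ⟨enumIdx I 0, ?_⟩
    conv_rhs => rw [← multiIdx_enumIdx I]
    refine congrArg multiIdx (funext fun a => ?_)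
    rw [Subsingleton.elim a 0]
    rfl

theorem apply_eq_sum {k : ℕ} (D : JetCoord m n k →L[ℝ] ℝ) (u : JetCoord m n k) (hu : u.1 = 0) :
    D u = ∑ I, ∑ α, u.2 I α * D (dirU I α) := by
  classical
  have h : u = ∑ I, ∑ α, u.2 I α • dirU I α := by
    refine Prod.ext ?_ (funext fun J => ?_)
    · rw [hu, Prod.fst_sum]
      refine (Finset.sum_eq_zero fun I _ => ?_).symm
      rw [Prod.fst_sum]
      exact Finset.sum_eq_zero fun α _ => smul_zero _
    · rw [Prod.snd_sum, Finset.sum_apply, Finset.sum_eq_single J]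
      · ext β
        rw [Prod.snd_sum, Finset.sum_apply]
        simp [dirU, Finset.sum_apply, Pi.single_apply]
      · intro I _ hI
        rw [Prod.snd_sum, Finset.sum_apply]
        exact Finset.sum_eq_zero fun α _ => by simp [dirU, hI.symm]
      · simp
  conv_lhs => rw [h]
  simp

theorem apply_eq_sum_two (D : JetCoord m n 2 →L[ℝ] ℝ) (u : JetCoord m n 2) (hu : u.1 = 0)
    (h0 : u.2 idx0 = 0) :
    D u = ∑ i, ∑ α, u.2 (idx1 i) α * D (dirU ⟨1, multiIdx ![i]⟩ α) +
      ∑ I : Sym (Fin m) 2, ∑ α, u.2 ⟨2, I⟩ α * D (dirU ⟨2, I⟩ α) := by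
  rw [apply_eq_sum D u hu, Fintype.sum_sigma, Fin.sum_univ_three]
  have e0 : ∑ I : Sym (Fin m) ((0 : Fin 3) : ℕ), ∑ α, u.2 ⟨0, I⟩ α * D (dirU ⟨0, I⟩ α) = 0 := by
    refine Finset.sum_eq_zero fun I _ => Finset.sum_eq_zero fun α _ => ?_
    have : (⟨0, I⟩ : JetIdx m 2) = idx0 :=
      congrArg (Sigma.mk (0 : Fin 3)) (Subsingleton.elim (α := Sym (Fin m) 0) I Sym.nil)
    rw [this, h0]
    exact zero_mul _
  rw [e0, zero_add]
  congr 1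
  exact sum_sym_one fun I => ∑ α, u.2 ⟨1, I⟩ α * D (dirU ⟨1, I⟩ α)

theorem extDeriv_modelTheta_of_vertical_over_E {ℓ : JetCoord m n 2 → ℝ} {z : WCoord m n}
    (hℓ : DifferentiableAt ℝ ℓ (z.1.trunc 2 (by norm_num))) {T : Fin m → WCoord m n}
    (hT : ∀ i, wToJ1 (T i) = (z.1.trunc 2 (by norm_num)).total i) {ξ : WCoord m n}
    (hξ : ξ.1.1 = 0) (hξ0 : ξ.1.2 idx0 = 0) : extDeriv (modelTheta ℓ) z (Fin.cons ξ T) =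
      ∑ i, ∑ α, ξ.1.2 (idx1 i) α *
        (fderiv ℝ ℓ (z.1.trunc 2 (by norm_num)) (dirU ⟨1, multiIdx ![i]⟩ α) - z.2.1 i α -
          ∑ k, (mult i k)⁻¹ * (T k).2.2 (idx2 i k) α) +
      ∑ I, ∑ α, ξ.1.2 ⟨2, I⟩ α *
        (fderiv ℝ ℓ (z.1.trunc 2 (by norm_num)) (dirU ⟨2, I⟩ α) - z.2.2 I α) := by
  have hadd : extDeriv (modelTheta ℓ) z (Fin.cons ξ T) =
      extDeriv (modelTheta ℓ) z (Fin.cons (ξ.1, 0) T) +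
        extDeriv (modelTheta ℓ) z (Fin.cons (0, ξ.2) T) := by
    have := (extDeriv (modelTheta ℓ) z).toMultilinearMap.cons_add T (ξ.1, 0) (0, ξ.2)
    rw [Prod.mk_add_mk, add_zero, zero_add] at this
    exact this
  rw [hadd, extDeriv_modelTheta_of_fst_eq_zero hℓ hT (ξ := (0, ξ.2)) rfl, add_zero,
    extDeriv_modelTheta_of_vertical hℓ hT hξ,
    apply_eq_sum_two _ (ξ.1.trunc 2 (by norm_num)) hξ hξ0]
  have e1 : ∀ i, (ξ.1.trunc 2 (by norm_num) : JetCoord m n 2).2 (idx1 i) = ξ.1.2 (idx1 i) :=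
    fun i => rfl
  have e2 : ∀ I, (ξ.1.trunc 2 (by norm_num) : JetCoord m n 2).2 ⟨2, I⟩ = ξ.1.2 ⟨2, I⟩ :=
    fun I => rfl
  have e3 : ∑ k, ∑ i, ∑ α, (mult i k)⁻¹ * z.2.2 (idx2 i k) α * ξ.1.2 ⟨2, idx2 i k⟩ α =
      ∑ I, ∑ α, ξ.1.2 ⟨2, I⟩ α * z.2.2 I α := by
    refine Eq.trans ?_ (sum_sym_two fun I => ∑ α, ξ.1.2 ⟨2, I⟩ α * z.2.2 I α)
    refine Finset.sum_congr rfl fun k _ => Finset.sum_congr rfl fun i _ => ?_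
    rw [Finset.mul_sum]
    exact Finset.sum_congr rfl fun α _ => by ring
  have e4 : ∑ k, ∑ i, ∑ α, (mult i k)⁻¹ * (T k).2.2 (idx2 i k) α * ξ.1.2 (idx1 i) α =
      ∑ i, ∑ α, ξ.1.2 (idx1 i) α * ∑ k, (mult i k)⁻¹ * (T k).2.2 (idx2 i k) α := by
    rw [Finset.sum_comm]
    refine Finset.sum_congr rfl fun i _ => ?_
    rw [Finset.sum_comm]
    refine Finset.sum_congr rfl fun α _ => ?_
    rw [Finset.mul_sum]
    exact Finset.sum_congr rfl fun k _ => by ring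
  have e5 : ∀ k, ∑ α, (T k).2.1 k α * ξ.1.2 idx0 α = 0 := fun k =>
    Finset.sum_eq_zero fun α _ => by simp [hξ0]
  have e6 : ∑ k, ∑ α, z.2.1 k α * ξ.1.2 (idx1 k) α = ∑ k, ∑ α, ξ.1.2 (idx1 k) α * z.2.1 k α := by
    simp only [mul_comm]
  simp only [e1, e2, e5, zero_add, Finset.sum_add_distrib, mul_sub, Finset.sum_sub_distrib]
  rw [e3, e4, e6]
  have comb : ∀ a b c d e : ℝ, a + b - (c + d) - e = a - c - e + (b - d) := by
    intros
    ring
  exact comb _ _ _ _ _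

end Sums

/-! ### Holonomic sections in coordinates -/

section Holonomic

set_option linter.unusedSectionVars false

variable {m n : ℕ} {M E : Type*}
  [TopologicalSpace M] [ChartedSpace (Rn m) M] [TopologicalSpace E] [ChartedSpace (Rn (m + n)) E]
  [IsManifold (𝓡 m) ∞ M] [IsManifold (𝓡 (m + n)) ∞ E]
  {π : FiberedManifold m n M E}

open FiberedChart

/-- Near `x`, the map `ψ` is a smooth section of `𝒲ᵣ → M` with component `j³φ` in `J³π`. -/
def HolonomicNear (ψ : M → RestrictedBundle π) (φ : M → E) (x : M) : Prop :=
  ∀ᶠ y in 𝓝 x, ContMDiffAt (𝓡 m) 𝓘(ℝ, WCoord m n) ∞ ψ y ∧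
    ∃ h : IsSectionAt π φ y, (ψ y).jet = jet 3 h

/-- The coordinate expression of a section of `𝒲ᵣ → M`. -/
def FiberedChart.coordRep (c : FiberedChart π) (ψ : M → RestrictedBundle π) : Rn m → WCoord m n :=
  c.wCoords ∘ ψ ∘ c.base.symm

variable {ψ : M → RestrictedBundle π} {φ : M → E} {x : M} {c d : FiberedChart π}

namespace HolonomicNear

theorem isSectionAt (h : HolonomicNear ψ φ x) : IsSectionAt π φ x := h.self_of_nhds.2.1

theorem jet_eq (h : HolonomicNear ψ φ x) : (ψ x).jet = jet 3 h.isSectionAt :=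
  h.self_of_nhds.2.2

theorem mem_chart (h : HolonomicNear ψ φ x) (hc : ψ x ∈ c.wSource) : φ x ∈ c.chart.source := by
  have h1 : (ψ x).jet.toE ∈ c.chart.source := hc
  rwa [h.jet_eq] at h1

theorem base_mem (h : HolonomicNear ψ φ x) (hc : ψ x ∈ c.wSource) : x ∈ c.base.source :=
  c.base_mem h.isSectionAt (h.mem_chart hc)

theorem eventually (h : HolonomicNear ψ φ x) (hc : ψ x ∈ c.wSource) :
    ∀ᶠ y in 𝓝 x, HolonomicNear ψ φ y ∧ ψ y ∈ c.wSource :=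
  (eventually_eventually_nhds.2 h).and
    (h.self_of_nhds.1.continuousAt.eventually (c.isOpen_wSource.mem_nhds hc))

theorem coordRep_base (h : HolonomicNear ψ φ x) (hc : ψ x ∈ c.wSource) :
    c.coordRep ψ (c.base x) = c.wCoords (ψ x) := by
  rw [coordRep, Function.comp_apply, Function.comp_apply, c.base.left_inv (h.base_mem hc)]

theorem mdifferentiableAt (h : HolonomicNear ψ φ x) :
    MDifferentiableAt (𝓡 m) 𝓘(ℝ, WCoord m n) ψ x :=
  h.self_of_nhds.1.mdifferentiableAt (by simp)

theorem contDiffAt_coordRep (h : HolonomicNear ψ φ x) (hc : ψ x ∈ c.wSource) :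
    ContDiffAt ℝ ∞ (c.coordRep ψ) (c.base x) := by
  rw [← contMDiffAt_iff_contDiffAt]
  have hb := h.base_mem hc
  have hsymm := c.base.left_inv hb
  have h1 : ContMDiffAt (𝓡 m) (𝓡 m) ∞ c.base.symm (c.base x) :=
    c.smooth_base_symm.contMDiffAt (c.base.open_target.mem_nhds (c.base.map_source hb))
  have h2 : ContMDiffAt (𝓡 m) 𝓘(ℝ, WCoord m n) ∞ ψ (c.base.symm (c.base x)) := by
    rw [hsymm]
    exact h.self_of_nhds.1
  have h3 : ContMDiffAt 𝓘(ℝ, WCoord m n) 𝓘(ℝ, WCoord m n) ∞ c.wCoords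
      (ψ (c.base.symm (c.base x))) := by
    rw [hsymm]
    exact c.contMDiffOn_wCoords.contMDiffAt (c.isOpen_wSource.mem_nhds hc)
  exact ContMDiffAt.comp (c.base x) h3 (h2.comp (c.base x) h1)

theorem coordRep_fst (h : HolonomicNear ψ φ x) (hc : ψ x ∈ c.wSource) :
    ∀ᶠ y in 𝓝 (c.base x), (c.coordRep ψ y).1 = jetRep 3 (c.rep φ) y := by
  filter_upwards [c.eventually_base_symm (h.base_mem hc) (h.eventually hc)] with y ⟨hy, h', hc'⟩
  change c.jetCoords (ψ (c.base.symm y)).jet = _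
  rw [h'.jet_eq, c.jetCoords_jet _ (h'.mem_chart hc'), c.base.right_inv hy]
  rfl

theorem mfderiv_coordRep (h : HolonomicNear ψ φ x) (hc : ψ x ∈ c.wSource) (u : Rn m) :
    mfderiv 𝓘(ℝ, WCoord m n) 𝓘(ℝ, WCoord m n) c.wCoords (ψ x)
      (mfderiv (𝓡 m) 𝓘(ℝ, WCoord m n) ψ x
        (mfderiv (𝓡 m) (𝓡 m) c.base.symm (c.base x) u)) =
      fderiv ℝ (c.coordRep ψ) (c.base x) u := by
  have hb := h.base_mem hc
  have hsymm := c.base.left_inv hb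
  have hB : MDifferentiableAt (𝓡 m) (𝓡 m) c.base.symm (c.base x) :=
    (c.smooth_base_symm.contMDiffAt
      (c.base.open_target.mem_nhds (c.base.map_source hb))).mdifferentiableAt (by simp)
  have hP : MDifferentiableAt (𝓡 m) 𝓘(ℝ, WCoord m n) ψ (c.base.symm (c.base x)) := by
    rw [hsymm]
    exact h.mdifferentiableAt
  have hW : MDifferentiableAt 𝓘(ℝ, WCoord m n) 𝓘(ℝ, WCoord m n) c.wCoords
      (ψ (c.base.symm (c.base x))) := by
    rw [hsymm]
    exact mdifferentiableAt_wCoords hc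
  have h2 := mfderiv_comp (g := c.wCoords) (f := ψ ∘ c.base.symm) _ hW (hP.comp _ hB)
  rw [mfderiv_comp _ hP hB] at h2
  change mfderiv (𝓡 m) 𝓘(ℝ, WCoord m n) (c.coordRep ψ) (c.base x) = _ at h2
  rw [mfderiv_eq_fderiv] at h2
  refine Eq.trans ?_ (DFunLike.congr_fun h2 u).symm
  have key : ∀ (y : M) (hy : y = x) (u : Rn m),
      mfderiv 𝓘(ℝ, WCoord m n) 𝓘(ℝ, WCoord m n) c.wCoords (ψ x)
        (mfderiv (𝓡 m) 𝓘(ℝ, WCoord m n) ψ x u) =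
      mfderiv 𝓘(ℝ, WCoord m n) 𝓘(ℝ, WCoord m n) c.wCoords (ψ y)
        (mfderiv (𝓡 m) 𝓘(ℝ, WCoord m n) ψ y u) := by
    rintro y rfl u
    rfl
  exact key _ hsymm _

theorem trunc_fderiv_coordRep (h : HolonomicNear ψ φ x) (hc : ψ x ∈ c.wSource) (i : Fin m) :
    (fderiv ℝ (c.coordRep ψ) (c.base x) (stdVec i)).1.trunc 2 (by norm_num) =
      (c.wCoords (ψ x)).1.total i := by
  let T : WCoord m n →L[ℝ] JetCoord m n 2 :=
    (truncL 2 (by norm_num)).comp (ContinuousLinearMap.fst ℝ (JetCoord m n 3) (MomCoord m n))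
  have h1 : T ∘ c.coordRep ψ =ᶠ[𝓝 (c.base x)] jetRep 2 (c.rep φ) := by
    filter_upwards [h.coordRep_fst hc] with y hy
    change (c.coordRep ψ y).1.trunc 2 (by norm_num) = _
    rw [hy]
    rfl
  have h2 := (T.hasFDerivAt (x := c.coordRep ψ (c.base x))).comp (c.base x)
    ((h.contDiffAt_coordRep hc).differentiableAt (by simp)).hasFDerivAt
  have h3 := h2.fderiv.symm.trans h1.fderiv_eq
  have h4 := DFunLike.congr_fun h3 (stdVec i)
  rw [fderiv_jetRep (c.rep_smooth h.isSectionAt (h.mem_chart hc)),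
    ← (h.coordRep_fst hc).self_of_nhds, h.coordRep_base hc] at h4
  exact h4

theorem wToJ1_fderiv_coordRep (h : HolonomicNear ψ φ x) (hc : ψ x ∈ c.wSource) (i : Fin m) :
    wToJ1 (fderiv ℝ (c.coordRep ψ) (c.base x) (stdVec i)) =
      ((c.wCoords (ψ x)).1.trunc 2 (by norm_num)).total i :=
  congrArg (fun u : JetCoord m n 2 => u.trunc 1 (by norm_num)) (h.trunc_fderiv_coordRep hc i)

end HolonomicNear

variable {L : JetSpace π 2 → ℝ} (η : VolumeForm m M)

namespace HolonomicNear

/-- If the momenta of second order are given by the Legendre map, their derivatives are total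
derivatives. -/
theorem fderiv_momentum (hL : ContMDiff 𝓘(ℝ, JetCoord m n 2) 𝓘(ℝ, ℝ) ∞ L)
    (h : HolonomicNear ψ φ x) (hc : ψ x ∈ c.wSource) (I : Sym (Fin m) 2) (α : Fin n)
    (hp : ∀ᶠ y in 𝓝 x, (c.wCoords (ψ y)).2.2 I α = fderiv ℝ (c.lagrangian L η)
      ((c.wCoords (ψ y)).1.trunc 2 (by norm_num)) (dirU ⟨2, I⟩ α)) (k : Fin m) :
    (fderiv ℝ (c.coordRep ψ) (c.base x) (stdVec k)).2.2 I α =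
      totalDeriv k (fun y => fderiv ℝ (c.lagrangian L η) y (dirU ⟨2, I⟩ α))
        (c.wCoords (ψ x)).1 := by
  let T : WCoord m n →L[ℝ] JetCoord m n 2 :=
    (truncL 2 (by norm_num)).comp (ContinuousLinearMap.fst ℝ (JetCoord m n 3) (MomCoord m n))
  let P : WCoord m n →L[ℝ] ℝ :=
    ((ContinuousLinearMap.proj (R := ℝ) (φ := fun _ : Fin n => ℝ) α).comp
      (ContinuousLinearMap.proj (R := ℝ) (φ := fun _ : Sym (Fin m) 2 => Fin n → ℝ) I)).comp
        ((ContinuousLinearMap.snd ℝ (Fin m → Fin n → ℝ) (Sym (Fin m) 2 → Fin n → ℝ)).comp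
          (ContinuousLinearMap.snd ℝ (JetCoord m n 3) (MomCoord m n)))
  let f : JetCoord m n 2 → ℝ := fun y => fderiv ℝ (c.lagrangian L η) y (dirU ⟨2, I⟩ α)
  have hσ := ((h.contDiffAt_coordRep hc).differentiableAt (by simp)).hasFDerivAt
  have h1 : P ∘ c.coordRep ψ =ᶠ[𝓝 (c.base x)] f ∘ T ∘ c.coordRep ψ := by
    filter_upwards [c.eventually_base_symm (h.base_mem hc) hp] with y hy
    exact hy.2
  have hf : DifferentiableAt ℝ f (T (c.coordRep ψ (c.base x))) := by
    rw [h.coordRep_base hc]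
    have hl : ContDiffAt ℝ ∞ (c.lagrangian L η)
        ((c.wCoords (ψ x)).1.trunc 2 (by norm_num)) :=
      contDiffAt_lagrangian η hL c (trunc_mem_jetTarget c (by norm_num) (c.wCoords_mem hc))
    exact ((hl.fderiv_right (m := ∞) (by simp)).clm_apply contDiffAt_const).differentiableAt
      (by simp)
  have h2 := (P.hasFDerivAt (x := c.coordRep ψ (c.base x))).comp (c.base x) hσ
  have h3 := hf.hasFDerivAt.comp (c.base x)
    ((T.hasFDerivAt (x := c.coordRep ψ (c.base x))).comp (c.base x) hσ)
  have h4 := DFunLike.congr_fun ((h2.fderiv.symm.trans h1.fderiv_eq).trans h3.fderiv) (stdVec k)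
  refine Eq.trans h4 ?_
  change fderiv ℝ f (T (c.coordRep ψ (c.base x)))
    ((fderiv ℝ (c.coordRep ψ) (c.base x) (stdVec k)).1.trunc 2 (by norm_num)) = _
  rw [h.trunc_fderiv_coordRep hc, h.coordRep_base hc]
  rfl

/-- The coordinate expression of `ψ^* i(X) Ω_r`. -/
theorem omegaR_eq (hL : ContMDiff 𝓘(ℝ, JetCoord m n 2) 𝓘(ℝ, ℝ) ∞ L)
    (h : HolonomicNear ψ φ x) (hc : ψ x ∈ c.wSource)
    (X : TangentSpace 𝓘(ℝ, WCoord m n) (ψ x)) (u : Fin m → Rn m) :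
    omegaR L η (ψ x) (Fin.cons X fun k => mfderiv (𝓡 m) 𝓘(ℝ, WCoord m n) ψ x
        (mfderiv (𝓡 m) (𝓡 m) c.base.symm (c.base x) (u k))) =
      -extDeriv (modelTheta (c.lagrangian L η)) (c.wCoords (ψ x))
        (Fin.cons (mfderiv 𝓘(ℝ, WCoord m n) 𝓘(ℝ, WCoord m n) c.wCoords (ψ x) X)
          fun k => fderiv ℝ (c.coordRep ψ) (c.base x) (u k)) := by
  rw [omegaR_apply η hL hc]
  congr 2
  funext a
  refine Fin.cases ?_ (fun k => ?_) a
  · rfl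
  · exact h.mfderiv_coordRep hc (u k)

/-- The equation `ψ^* i(X) Ω_r = 0` needs to be checked on a coordinate frame only. -/
theorem omegaR_eq_zero_of_basis (hL : ContMDiff 𝓘(ℝ, JetCoord m n 2) 𝓘(ℝ, ℝ) ∞ L)
    (h : HolonomicNear ψ φ x) (hc : ψ x ∈ c.wSource)
    (X : TangentSpace 𝓘(ℝ, WCoord m n) (ψ x))
    (h0 : extDeriv (modelTheta (c.lagrangian L η)) (c.wCoords (ψ x))
      (Fin.cons (mfderiv 𝓘(ℝ, WCoord m n) 𝓘(ℝ, WCoord m n) c.wCoords (ψ x) X)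
        fun k => fderiv ℝ (c.coordRep ψ) (c.base x) (stdVec k)) = 0)
    (v : Fin m → TangentSpace (𝓡 m) x) :
    omegaR L η (ψ x) (Fin.cons X fun k => mfderiv (𝓡 m) 𝓘(ℝ, WCoord m n) ψ x (v k)) = 0 := by
  have hb := h.base_mem hc
  have hsymm := c.base.left_inv hb
  have hB : MDifferentiableAt (𝓡 m) (𝓡 m) c.base.symm (c.base x) :=
    (c.smooth_base_symm.contMDiffAt
      (c.base.open_target.mem_nhds (c.base.map_source hb))).mdifferentiableAt (by simp)
  have hB' : MDifferentiableAt (𝓡 m) (𝓡 m) c.base x :=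
    (c.smooth_base.contMDiffAt (c.base.open_source.mem_nhds hb)).mdifferentiableAt (by simp)
  have h1 : c.base.symm ∘ c.base =ᶠ[𝓝 x] id := by
    filter_upwards [c.base.open_source.mem_nhds hb] with y hy
    exact c.base.left_inv hy
  have h2 := h1.mfderiv_eq (I := 𝓡 m) (I' := 𝓡 m)
  rw [mfderiv_comp x hB hB', mfderiv_id] at h2
  have hv : ∀ k, mfderiv (𝓡 m) (𝓡 m) c.base.symm (c.base x)
      (mfderiv (𝓡 m) (𝓡 m) c.base x (v k)) = v k := fun k => DFunLike.congr_fun h2 (v k)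
  have h3 := h.omegaR_eq η hL hc X fun k => mfderiv (𝓡 m) (𝓡 m) c.base x (v k)
  have h4 : (fun k => mfderiv (𝓡 m) 𝓘(ℝ, WCoord m n) ψ x
      (mfderiv (𝓡 m) (𝓡 m) c.base.symm (c.base x) (mfderiv (𝓡 m) (𝓡 m) c.base x (v k)))) =
      fun k => mfderiv (𝓡 m) 𝓘(ℝ, WCoord m n) ψ x (v k) :=
    funext fun k => congrArg (mfderiv (𝓡 m) 𝓘(ℝ, WCoord m n) ψ x) (hv k)
  have h5 : omegaR L η (ψ x) (Fin.cons X fun k => mfderiv (𝓡 m) 𝓘(ℝ, WCoord m n) ψ x (v k)) =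
      omegaR L η (ψ x) (Fin.cons X fun k => mfderiv (𝓡 m) 𝓘(ℝ, WCoord m n) ψ x
      (mfderiv (𝓡 m) (𝓡 m) c.base.symm (c.base x) (mfderiv (𝓡 m) (𝓡 m) c.base x (v k)))) :=
    congrArg (fun u => omegaR L η (ψ x) (Fin.cons X u)) h4.symm
  rw [h5, h3, neg_eq_zero]
  let f : Rn m [⋀^Fin m]→L[ℝ] ℝ := ((extDeriv (modelTheta (c.lagrangian L η))
    (c.wCoords (ψ x))).curryLeft (mfderiv 𝓘(ℝ, WCoord m n) 𝓘(ℝ, WCoord m n) c.wCoords (ψ x)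
      X)).compContinuousLinearMap (fderiv ℝ (c.coordRep ψ) (c.base x))
  have h6 := alternating_apply_eq_det f fun k => mfderiv (𝓡 m) (𝓡 m) c.base x (v k)
  have h7 : f (fun i => stdVec i) = 0 := h0
  rw [h7, zero_mul] at h6
  exact h6

end HolonomicNear

end Holonomic

/-! ### The graph of the Legendre map does not depend on the chart -/

section Invariance

set_option linter.unusedSectionVars false

variable {m n : ℕ} {M E : Type*}
  [TopologicalSpace M] [ChartedSpace (Rn m) M] [TopologicalSpace E] [ChartedSpace (Rn (m + n)) E]
  [IsManifold (𝓡 m) ∞ M] [IsManifold (𝓡 (m + n)) ∞ E]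
  {π : FiberedManifold m n M E}

open FiberedChart

/-- The projection `𝒲ᵣ → E` in coordinates. -/
def wToE : WCoord m n →L[ℝ] Rn m × Rn n :=
  ((ContinuousLinearMap.fst ℝ (Rn m) (JetIdx m 3 → Rn n)).prod
    ((ContinuousLinearMap.proj (φ := fun _ : JetIdx m 3 => Rn n) idx0).comp
      (ContinuousLinearMap.snd ℝ (Rn m) (JetIdx m 3 → Rn n)))).comp
    (ContinuousLinearMap.fst ℝ (JetCoord m n 3) (MomCoord m n))

theorem wToE_wCoords {c : FiberedChart π} {w : RestrictedBundle π} (hc : w ∈ c.wSource) :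
    wToE (c.wCoords w) = c.chart w.jet.toE := by
  change ((c.jetCoords w.jet).1, (c.jetCoords w.jet).2 idx0) = _
  have hj : w.jet.toE ∈ c.chart.source := hc
  obtain ⟨φ, x, h, he⟩ := w.jet.exists_jet
  rw [he] at hj ⊢
  rw [c.jetCoords_jet h hj]
  change (c.base x, partialDeriv (idx0 : JetIdx m 3).2 (c.rep φ) (c.base x)) = c.chart (φ x)
  rw [c.partialDeriv_zero_rep, ← c.chart_eq h hj]

theorem wToE_mfderiv_eq_zero {c d : FiberedChart π} {w : RestrictedBundle π}
    (hc : w ∈ c.wSource) (hd : w ∈ d.wSource) (X : TangentSpace 𝓘(ℝ, WCoord m n) w)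
    (hX : wToE (mfderiv 𝓘(ℝ, WCoord m n) 𝓘(ℝ, WCoord m n) d.wCoords w X) = 0) :
    wToE (mfderiv 𝓘(ℝ, WCoord m n) 𝓘(ℝ, WCoord m n) c.wCoords w X) = 0 := by
  have hmem : wToE (d.wCoords w) ∈ d.overlap c := by
    rw [mem_overlap, wToE_wCoords hd, d.chart.left_inv hd]
    exact ⟨d.chart.map_source hd, hc⟩
  have h1 : wToE ∘ c.wCoords =ᶠ[𝓝 w] (d.trans c ∘ wToE) ∘ d.wCoords := by
    filter_upwards [c.isOpen_wSource.mem_nhds hc, d.isOpen_wSource.mem_nhds hd] with w' hc' hd'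
    change wToE (c.wCoords w') = d.trans c (wToE (d.wCoords w'))
    rw [wToE_wCoords hc', wToE_wCoords hd', FiberedChart.trans, d.chart.left_inv hd']
  have hT := ((d.trans_smooth c hmem).differentiableAt (by simp)).hasFDerivAt.comp (d.wCoords w)
    (wToE (m := m) (n := n)).hasFDerivAt
  have h2 := h1.mfderiv_eq (I := 𝓘(ℝ, WCoord m n)) (I' := 𝓘(ℝ, Rn m × Rn n))
  rw [mfderiv_comp w (wToE (m := m) (n := n)).differentiableAt.mdifferentiableAt
      (mdifferentiableAt_wCoords hc),
    mfderiv_comp w hT.differentiableAt.mdifferentiableAt (mdifferentiableAt_wCoords hd),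
    mfderiv_eq_fderiv, mfderiv_eq_fderiv, hT.fderiv, ContinuousLinearMap.fderiv] at h2
  refine (DFunLike.congr_fun h2 X).trans ?_
  change fderiv ℝ (d.trans c) (wToE (d.wCoords w))
    (wToE (mfderiv 𝓘(ℝ, WCoord m n) 𝓘(ℝ, WCoord m n) d.wCoords w X)) = 0
  rw [hX, map_zero]

theorem mfderiv_wCoords_mfderiv_wSymm {d : FiberedChart π} {w : RestrictedBundle π}
    (hd : w ∈ d.wSource) (ξ : WCoord m n) :
    mfderiv 𝓘(ℝ, WCoord m n) 𝓘(ℝ, WCoord m n) d.wCoords w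
      ((mfderiv 𝓘(ℝ, WCoord m n) 𝓘(ℝ, WCoord m n) (d.wSymm : _ → RestrictedBundle π)
        (d.wCoords w) ξ : WCoord m n)) = ξ := by
  have hz := d.wCoords_mem hd
  have hw0 := d.wSymm_wCoords hd
  have h1 : d.wCoords ∘ (d.wSymm : _ → RestrictedBundle π) =ᶠ[𝓝 (d.wCoords w)] id := by
    filter_upwards [d.isOpen_wTarget.mem_nhds hz] with z hz'
    exact d.wCoords_wSymm_self hz'
  have hc : MDifferentiableAt 𝓘(ℝ, WCoord m n) 𝓘(ℝ, WCoord m n) d.wCoords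
      (d.wSymm (d.wCoords w)) := by
    rw [hw0]
    exact mdifferentiableAt_wCoords hd
  have h2 := h1.mfderiv_eq (I := 𝓘(ℝ, WCoord m n)) (I' := 𝓘(ℝ, WCoord m n))
  rw [mfderiv_comp _ hc (mdifferentiableAt_wSymm hz), mfderiv_id] at h2
  have key : ∀ (w' : RestrictedBundle π) (hw : w' = w) (u : WCoord m n),
      mfderiv 𝓘(ℝ, WCoord m n) 𝓘(ℝ, WCoord m n) d.wCoords w u =
        mfderiv 𝓘(ℝ, WCoord m n) 𝓘(ℝ, WCoord m n) d.wCoords w' u := by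
    rintro w' rfl u
    rfl
  exact (key _ hw0 _).trans (DFunLike.congr_fun h2 ξ)

theorem dirU_snd_self {k : ℕ} (I : JetIdx m k) (α : Fin n) :
    (dirU I α : JetCoord m n k).2 I = stdVec α := by
  simp [dirU]

theorem dirU_snd_of_ne {k : ℕ} {I J : JetIdx m k} (h : J ≠ I) (α : Fin n) :
    (dirU I α : JetCoord m n k).2 J = 0 := by
  simp [dirU, h]

theorem sum_dirU_self {k : ℕ} {ι : Type*} [Fintype ι] (f : ι → JetIdx m k)
    (hf : Function.Injective f) (B : ι → Fin n → ℝ) (i : ι) (α : Fin n) :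
    ∑ r, ∑ β, (dirU (f i) α : JetCoord m n k).2 (f r) β * B r β = B i α := by
  rw [Finset.sum_eq_single i, dirU_snd_self, Finset.sum_eq_single α]
  · simp
  · intro β _ hβ
    simp [hβ]
  · simp
  · intro r _ hr
    simp [dirU_snd_of_ne (hf.ne hr)]
  · simp

theorem sum_dirU_of_ne {k : ℕ} {ι : Type*} [Fintype ι] (f : ι → JetIdx m k)
    (B : ι → Fin n → ℝ) {J : JetIdx m k} (hJ : ∀ r, f r ≠ J) (α : Fin n) :
    ∑ r, ∑ β, (dirU J α : JetCoord m n k).2 (f r) β * B r β = 0 :=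
  Finset.sum_eq_zero fun r _ => Finset.sum_eq_zero fun β _ => by simp [dirU_snd_of_ne (hJ r)]

theorem injective_idx1 {k : ℕ} : Function.Injective (idx1 : Fin m → JetIdx m (k + 1)) := by
  intro r i he
  have h2 : multiIdx ![r] = multiIdx ![i] := eq_of_heq (Sigma.mk.inj he).2
  rw [multiIdx_eq_iff] at h2
  simpa using h2

theorem eq_zero_of_sum_eq_zero {A : Fin m → Fin n → ℝ} {B : Sym (Fin m) 2 → Fin n → ℝ}
    (h : ∀ ζ : JetCoord m n 3, ζ.1 = 0 → ζ.2 idx0 = 0 →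
      ∑ i, ∑ α, ζ.2 ⟨1, multiIdx ![i]⟩ α * A i α +
        ∑ I : Sym (Fin m) 2, ∑ α, ζ.2 ⟨2, I⟩ α * B I α = 0) :
    (∀ i α, A i α = 0) ∧ ∀ I α, B I α = 0 := by
  have hne : ∀ {I J : JetIdx m 3}, (I.1 : ℕ) ≠ J.1 → I ≠ J := fun hI he => hI (by rw [he])
  constructor
  · intro i α
    have h1 := sum_dirU_self (idx1 : Fin m → JetIdx m 3) injective_idx1 A i α
    have h2 := sum_dirU_of_ne (fun I : Sym (Fin m) 2 => (⟨2, I⟩ : JetIdx m 3)) B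
      (J := ⟨1, multiIdx ![i]⟩) (fun I => hne (show 2 ≠ 1 by decide)) α
    have h3 := (congrArg₂ (· + ·) h1 h2).symm.trans (h (dirU ⟨1, multiIdx ![i]⟩ α) rfl
      (dirU_snd_of_ne (hne (show 0 ≠ 1 by decide)) α))
    simpa using h3
  · intro I α
    have h1 := sum_dirU_of_ne (fun i : Fin m => (⟨1, multiIdx ![i]⟩ : JetIdx m 3)) A
      (J := ⟨2, I⟩) (fun I => hne (show 1 ≠ 2 by decide)) α
    have h2 := sum_dirU_self (fun I : Sym (Fin m) 2 => (⟨2, I⟩ : JetIdx m 3))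
      (fun I J he => eq_of_heq (Sigma.mk.inj he).2) B I α
    have h3 := (congrArg₂ (· + ·) h1 h2).symm.trans (h (dirU ⟨2, I⟩ α) rfl
      (dirU_snd_of_ne (hne (show 0 ≠ 2 by decide)) α))
    simpa using h3

variable {L : JetSpace π 2 → ℝ} (η : VolumeForm m M)

/-- Along a holonomic section in the graph of the Legendre map, `ψ^* i(X) Ω_r = 0` for every `X`
vertical over `E`. -/
theorem HolonomicNear.omegaR_eq_zero_of_legendre
    (hL : ContMDiff 𝓘(ℝ, JetCoord m n 2) 𝓘(ℝ, ℝ) ∞ L) {ψ : M → RestrictedBundle π} {φ : M → E}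
    {x : M} {c : FiberedChart π} (h : HolonomicNear ψ φ x) (hc : ψ x ∈ c.wSource)
    (hp : ∀ᶠ y in 𝓝 x, (c.wCoords (ψ y)).2 = c.legendre L η (c.wCoords (ψ y)).1)
    (X : TangentSpace 𝓘(ℝ, WCoord m n) (ψ x))
    (hX : wToE (mfderiv 𝓘(ℝ, WCoord m n) 𝓘(ℝ, WCoord m n) c.wCoords (ψ x) X) = 0)
    (v : Fin m → TangentSpace (𝓡 m) x) :
    omegaR L η (ψ x) (Fin.cons X fun k => mfderiv (𝓡 m) 𝓘(ℝ, WCoord m n) ψ x (v k)) = 0 := by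
  refine h.omegaR_eq_zero_of_basis η hL hc X ?_ v
  rw [extDeriv_modelTheta_of_vertical_over_E
    (differentiableAt_lagrangian η hL (c.wCoords_mem hc)) (h.wToJ1_fderiv_coordRep hc)
    (congrArg Prod.fst hX) (congrArg Prod.snd hX)]
  have hp2 : ∀ I α, ∀ᶠ y in 𝓝 x, (c.wCoords (ψ y)).2.2 I α = fderiv ℝ (c.lagrangian L η)
      ((c.wCoords (ψ y)).1.trunc 2 (by norm_num)) (dirU ⟨2, I⟩ α) := by
    intro I α
    filter_upwards [hp] with y hy
    rw [hy]
    rfl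
  have e1 : ∀ i α, fderiv ℝ (c.lagrangian L η) ((c.wCoords (ψ x)).1.trunc 2 (by norm_num))
      (dirU ⟨1, multiIdx ![i]⟩ α) - (c.wCoords (ψ x)).2.1 i α - ∑ k, (mult i k)⁻¹ *
        (fderiv ℝ (c.coordRep ψ) (c.base x) (stdVec k)).2.2 (idx2 i k) α = 0 := by
    intro i α
    simp only [h.fderiv_momentum η hL hc _ _ (hp2 _ _)]
    rw [hp.self_of_nhds]
    change _ - (_ - _) - _ = (0 : ℝ)
    rw [sub_sub_cancel]
    exact sub_self _
  have e2 : ∀ I α, fderiv ℝ (c.lagrangian L η) ((c.wCoords (ψ x)).1.trunc 2 (by norm_num))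
      (dirU ⟨2, I⟩ α) - (c.wCoords (ψ x)).2.2 I α = 0 := fun I α =>
    sub_eq_zero.2 (hp2 I α).self_of_nhds.symm
  simp only [e1, e2, mul_zero, Finset.sum_const_zero, add_zero]

/-- If `ψ^* i(X) Ω_r = 0` for every `X` vertical over `E` near `x`, then `ψ x` lies in the graph of
the Legendre map. -/
theorem HolonomicNear.legendre_of_omegaR_eq_zero
    (hL : ContMDiff 𝓘(ℝ, JetCoord m n 2) 𝓘(ℝ, ℝ) ∞ L) {ψ : M → RestrictedBundle π} {φ : M → E}
    {x : M} {d : FiberedChart π} (h : HolonomicNear ψ φ x) (hd : ψ x ∈ d.wSource)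
    (hΩ : ∀ᶠ y in 𝓝 x, ∀ X : TangentSpace 𝓘(ℝ, WCoord m n) (ψ y),
      wToE (mfderiv 𝓘(ℝ, WCoord m n) 𝓘(ℝ, WCoord m n) d.wCoords (ψ y) X) = 0 →
      ∀ v : Fin m → TangentSpace (𝓡 m) y, omegaR L η (ψ y)
        (Fin.cons X fun k => mfderiv (𝓡 m) 𝓘(ℝ, WCoord m n) ψ y (v k)) = 0) :
    (d.wCoords (ψ x)).2 = d.legendre L η (d.wCoords (ψ x)).1 := by
  have key : ∀ᶠ y in 𝓝 x,
      (∀ i α, fderiv ℝ (d.lagrangian L η) ((d.wCoords (ψ y)).1.trunc 2 (by norm_num))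
        (dirU ⟨1, multiIdx ![i]⟩ α) - (d.wCoords (ψ y)).2.1 i α - ∑ k, (mult i k)⁻¹ *
          (fderiv ℝ (d.coordRep ψ) (d.base y) (stdVec k)).2.2 (idx2 i k) α = 0) ∧
      ∀ I α, fderiv ℝ (d.lagrangian L η) ((d.wCoords (ψ y)).1.trunc 2 (by norm_num))
        (dirU ⟨2, I⟩ α) - (d.wCoords (ψ y)).2.2 I α = 0 := by
    filter_upwards [h.eventually hd, hΩ] with y ⟨hy, hdy⟩ hΩy
    refine eq_zero_of_sum_eq_zero fun ζ hζ hζ0 => ?_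
    obtain ⟨X, hX⟩ : ∃ X : TangentSpace 𝓘(ℝ, WCoord m n) (ψ y),
        mfderiv 𝓘(ℝ, WCoord m n) 𝓘(ℝ, WCoord m n) d.wCoords (ψ y) X = (ζ, 0) :=
      ⟨_, mfderiv_wCoords_mfderiv_wSymm hdy (ζ, 0)⟩
    have h1 := hy.omegaR_eq η hL hdy X fun k => stdVec k
    have h0 := hΩy X (by rw [hX]; exact Prod.ext hζ hζ0)
    rw [hX, extDeriv_modelTheta_of_vertical_over_E
      (differentiableAt_lagrangian η hL (d.wCoords_mem hdy)) (hy.wToJ1_fderiv_coordRep hdy)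
      hζ hζ0] at h1
    exact neg_eq_zero.1 (h1.symm.trans (h0 _))
  have hp2 : ∀ I α, ∀ᶠ y in 𝓝 x, (d.wCoords (ψ y)).2.2 I α = fderiv ℝ (d.lagrangian L η)
      ((d.wCoords (ψ y)).1.trunc 2 (by norm_num)) (dirU ⟨2, I⟩ α) := by
    intro I α
    filter_upwards [key] with y hy
    exact (sub_eq_zero.1 (hy.2 I α)).symm
  refine Prod.ext (funext fun i => funext fun α => ?_) (funext fun I => funext fun α => ?_)
  · have h1 := key.self_of_nhds.1 i α
    simp only [h.fderiv_momentum η hL hd _ _ (hp2 _ _)] at h1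
    rw [sub_right_comm] at h1
    exact (sub_eq_zero.1 h1).symm
  · exact (hp2 I α).self_of_nhds

/-- The restricted Legendre map does not depend on the chart. -/
theorem legendre_change (hL : ContMDiff 𝓘(ℝ, JetCoord m n 2) 𝓘(ℝ, ℝ) ∞ L)
    {c d : FiberedChart π} {w : RestrictedBundle π} (hc : w ∈ c.wSource) (hd : w ∈ d.wSource)
    (hw : c.momCoords w.mom = c.legendre L η (c.jetCoords w.jet)) :
    d.momCoords w.mom = d.legendre L η (d.jetCoords w.jet) := by
  obtain ⟨φ, x, hφ, hj⟩ := w.jet.exists_jet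
  have hcx : φ x ∈ c.chart.source := by
    have h1 : w.jet.toE ∈ c.chart.source := hc
    rwa [hj] at h1
  let σ : M → JetCoord m n 3 := fun y => jetRep 3 (c.rep φ) (c.base y)
  let ψ : M → RestrictedBundle π := fun y => c.wSymm (σ y, c.legendre L η (σ y))
  have hσ : ∀ {y : M} (hy : IsSectionAt π φ y), φ y ∈ c.chart.source →
      c.jetCoords (jet 3 hy) = σ y := fun hy hyc => c.jetCoords_jet hy hyc
  have hσ' : ∀ {y : M}, IsSectionAt π φ y → φ y ∈ c.chart.source → σ y ∈ c.jetTarget 3 := by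
    intro y hy hyc
    rw [← hσ hy hyc]
    exact c.jetCoords_mem (j := jet 3 hy) hyc
  have hψx : ψ x = w := by
    have h1 : (σ x, c.legendre L η (σ x)) = c.wCoords w := by
      rw [← hσ hφ hcx, ← hj, ← hw]
      rfl
    change c.wSymm (σ x, c.legendre L η (σ x)) = w
    rw [h1, c.wSymm_wCoords hc]
  have hhol : HolonomicNear ψ φ x := by
    filter_upwards [c.eventually_section hφ hcx] with y ⟨hy, hyc⟩
    refine ⟨?_, hy, ?_⟩
    · have hb : ContMDiffAt (𝓡 m) (𝓡 m) ∞ c.base y :=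
        c.smooth_base.contMDiffAt (c.base.open_source.mem_nhds (c.base_mem hy hyc))
      have hJ : ContDiffAt ℝ ∞ (jetRep 3 (c.rep φ)) (c.base y) :=
        contDiffAt_jetRep (c.rep_smooth hy hyc).self_of_nhds
      have hG : ContDiffAt ℝ ∞ (fun u => ((jetRep 3 (c.rep φ) u,
          c.legendre L η (jetRep 3 (c.rep φ) u)) : WCoord m n)) (c.base y) :=
        hJ.prodMk (ContDiffAt.comp (g := c.legendre L η) (f := jetRep 3 (c.rep φ)) (c.base y)
          (contDiffAt_legendre η hL c (hσ' hy hyc)) hJ)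
      have hS : ContMDiffAt 𝓘(ℝ, WCoord m n) 𝓘(ℝ, WCoord m n) ∞
          (c.wSymm : _ → RestrictedBundle π) (σ y, c.legendre L η (σ y)) :=
        c.contMDiffOn_wSymm.contMDiffAt (c.isOpen_wTarget.mem_nhds (hσ' hy hyc))
      have hGm : ContMDiffAt (𝓡 m) 𝓘(ℝ, WCoord m n) ∞ (fun u => ((jetRep 3 (c.rep φ) u,
          c.legendre L η (jetRep 3 (c.rep φ) u)) : WCoord m n)) (c.base y) := hG.contMDiffAt
      exact ContMDiffAt.comp y hS (hGm.comp y hb)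
    · change c.jetSymm (σ y) = _
      rw [← hσ hy hyc]
      exact c.jetSymm_jetCoords (j := jet 3 hy) hyc
  have hp : ∀ᶠ y in 𝓝 x, (c.wCoords (ψ y)).2 = c.legendre L η (c.wCoords (ψ y)).1 := by
    filter_upwards [c.eventually_section hφ hcx] with y ⟨hy, hyc⟩
    have h1 : c.wCoords (ψ y) = (σ y, c.legendre L η (σ y)) :=
      c.wCoords_wSymm_self (z := (σ y, c.legendre L η (σ y))) (hσ' hy hyc)
    rw [h1]
  have hc' : ψ x ∈ c.wSource := by rwa [hψx]
  have hd' : ψ x ∈ d.wSource := by rwa [hψx]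
  have h1 := hhol.legendre_of_omegaR_eq_zero η hL hd' (by
    filter_upwards [hhol.eventually hc', hhol.eventually hd', eventually_eventually_nhds.2 hp]
      with y ⟨hy, hcy⟩ ⟨_, hdy⟩ hpy X hX v
    exact hy.omegaR_eq_zero_of_legendre η hL hcy hpy X (wToE_mfderiv_eq_zero hcy hdy X hX) v)
  rw [hψx] at h1
  exact h1

theorem mem_legendreGraph_iff (hL : ContMDiff 𝓘(ℝ, JetCoord m n 2) 𝓘(ℝ, ℝ) ∞ L)
    {c : FiberedChart π} {w : RestrictedBundle π} (hc : w ∈ c.wSource) :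
    w ∈ legendreGraph L η ↔ (c.wCoords w).2 = c.legendre L η (c.wCoords w).1 :=
  ⟨fun h => h c hc, fun h _ hd => legendre_change η hL hc hd h⟩

end Invariance

/-! ### Vector fields tangent to the graph of the Legendre map -/

section TangentFields

set_option linter.unusedSectionVars false

variable {m n : ℕ} {M E : Type*}
  [TopologicalSpace M] [ChartedSpace (Rn m) M] [TopologicalSpace E] [ChartedSpace (Rn (m + n)) E]
  [IsManifold (𝓡 m) ∞ M] [IsManifold (𝓡 (m + n)) ∞ E]
  {π : FiberedManifold m n M E}

open FiberedChart

theorem contMDiff_toE : ContMDiff 𝓘(ℝ, WCoord m n) (𝓡 (m + n)) ∞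
    (fun w : RestrictedBundle π => w.jet.toE) := by
  intro w
  obtain ⟨c, hc⟩ := FiberedChart.exists_mem π w.jet.toE
  have hw : w ∈ c.wSource := hc
  have h1 : (fun w : RestrictedBundle π => w.jet.toE) =ᶠ[𝓝 w]
      c.chart.symm ∘ wToE ∘ c.wCoords := by
    filter_upwards [c.isOpen_wSource.mem_nhds hw] with w' hw'
    change _ = c.chart.symm (wToE (c.wCoords w'))
    rw [wToE_wCoords hw', c.chart.left_inv hw']
  refine ContMDiffAt.congr_of_eventuallyEq ?_ h1
  have hs : ContMDiffAt 𝓘(ℝ, Rn m × Rn n) (𝓡 (m + n)) ∞ c.chart.symm (wToE (c.wCoords w)) := by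
    refine c.smooth_chart_symm.contMDiffAt (c.chart.open_target.mem_nhds ?_)
    rw [wToE_wCoords hw]
    exact c.chart.map_source hc
  exact hs.comp w ((wToE (m := m) (n := n)).contDiff.contMDiff.contMDiffAt.comp w
    (c.contMDiffOn_wCoords.contMDiffAt (c.isOpen_wSource.mem_nhds hw)))

/-- The vector field with components `V` in a chart. -/
def FiberedChart.fieldOf (c : FiberedChart π) (V : WCoord m n → WCoord m n)
    (w : RestrictedBundle π) : TangentSpace 𝓘(ℝ, WCoord m n) w :=
  mfderiv 𝓘(ℝ, WCoord m n) 𝓘(ℝ, WCoord m n) (c.wSymm : _ → RestrictedBundle π) (c.wCoords w)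
    (V (c.wCoords w))

theorem FiberedChart.contMDiffOn_fieldOf (c : FiberedChart π) {V : WCoord m n → WCoord m n}
    (hV : ∀ z : WCoord m n, z.1 ∈ c.jetTarget 3 → ContDiffAt ℝ ∞ V z) :
    ContMDiffOn 𝓘(ℝ, WCoord m n) 𝓘(ℝ, WCoord m n).tangent ∞
      (fun w => (⟨w, c.fieldOf V w⟩ : TangentBundle 𝓘(ℝ, WCoord m n) (RestrictedBundle π)))
      c.wSource := by
  have hT := c.contMDiffOn_wSymm.contMDiffOn_tangentMapWithin (m := ∞) (by simp)
    c.isOpen_wTarget.uniqueMDiffOn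
  have hV' : ContMDiffOn 𝓘(ℝ, WCoord m n) 𝓘(ℝ, WCoord m n).tangent ∞
      (fun z => (⟨z, V z⟩ : TangentBundle 𝓘(ℝ, WCoord m n) (WCoord m n)))
      {z : WCoord m n | z.1 ∈ c.jetTarget 3} := fun z hz =>
    (contMDiffAt_vectorSpace_iff_contDiffAt.2 (hV z hz)).contMDiffWithinAt
  have h := hT.comp (hV'.comp c.contMDiffOn_wCoords fun w hw => c.wCoords_mem hw)
    fun w hw => c.wCoords_mem hw
  refine h.congr fun w hw => ?_
  have key : ∀ (w' : RestrictedBundle π) (_ : w' = w) (u : WCoord m n),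
      (⟨w, u⟩ : TangentBundle 𝓘(ℝ, WCoord m n) (RestrictedBundle π)) = ⟨w', u⟩ := by
    rintro w' rfl u
    rfl
  refine (key _ (c.wSymm_wCoords hw) _).trans ?_
  change _ = (⟨c.wSymm (c.wCoords w), mfderivWithin 𝓘(ℝ, WCoord m n) 𝓘(ℝ, WCoord m n)
    (c.wSymm : _ → RestrictedBundle π) {z : WCoord m n | z.1 ∈ c.jetTarget 3} (c.wCoords w)
    (V (c.wCoords w))⟩ : TangentBundle 𝓘(ℝ, WCoord m n) (RestrictedBundle π))
  rw [mfderivWithin_of_isOpen c.isOpen_wTarget (c.wCoords_mem hw)]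
  rfl

variable [T2Space E]

/-- A vector field on the domain of a chart, cut off by a function on `E`. -/
def FiberedChart.cutoffField (c : FiberedChart π) {V : WCoord m n → WCoord m n}
    (hV : ∀ z : WCoord m n, z.1 ∈ c.jetTarget 3 → ContDiffAt ℝ ∞ V z) {χ : E → ℝ}
    (hχ : ContMDiff (𝓡 (m + n)) 𝓘(ℝ, ℝ) ∞ χ) (hs : tsupport χ ⊆ c.chart.source) :
    SmoothVectorField (WCoord m n) (RestrictedBundle π) where
  field w := χ w.jet.toE • c.fieldOf V w
  smooth := by
    refine ContMDiffOn.smul_section_of_tsupport (s := c.fieldOf V)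
      (ψ := fun w : RestrictedBundle π => χ w.jet.toE) (hχ.comp contMDiff_toE).contMDiffOn
      c.isOpen_wSource ?_ (c.contMDiffOn_fieldOf hV)
    exact (tsupport_comp_subset_preimage χ contMDiff_toE.continuous).trans fun w hw => hs hw

variable {L : JetSpace π 2 → ℝ} (η : VolumeForm m M)

/-- The components of the lift of a constant vector field to the graph of the Legendre map. -/
def FiberedChart.legendreLift (L : JetSpace π 2 → ℝ) (c : FiberedChart π) (v : JetCoord m n 3)
    (z : WCoord m n) : WCoord m n :=
  (v, fderiv ℝ (c.legendre L η) z.1 v)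

theorem FiberedChart.contDiffAt_legendreLift (hL : ContMDiff 𝓘(ℝ, JetCoord m n 2) 𝓘(ℝ, ℝ) ∞ L)
    (c : FiberedChart π) (v : JetCoord m n 3) (z : WCoord m n) (hz : z.1 ∈ c.jetTarget 3) :
    ContDiffAt ℝ ∞ (c.legendreLift η L v) z := by
  refine contDiffAt_const.prodMk (ContDiffAt.clm_apply ?_ contDiffAt_const)
  exact ContDiffAt.comp (g := fderiv ℝ (c.legendre L η)) z
    ((contDiffAt_legendre η hL c hz).fderiv_right (by simp)) contDiffAt_fst

theorem FiberedChart.cutoffField_tangentTo (hL : ContMDiff 𝓘(ℝ, JetCoord m n 2) 𝓘(ℝ, ℝ) ∞ L)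
    (c : FiberedChart π) (v : JetCoord m n 3) {χ : E → ℝ}
    (hχ : ContMDiff (𝓡 (m + n)) 𝓘(ℝ, ℝ) ∞ χ) (hs : tsupport χ ⊆ c.chart.source) :
    (c.cutoffField (c.contDiffAt_legendreLift η hL v) hχ hs).TangentTo (legendreGraph L η) := by
  intro w hw
  by_cases hc : w ∈ c.wSource
  · set z := c.wCoords w with hz
    have hzt : z.1 ∈ c.jetTarget 3 := c.wCoords_mem hc
    set a := χ w.jet.toE
    let p : ℝ → JetCoord m n 3 := fun t => z.1 + t • a • v
    have hp0 : p 0 = z.1 := by simp [p]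
    have hp : ContDiff ℝ ∞ p := contDiff_const.add (contDiff_id.smul contDiff_const)
    have hpd : HasDerivAt p (a • v) 0 := by
      have h := ((hasDerivAt_id (0 : ℝ)).smul_const (a • v)).const_add z.1
      rw [one_smul] at h
      exact h
    have hpt : ∀ᶠ t in 𝓝 0, p t ∈ c.jetTarget 3 := by
      refine hp.continuous.continuousAt.eventually ((c.isOpen_jetTarget 3).mem_nhds ?_)
      rwa [hp0]
    let q : ℝ → WCoord m n := fun t => (p t, c.legendre L η (p t))
    have hq0 : q 0 = z := by
      refine Prod.ext hp0 ?_
      change c.legendre L η (p 0) = z.2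
      rw [hp0]
      exact ((mem_legendreGraph_iff η hL hc).1 hw).symm
    have hℓ := contDiffAt_legendre η hL c hzt
    have hq : ContDiffAt ℝ ∞ q 0 := by
      refine hp.contDiffAt.prodMk (ContDiffAt.comp (g := c.legendre L η) 0 ?_ hp.contDiffAt)
      rwa [hp0]
    have hqd : HasDerivAt q (a • c.legendreLift η L v z) 0 := by
      have h1 : HasFDerivAt (c.legendre L η) (fderiv ℝ (c.legendre L η) z.1) (p 0) := by
        rw [hp0]
        exact (hℓ.differentiableAt (by simp)).hasFDerivAt
      have h2 := hpd.prodMk (h1.comp_hasDerivAt 0 hpd)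
      rw [map_smul] at h2
      exact h2
    have hS : ContMDiffAt 𝓘(ℝ, WCoord m n) 𝓘(ℝ, WCoord m n) ∞
        (c.wSymm : _ → RestrictedBundle π) (q 0) := by
      rw [hq0]
      exact c.contMDiffOn_wSymm.contMDiffAt (c.isOpen_wTarget.mem_nhds hzt)
    refine ⟨fun t => c.wSymm (q t), ?_, ?_, hS.comp 0 hq.contMDiffAt, ?_⟩
    · change c.wSymm (q 0) = w
      rw [hq0, hz, c.wSymm_wCoords hc]
    · filter_upwards [hpt] with t ht
      have hqt : c.wCoords (c.wSymm (q t)) = q t := c.wCoords_wSymm_self (z := q t) ht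
      rw [mem_legendreGraph_iff η hL (c.wSymm_mem (z := q t) ht), hqt]
    · have h1 := mfderiv_comp (I := 𝓘(ℝ, ℝ)) (I' := 𝓘(ℝ, WCoord m n)) (I'' := 𝓘(ℝ, WCoord m n))
        (g := (c.wSymm : _ → RestrictedBundle π)) (f := q) 0 (hS.mdifferentiableAt (by simp))
        (hq.contMDiffAt.mdifferentiableAt (by simp))
      refine (DFunLike.congr_fun h1 (1 : ℝ)).trans ?_
      change mfderiv 𝓘(ℝ, WCoord m n) 𝓘(ℝ, WCoord m n) (c.wSymm : _ → RestrictedBundle π) (q 0)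
        (mfderiv 𝓘(ℝ, ℝ) 𝓘(ℝ, WCoord m n) q 0 (1 : ℝ)) = a • (mfderiv 𝓘(ℝ, WCoord m n)
          𝓘(ℝ, WCoord m n) (c.wSymm : _ → RestrictedBundle π) z (c.legendreLift η L v z) :
            WCoord m n)
      rw [mfderiv_eq_fderiv, hq0]
      have h2 : (fderiv ℝ q 0 (1 : ℝ) : WCoord m n) = a • c.legendreLift η L v z := by
        rw [fderiv_apply_one_eq_deriv, hqd.deriv]
      refine (congrArg (mfderiv 𝓘(ℝ, WCoord m n) 𝓘(ℝ, WCoord m n)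
        (c.wSymm : _ → RestrictedBundle π) z) h2).trans ?_
      exact map_smul _ _ _
  · have h0 : χ w.jet.toE = 0 :=
      image_eq_zero_of_notMem_tsupport fun h => hc (hs h)
    refine ⟨fun _ => w, rfl, Filter.Eventually.of_forall fun _ => hw, contMDiffAt_const, ?_⟩
    rw [mfderiv_const]
    exact ((congrArg (· • c.fieldOf (c.legendreLift η L v) w) h0).trans (zero_smul ℝ _)).symm

/-- At every point of `𝒲ᵣ` and for every tangent vector, there is a vector field tangent to the
graph of the Legendre map with the same projection to `J³π` at that point. -/
theorem exists_tangentTo_legendreGraph (hL : ContMDiff 𝓘(ℝ, JetCoord m n 2) 𝓘(ℝ, ℝ) ∞ L)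
    {c : FiberedChart π} {w : RestrictedBundle π} (hc : w ∈ c.wSource)
    (X : TangentSpace 𝓘(ℝ, WCoord m n) w) :
    ∃ Y : SmoothVectorField (WCoord m n) (RestrictedBundle π), Y.TangentTo (legendreGraph L η) ∧
      (mfderiv 𝓘(ℝ, WCoord m n) 𝓘(ℝ, WCoord m n) c.wCoords w (X - Y.field w)).1 = 0 := by
  obtain ⟨f, -, hf⟩ := (SmoothBumpFunction.nhds_basis_tsupport (I := 𝓡 (m + n)) w.jet.toE).mem_iff.1
    (c.chart.open_source.mem_nhds hc)
  let v : JetCoord m n 3 := (mfderiv 𝓘(ℝ, WCoord m n) 𝓘(ℝ, WCoord m n) c.wCoords w X).1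
  refine ⟨_, c.cutoffField_tangentTo η hL v f.contMDiff hf, ?_⟩
  have h1 : (c.cutoffField (c.contDiffAt_legendreLift η hL v) f.contMDiff hf).field w =
      c.fieldOf (c.legendreLift η L v) w := by
    change f w.jet.toE • c.fieldOf (c.legendreLift η L v) w = _
    rw [f.eq_one, one_smul]
  rw [h1, map_sub]
  exact sub_eq_zero.2 (congrArg Prod.fst
    (mfderiv_wCoords_mfderiv_wSymm hc (c.legendreLift η L v (c.wCoords w)))).symm

theorem HolonomicNear.omegaR_eq_zero_of_fst_eq_zero
    (hL : ContMDiff 𝓘(ℝ, JetCoord m n 2) 𝓘(ℝ, ℝ) ∞ L) {ψ : M → RestrictedBundle π} {φ : M → E}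
    {x : M} {c : FiberedChart π} (h : HolonomicNear ψ φ x) (hc : ψ x ∈ c.wSource)
    (X : TangentSpace 𝓘(ℝ, WCoord m n) (ψ x))
    (hX : (mfderiv 𝓘(ℝ, WCoord m n) 𝓘(ℝ, WCoord m n) c.wCoords (ψ x) X).1 = 0)
    (v : Fin m → TangentSpace (𝓡 m) x) :
    omegaR L η (ψ x) (Fin.cons X fun k => mfderiv (𝓡 m) 𝓘(ℝ, WCoord m n) ψ x (v k)) = 0 :=
  h.omegaR_eq_zero_of_basis η hL hc X (extDeriv_modelTheta_of_fst_eq_zero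
    (differentiableAt_lagrangian η hL (c.wCoords_mem hc)) (h.wToJ1_fderiv_coordRep hc) hX) v

theorem HolonomicNear.of_isHolonomicOn {ψ : M → RestrictedBundle π} {U : Set M} (hU : IsOpen U)
    (hψ : IsSectionOn ψ U) (hhol : IsHolonomicOn ψ U) {x : M} (hx : x ∈ U) :
    HolonomicNear ψ (fun y => (ψ y).jet.toE) x := by
  filter_upwards [hU.mem_nhds hx] with y hy
  exact ⟨hψ.1.contMDiffAt (hU.mem_nhds hy), hhol y hy⟩

end TangentFields

end FieldTheory

end

theorem mainTheorem4 {m n : ℕ} {M E : Type*}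
    [TopologicalSpace M] [ChartedSpace (Rn m) M] [IsManifold (𝓡 m) ∞ M] [T2Space M]
    [TopologicalSpace E] [ChartedSpace (Rn (m + n)) E] [IsManifold (𝓡 (m + n)) ∞ E] [T2Space E]
    (π : FiberedManifold m n M E) (η : VolumeForm m M)
    (L : JetSpace π 2 → ℝ) (hL : ContMDiff 𝓘(ℝ, JetCoord m n 2) 𝓘(ℝ, ℝ) ∞ L)
    (U : Set M) (hU : IsOpen U) (ψ : M → RestrictedBundle π)
    (hψ : IsSectionOn ψ U) (hhol : IsHolonomicOn ψ U) :
    (∀ X : SmoothVectorField (WCoord m n) (RestrictedBundle π), FieldEquation L η ψ U X) ↔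
      ∀ Y : SmoothVectorField (WCoord m n) (RestrictedBundle π),
        Y.TangentTo (legendreGraph L η) → FieldEquation L η ψ U Y := by
  refine ⟨fun h Y _ => h Y, fun h X x hx v => ?_⟩
  have hn := HolonomicNear.of_isHolonomicOn hU hψ hhol hx
  obtain ⟨c, hc⟩ := FiberedChart.exists_mem π (ψ x).jet.toE
  obtain ⟨Y, hY, hXY⟩ := exists_tangentTo_legendreGraph η hL (w := ψ x) hc (X.field (ψ x))
  have h1 := (omegaR L η (ψ x)).toMultilinearMap.cons_add
    (fun k => mfderiv (𝓡 m) 𝓘(ℝ, WCoord m n) ψ x (v k))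
    (X.field (ψ x) - Y.field (ψ x)) (Y.field (ψ x))
  rw [sub_add_cancel] at h1
  refine h1.trans ((congrArg₂ (· + ·)
    (hn.omegaR_eq_zero_of_fst_eq_zero η hL hc _ hXY v) (h Y hY x hx v)).trans (add_zero 0))
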